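/- **Setting.** Let $p\ge 1$, $H=\mathbb C^p\otimes L^2(0,\infty)=L^2((0,\infty);\mathbb C^p)$ (inner products linear in the second variable), and let $\Lambda:B(\mathbb C^p)\to B(H)$, $(\Lambda(A)F)(x)=e^{-x}AF(x)$; in $I-\Lambda$ the symbol $\Lambda$ means $\Lambda(I)$. Let $\mathfrak A=(I-\Lambda)^{1/2}B(H)(I-\Lambda)^{1/2}\subseteq B(H)$. A $b$-weight map is a linear map $\phi:\mathfrak A\to B(\mathbb C^p)$ such that $A\mapsto (f,\phi((I-\Lambda)^{1/2}A(I-\Lambda)^{1/2})g)$ is $\sigma$-weakly continuous on $B(H)$ for all $f,g\in\mathbb C^p$; it is bounded if $\sup\{\|\phi(A)\|:A\in\mathfrak A,\|A\|\le1\}<\infty$ in the operator norms. For linear maps, $\phi\ge\eta$ means that $\phi-\eta$ is completely positive. For $t>0$ let $E_t$ be the projection of $H$ onto functions supported in $[t,\infty)$, and $\phi|_t(A)=\phi(E_tAE_t)$ for $A\in B(H)$. A *$q$-weight map* over $\mathbb C^p$ is a completely positive $b$-weight map $\omega$ such that for each $t>0$ the map $\iota+\omega|_t\Lambda$ of $B(\mathbb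 C^p)$ is invertible ($\iota$ is the identity map) and $\pi^{\#}_t=(\iota+\omega|_t\Lambda)^{-1}\omega|_t:B(H)\to B(\mathbb C^p)$ is completely positive, contractive and normal. It has *index zero* if $\pi^{\#}_t(E_sAE_s)\to0$ as $t\to0+$ for all $s>0$, $A\in B(H)$. For $q$-weight maps $\omega,\eta$ with associated maps $\pi_t^\#,\psi_t^\#$, write $\omega\ge_q\eta$ (and call $\eta$ a $q$-subordinate of $\omega$) if $\pi_t^\#-\psi_t^\#$ is completely positive for all $t>0$. $\omega$ is *$q$-pure* if its $q$-subordinates are totally ordered by $\ge_q$. A linear map $\phi$ of $B(\mathbb C^p)$ is *conditionally positive* if $\phi(A^*)=\phi(A)^*$ for all $A$ and $\sum_{i,j}(f_i,\phi(A_i^*A_j)f_j)\ge0$ for all finite families $A_i\in B(\mathbb C^p)$, $f_i\in\mathbb C^p$ with $\sum_iA_if_i=0$; it is *conditionally negative* if $-\phi$ is conditionally positive, and *conditionally zero* if it is both. Let $\omega$ be a $q$-weight map over $\mathbb C^p$ of index zero with range $B(\mathbb C^p)$, and let $\omega=\psi^{-1}\vartheta$, where $\psi$ is a *coefficient map* of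 $\omega$ and $\vartheta$ the *corresponding limiting $b$-weight map*. This means: $\psi$ is an invertible conditionally negative linear map of $B(\mathbb C^p)$ whose inverse is completely positive; there are a countable set $J$, measurable functions $g_k$ on $(0,\infty)$ with $\sum_{k\in J}\int_0^\infty(1-e^{-x})|g_k(x)|^2dx<\infty$, and $h_{ik}\in H$ with $\sum_{k\in J}\|h_{ik}\|^2<\infty$ and $\sum_{i=1}^p(h_{ik})_i(x)=0$ for almost every $x$ ($1\le i\le p$, $k\in J$), such that the matrix entries $\vartheta_{ij}(A)=(e_i,\vartheta(A)e_j)$ are $$\vartheta_{ij}(A)=\sum_{k\in J}\big(g_{ik}+h_{ik},\,A(g_{jk}+h_{jk})\big)\qquad(A\in\mathfrak A),\qquad (g_{ik})_j(x)=\delta_{ij}g_k(x),$$ where $(F,AG)$ for $A=(I-\Lambda)^{1/2}B(I-\Lambda)^{1/2}$ is read as $((I-\Lambda)^{1/2}F,B(I-\Lambda)^{1/2}G)$; $w_t=\sum_k\int_t^\infty e^{-x}|g_k(x)|^2dx$ satisfies $1/w_t\to0$ as $t\to0+$; and $\psi(I)\ge\vartheta(I-\Lambda)$ and $\psi+\rho_\vartheta\Lambda$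 is conditionally negative, where $\rho_\vartheta:B(H)\to B(\mathbb C^p)$ is given by $(\rho_\vartheta)_{ij}(A)=\sum_{k}(h_{ik},Ah_{jk})$. **Theorem.** Under these assumptions $\omega$ is $q$-pure if and only if the following two conditions both hold: $\psi+\rho_\vartheta\Lambda$ is conditionally zero, and $\vartheta$ is *strictly infinite*, i.e. if $\eta$ is a bounded completely positive $B(\mathbb C^p)$-valued $b$-weight map on $\mathfrak A$ with $\vartheta\ge\eta$, then $\eta=0$. -/

import Mathlib

noncomputable section

namespace QWeight

open MeasureTheory Filter Topology
open scoped ComplexOrder InnerProductSpace ENNReal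

/-! ### The spaces -/

/-- Lebesgue measure on the half line `(0, ∞)`. -/
abbrev halfLine : Measure ℝ := volume.restrict (Set.Ioi (0 : ℝ))

/-- The Hilbert space `K = ℂ^p` (inner products are linear in the second variable). -/
abbrev Kp (p : ℕ) : Type := EuclideanSpace ℂ (Fin p)

/-- The Hilbert space `H = ℂ^p ⊗ L²(0, ∞)`, realised as `L²((0, ∞); ℂ^p)`. -/
abbrev Hp (p : ℕ) : Type := Lp (Kp p) 2 halfLine

/-- The algebra `B(ℂ^p)`. -/
abbrev BK (p : ℕ) : Type := Kp p →L[ℂ] Kp p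

/-- The algebra `B(ℂ^p ⊗ L²(0, ∞))`. -/
abbrev BH (p : ℕ) : Type := Hp p →L[ℂ] Hp p

/-- The `i`-th standard basis vector of `ℂ^p`. -/
abbrev basisVec {p : ℕ} (i : Fin p) : Kp p := EuclideanSpace.single i (1 : ℂ)

/-! ### Multiplication operators, `Λ`, and the cut-off projections -/

/-- Multiplication by an essentially bounded real function `φ` on `H`. -/
def mulOp {p : ℕ} (φ : ℝ → ℝ) (hφ : MemLp (fun x => (φ x : ℂ)) ∞ halfLine) : BH p :=
  LinearMap.mkContinuous
    { toFun := fun F => (hφ.toLp _ : Lp ℂ ∞ halfLine) • F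
      map_add' := fun F G => Lp.add_smul (hφ.toLp _ : Lp ℂ ∞ halfLine) F G
      map_smul' := fun c F => (Lp.smul_comm c (hφ.toLp _ : Lp ℂ ∞ halfLine) F).symm }
    ‖(hφ.toLp _ : Lp ℂ ∞ halfLine)‖
    (fun F => Lp.norm_smul_le (hφ.toLp _ : Lp ℂ ∞ halfLine) F)

theorem mulOp_ae {p : ℕ} (φ : ℝ → ℝ) (hφ : MemLp (fun x => (φ x : ℂ)) ∞ halfLine) (F : Hp p) :
    (mulOp φ hφ F : ℝ → Kp p) =ᵐ[halfLine] fun x => (φ x : ℂ) • F x := by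
  have h1 : (mulOp φ hφ F : ℝ → Kp p) =ᵐ[halfLine]
      ((hφ.toLp _ : Lp ℂ ∞ halfLine) : ℝ → ℂ) • (F : ℝ → Kp p) := Lp.coeFn_lpSMul _ F
  filter_upwards [h1, hφ.coeFn_toLp] with x hx hx'
  rw [hx, Pi.smul_apply', hx']

theorem mulOp_comp {p : ℕ} {φ χ θ : ℝ → ℝ} (hφ : MemLp (fun x => (φ x : ℂ)) ∞ halfLine)
    (hχ : MemLp (fun x => (χ x : ℂ)) ∞ halfLine) (hθ : MemLp (fun x => (θ x : ℂ)) ∞ halfLine)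
    (h : ∀ x, 0 < x → φ x * χ x = θ x) :
    (mulOp φ hφ : BH p) * mulOp χ hχ = mulOp θ hθ := by
  ext1 F
  apply Lp.ext
  filter_upwards [mulOp_ae φ hφ (mulOp χ hχ F), mulOp_ae χ hχ F, mulOp_ae θ hθ F,
    ae_restrict_mem measurableSet_Ioi] with x h1 h2 h3 h4
  rw [mul_apply_eq_comp, h1, h2, h3, smul_smul, ← h x h4]
  push_cast
  rfl

theorem memLp_of_bound {φ : ℝ → ℝ} (hm : Measurable φ) (C : ℝ)
    (hC : ∀ x, 0 < x → |φ x| ≤ C) : MemLp (fun x => (φ x : ℂ)) ∞ halfLine := by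
  refine MeasureTheory.memLp_top_of_bound (Complex.measurable_ofReal.comp hm).aestronglyMeasurable C ?_
  filter_upwards [ae_restrict_mem measurableSet_Ioi] with x hx
  simpa using hC x hx

theorem memLp_exp : MemLp (fun x => ((Real.exp (-x) : ℝ) : ℂ)) ∞ halfLine :=
  memLp_of_bound (by fun_prop) 1 (fun x hx => by
    rw [abs_of_pos (Real.exp_pos _)]
    exact Real.exp_le_one_iff.2 (by linarith))

/-- The function `√(1 - e^{-x})`. -/
def wt (x : ℝ) : ℝ := √(1 - Real.exp (-x))

theorem measurable_wt : Measurable wt := by unfold wt; fun_prop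

theorem wt_pos {x : ℝ} (hx : 0 < x) : 0 < wt x :=
  Real.sqrt_pos.2 (by
    have : Real.exp (-x) < 1 := Real.exp_lt_one_iff.2 (by linarith)
    linarith)

theorem memLp_wt : MemLp (fun x => (wt x : ℂ)) ∞ halfLine :=
  memLp_of_bound measurable_wt 1 (fun x _ => by
    rw [wt, abs_of_nonneg (Real.sqrt_nonneg _)]
    exact Real.sqrt_le_one.2 (by have := Real.exp_pos (-x); linarith))

theorem memLp_indicator (t : ℝ) :
    MemLp (fun x => (((Set.Ici t).indicator (fun _ => (1 : ℝ)) x : ℝ) : ℂ)) ∞ halfLine :=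
  memLp_of_bound (measurable_const.indicator measurableSet_Ici) 1 (fun x _ => by
    by_cases h : x ∈ Set.Ici t <;> simp [h])

theorem memLp_indicator_inv {t : ℝ} (ht : 0 < t) :
    MemLp (fun x => (((Set.Ici t).indicator (fun y => (wt y)⁻¹) x : ℝ) : ℂ)) ∞ halfLine :=
  memLp_of_bound (measurable_wt.inv.indicator measurableSet_Ici) (wt t)⁻¹ (fun x _ => by
    by_cases h : x ∈ Set.Ici t
    · rw [Set.indicator_of_mem h, abs_of_pos (inv_pos.2 (wt_pos (lt_of_lt_of_le ht h)))]
      refine inv_anti₀ (wt_pos ht) (Real.sqrt_le_sqrt ?_)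
      have : Real.exp (-x) ≤ Real.exp (-t) := Real.exp_le_exp.2 (neg_le_neg h)
      linarith
    · rw [Set.indicator_of_notMem h, abs_zero]
      exact (inv_pos.2 (wt_pos ht)).le)

/-- The mapping `Λ : B(ℂ^p) → B(H)`, `(Λ(A)F)(x) = e^{-x} A F(x)`. -/
def Lam (p : ℕ) : BK p →ₗ[ℂ] BH p where
  toFun A := mulOp (fun x => Real.exp (-x)) memLp_exp * A.compLpL 2 halfLine
  map_add' A B := by rw [ContinuousLinearMap.add_compLpL, mul_add]
  map_smul' c A := by rw [ContinuousLinearMap.smul_compLpL, mul_smul_comm]; rfl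

theorem Lam_ae {p : ℕ} (A : BK p) (F : Hp p) :
    (Lam p A F : ℝ → Kp p) =ᵐ[halfLine] fun x => (Real.exp (-x) : ℂ) • A (F x) := by
  filter_upwards [mulOp_ae (fun x => Real.exp (-x)) memLp_exp (A.compLpL 2 halfLine F),
    A.coeFn_compLpL F] with x h1 h2
  change (mulOp (fun x => Real.exp (-x)) memLp_exp (A.compLpL 2 halfLine F) : ℝ → Kp p) x = _
  rw [h1, h2]

/-- The positive square root `(I - Λ)^{1/2}`, i.e. multiplication by `√(1 - e^{-x})`. -/
def sqrtOp (p : ℕ) : BH p := mulOp wt memLp_wt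

theorem sqrtOp_mul_self (p : ℕ) : sqrtOp p * sqrtOp p = 1 - Lam p 1 := by
  ext1 F
  apply Lp.ext
  filter_upwards [mulOp_ae wt memLp_wt (sqrtOp p F), mulOp_ae wt memLp_wt F, Lam_ae 1 F,
    Lp.coeFn_sub F (Lam p 1 F), ae_restrict_mem measurableSet_Ioi] with x h1 h2 h3 h4 h5
  change (mulOp wt memLp_wt (sqrtOp p F) : ℝ → Kp p) x = (F - Lam p 1 F : Hp p) x
  change (sqrtOp p F : ℝ → Kp p) x = _ at h2
  have h6 : wt x * wt x = 1 - Real.exp (-x) :=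
    Real.mul_self_sqrt (by
      have h7 : (0 : ℝ) < x := h5
      have : Real.exp (-x) ≤ 1 := Real.exp_le_one_iff.2 (by linarith)
      linarith)
  rw [h1, h2, h4, Pi.sub_apply, h3, smul_smul, ← Complex.ofReal_mul, h6]
  simp [sub_smul]

/-- The projection `E(t, ∞)` of `H` onto the functions supported in `[t, ∞)`. -/
def cutProj (p : ℕ) (t : ℝ) : BH p :=
  mulOp ((Set.Ici t).indicator (fun _ => (1 : ℝ))) (memLp_indicator t)

/-- The linear map `B ↦ C B C` of `B(H)`. -/
def sandwich {p : ℕ} (C : BH p) : BH p →ₗ[ℂ] BH p where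
  toFun B := C * B * C
  map_add' A B := by rw [mul_add, add_mul]
  map_smul' c A := by rw [mul_smul_comm, smul_mul_assoc]; rfl

/-- `𝔄(ℂ^p)`: the operators `(I - Λ)^{1/2} B (I - Λ)^{1/2}` with `B ∈ B(H)`. -/
def frakA (p : ℕ) : Submodule ℂ (BH p) := LinearMap.range (sandwich (sqrtOp p))

/-- The map `B ↦ (I - Λ)^{1/2} B (I - Λ)^{1/2}` of `B(H)` onto `𝔄(ℂ^p)`. -/
def toFrakA (p : ℕ) : BH p →ₗ[ℂ] frakA p := (sandwich (sqrtOp p)).rangeRestrict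

theorem one_sub_Lam_mem (p : ℕ) : 1 - Lam p 1 ∈ frakA p :=
  ⟨1, by rw [← sqrtOp_mul_self]; simp [sandwich]⟩

/-- The element `I - Λ` of `𝔄(ℂ^p)`. -/
def oneSubLam (p : ℕ) : frakA p := ⟨1 - Lam p 1, one_sub_Lam_mem p⟩

theorem cutProj_sandwich_mem {p : ℕ} {t : ℝ} (ht : 0 < t) (A : BH p) :
    sandwich (cutProj p t) A ∈ frakA p := by
  have key : ∀ x : ℝ, 0 < x → wt x * (Set.Ici t).indicator (fun y => (wt y)⁻¹) x =
      (Set.Ici t).indicator (fun _ => (1 : ℝ)) x := fun x hx => by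
    by_cases h : x ∈ Set.Ici t
    · rw [Set.indicator_of_mem h, Set.indicator_of_mem h, mul_inv_cancel₀ (wt_pos hx).ne']
    · rw [Set.indicator_of_notMem h, Set.indicator_of_notMem h, mul_zero]
  have h1 : sqrtOp p * mulOp _ (memLp_indicator_inv ht) = cutProj p t :=
    mulOp_comp _ _ _ key
  have h2 : mulOp _ (memLp_indicator_inv ht) * sqrtOp p = cutProj p t :=
    mulOp_comp _ _ _ (fun x hx => by rw [mul_comm, key x hx])
  refine ⟨mulOp _ (memLp_indicator_inv ht) * A * mulOp _ (memLp_indicator_inv ht), ?_⟩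
  change sqrtOp p * (_ * A * _) * sqrtOp p = cutProj p t * A * cutProj p t
  nth_rewrite 1 [← h1]
  rw [← h2]
  simp only [mul_assoc]

/-- The map `A ↦ A|_t = E(t, ∞) A E(t, ∞)` of `B(H)` into `𝔄(ℂ^p)`, for `t > 0`
(set to `0` for the irrelevant values `t ≤ 0`). -/
def cut (p : ℕ) (t : ℝ) : BH p →ₗ[ℂ] frakA p :=
  if ht : 0 < t then (sandwich (cutProj p t)).codRestrict (frakA p) (cutProj_sandwich_mem ht)
  else 0

/-! ### Complete positivity, conditional positivity, normality -/

/-- An `n × n` matrix of operators is positive (as an operator on the `n`-fold direct sum). -/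
def MatrixPos {E : Type*} [NormedAddCommGroup E] [InnerProductSpace ℂ E] {n : ℕ}
    (A : Fin n → Fin n → (E →L[ℂ] E)) : Prop :=
  ∀ x : Fin n → E, 0 ≤ ∑ i, ∑ j, ⟪x i, A i j (x j)⟫_ℂ

/-- Complete positivity of a linear map defined on a subspace `V` of `B(E)`: applied entrywise it
takes positive operator matrices with entries in `V` to positive operator matrices, for all
sizes. -/
def IsCPOn {E F : Type*} [NormedAddCommGroup E] [InnerProductSpace ℂ E]
    [NormedAddCommGroup F] [InnerProductSpace ℂ F] {V : Submodule ℂ (E →L[ℂ] E)}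
    (φ : V →ₗ[ℂ] (F →L[ℂ] F)) : Prop :=
  ∀ (n : ℕ) (A : Fin n → Fin n → V),
    MatrixPos (fun i j => (A i j : E →L[ℂ] E)) → MatrixPos (fun i j => φ (A i j))

/-- Complete positivity of a linear map from `B(E)` to `B(F)`. -/
def IsCP {E F : Type*} [NormedAddCommGroup E] [InnerProductSpace ℂ E]
    [NormedAddCommGroup F] [InnerProductSpace ℂ F]
    (φ : (E →L[ℂ] E) →ₗ[ℂ] (F →L[ℂ] F)) : Prop :=
  ∀ (n : ℕ) (A : Fin n → Fin n → (E →L[ℂ] E)), MatrixPos A → MatrixPos (fun i j => φ (A i j))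

/-- A linear map of `B(ℂ^p)` is conditionally positive if it is hermitian and
`∑ (f_i, φ(A_i^* A_j) f_j) ≥ 0` whenever `∑ A_i f_i = 0`. -/
def ConditionallyPositive {p : ℕ} (φ : BK p →ₗ[ℂ] BK p) : Prop :=
  (∀ A, φ (star A) = star (φ A)) ∧
    ∀ (n : ℕ) (A : Fin n → BK p) (f : Fin n → Kp p), ∑ i, A i (f i) = 0 →
      0 ≤ ∑ i, ∑ j, ⟪f i, φ (star (A i) * A j) (f j)⟫_ℂ

def ConditionallyNegative {p : ℕ} (φ : BK p →ₗ[ℂ] BK p) : Prop :=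
  ConditionallyPositive (-φ)

def ConditionallyZero {p : ℕ} (φ : BK p →ₗ[ℂ] BK p) : Prop :=
  ConditionallyPositive φ ∧ ConditionallyPositive (-φ)

/-- `σ`-weakly continuous functionals on `B(H)`: those of the form `A ↦ ∑ (F_n, A G_n)` with
`∑ ‖F_n‖² < ∞` and `∑ ‖G_n‖² < ∞`. -/
def IsNormalFunctional {p : ℕ} (η : BH p → ℂ) : Prop :=
  ∃ F G : ℕ → Hp p, Summable (fun n => ‖F n‖ ^ 2) ∧ Summable (fun n => ‖G n‖ ^ 2) ∧
    ∀ A : BH p, HasSum (fun n => ⟪F n, A (G n)⟫_ℂ) (η A)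

/-- Normal (`σ`-weakly continuous) linear maps of `B(H)` into `B(ℂ^p)`. -/
def IsNormalMap {p : ℕ} (φ : BH p →ₗ[ℂ] BK p) : Prop :=
  ∀ f g : Kp p, IsNormalFunctional (fun A => ⟪f, φ A g⟫_ℂ)

/-- Membership in `B(ℂ^p) ⊗ 𝔄(ℂ^p)_*`, i.e. being a `B(ℂ^p)`-valued `b`-weight map: for all
`f, g`, the functional `A ↦ (f, ω((I - Λ)^{1/2} A (I - Λ)^{1/2}) g)` on `B(H)` is `σ`-weakly
continuous. -/
def IsBWeightMap {p : ℕ} (ω : frakA p →ₗ[ℂ] BK p) : Prop :=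
  IsNormalMap (ω ∘ₗ toFrakA p)

/-- Boundedness with respect to the ordinary operator norm on `𝔄(ℂ^p) ⊆ B(H)`. -/
def IsBoundedMap {p : ℕ} (η : frakA p →ₗ[ℂ] BK p) : Prop :=
  ∃ C : ℝ, ∀ A : frakA p, ‖η A‖ ≤ C * ‖(A : BH p)‖

/-- `ϑ` is strictly infinite: every bounded completely positive `b`-weight map `η` with
`ϑ ≥ η` (i.e. `ϑ - η` completely positive) vanishes. -/
def StrictlyInfinite {p : ℕ} (ϑ : frakA p →ₗ[ℂ] BK p) : Prop :=
  ∀ η : frakA p →ₗ[ℂ] BK p,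
    IsBWeightMap η → IsCPOn η → IsBoundedMap η → IsCPOn (ϑ - η) → η = 0

/-! ### `q`-weight maps -/

/-- The cut-off `ω|_t : A ↦ ω(E(t, ∞) A E(t, ∞))`, a map of `B(H)` into `B(ℂ^p)` (`t > 0`). -/
def cutMap {p : ℕ} (ω : frakA p →ₗ[ℂ] BK p) (t : ℝ) : BH p →ₗ[ℂ] BK p := ω ∘ₗ cut p t

/-- The mapping `ι + ω|_t Λ` of `B(ℂ^p)` into itself. -/
def iotaAdd {p : ℕ} (ω : frakA p →ₗ[ℂ] BK p) (t : ℝ) : Module.End ℂ (BK p) :=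
  1 + cutMap ω t ∘ₗ Lam p

/-- The generalized boundary representation `π_t^# = (ι + ω|_t Λ)^{-1} ω|_t` (`t > 0`). -/
def boundaryRep {p : ℕ} (ω : frakA p →ₗ[ℂ] BK p) (t : ℝ) : BH p →ₗ[ℂ] BK p :=
  (Ring.inverse (iotaAdd ω t) : Module.End ℂ (BK p)) ∘ₗ cutMap ω t

/-- `q`-weight maps over `ℂ^p`. -/
structure IsQWeightMap {p : ℕ} (ω : frakA p →ₗ[ℂ] BK p) : Prop where
  bweight : IsBWeightMap ω
  cp : IsCPOn ω
  invertible : ∀ t : ℝ, 0 < t → IsUnit (iotaAdd ω t)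
  rep_cp : ∀ t : ℝ, 0 < t → IsCP (boundaryRep ω t)
  rep_contractive : ∀ t : ℝ, 0 < t → ∀ A : BH p, ‖boundaryRep ω t A‖ ≤ ‖A‖
  rep_normal : ∀ t : ℝ, 0 < t → IsNormalMap (boundaryRep ω t)

/-- The order relation `ω ≥_q η` between `q`-weight maps. -/
def QGe {p : ℕ} (ω η : frakA p →ₗ[ℂ] BK p) : Prop :=
  ∀ t : ℝ, 0 < t → IsCP (boundaryRep ω t - boundaryRep η t)

/-- `η` is a `q`-subordinate of the `q`-weight map `ω`. -/
def IsQSubordinate {p : ℕ} (ω η : frakA p →ₗ[ℂ] BK p) : Prop :=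
  IsQWeightMap η ∧ QGe ω η

/-- `ω` is `q`-pure: its `q`-subordinates are totally ordered. -/
def IsQPure {p : ℕ} (ω : frakA p →ₗ[ℂ] BK p) : Prop :=
  ∀ η₁ η₂ : frakA p →ₗ[ℂ] BK p,
    IsQSubordinate ω η₁ → IsQSubordinate ω η₂ → QGe η₁ η₂ ∨ QGe η₂ η₁

/-- `σ` is the normal spine of `ω`: a normal completely positive map of `B(H)` into `B(ℂ^p)` with
`π_t^#|_s(A) → σ|_s(A)` as `t → 0+`, for all `s > 0` and `A ∈ B(H)`.  (All the usual topologies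
coincide on the finite-dimensional algebra `B(ℂ^p)`.) -/
structure IsNormalSpine {p : ℕ} (ω : frakA p →ₗ[ℂ] BK p) (σ : BH p →ₗ[ℂ] BK p) : Prop where
  cp : IsCP σ
  normal : IsNormalMap σ
  tendsto : ∀ s : ℝ, 0 < s → ∀ A : BH p,
    Tendsto (fun t => boundaryRep ω t (sandwich (cutProj p s) A)) (𝓝[>] (0 : ℝ))
      (𝓝 (σ (sandwich (cutProj p s) A)))

/-- `ω` is of index zero: its normal spine is zero. -/
def IndexZero {p : ℕ} (ω : frakA p →ₗ[ℂ] BK p) : Prop := IsNormalSpine ω 0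

/-! ### Coefficient maps and limiting `b`-weight maps -/

/-- Families `g_k`, `h_{ik}` (`k ∈ J`, `1 ≤ i ≤ p`) with `g_k ∈ L²_+(0, ∞)`, i.e.
`∫ (1 - e^{-x}) |g_k(x)|² dx < ∞`, and `h_{ik} ∈ ℂ^p ⊗ L²(0, ∞)`, such that
`∑_k (g_k, (I - Λ) g_k) < ∞`, `∑_k ‖h_{ik}‖² < ∞` and `∑_i (h_{ik})_i(x) = 0`. -/
structure StandardData (p : ℕ) (J : Type*) where
  g : J → ℝ → ℂ
  h : Fin p → J → Hp p
  g_mem : ∀ k, MemLp (fun x => (wt x : ℂ) * g k x) 2 halfLine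
  g_summable : Summable fun k => ∫ x in Set.Ioi (0 : ℝ), (1 - Real.exp (-x)) * ‖g k x‖ ^ 2
  h_summable : ∀ i, Summable fun k => ‖h i k‖ ^ 2
  h_trace : ∀ k, ∀ᵐ x ∂halfLine, ∑ i, h i k x i = 0

namespace StandardData

variable {p : ℕ} {J : Type*} (D : StandardData p J)

/-- The vector `(I - Λ)^{1/2} (g_{ik} + h_{ik}) ∈ H`, where `g_{ik}(x) = g_k(x) e_i`, that is
`(g_{ik})_j(x) = δ_{ij} g_k(x)`. -/
def vec (i : Fin p) (k : J) : Hp p :=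
  (ContinuousLinearMap.toSpanSingleton ℂ (basisVec i)).compLpL 2 halfLine ((D.g_mem k).toLp _) +
    sqrtOp p (D.h i k)

/-- `w_t = ∑_k (g_k, Λ|_t g_k)`. -/
def w (t : ℝ) : ℝ := ∑' k, ∫ x in Set.Ici t, Real.exp (-x) * ‖D.g k x‖ ^ 2

theorem summable_inner (A : BH p) (i j : Fin p) :
    Summable fun k => ⟪D.h i k, A (D.h j k)⟫_ℂ := by
  refine Summable.of_norm_bounded
    (g := fun k => ‖A‖ * (‖D.h i k‖ ^ 2 + ‖D.h j k‖ ^ 2))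
    (((D.h_summable i).add (D.h_summable j)).mul_left _) (fun k => ?_)
  calc ‖⟪D.h i k, A (D.h j k)⟫_ℂ‖ ≤ ‖D.h i k‖ * ‖A (D.h j k)‖ := norm_inner_le_norm _ _
    _ ≤ ‖D.h i k‖ * (‖A‖ * ‖D.h j k‖) := by gcongr; exact A.le_opNorm _
    _ = ‖A‖ * (‖D.h i k‖ * ‖D.h j k‖) := by ring
    _ ≤ ‖A‖ * (‖D.h i k‖ ^ 2 + ‖D.h j k‖ ^ 2) := by
      gcongr
      nlinarith [sq_nonneg (‖D.h i k‖ - ‖D.h j k‖), sq_nonneg (‖D.h i k‖),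
        sq_nonneg (‖D.h j k‖)]

/-- The bounded map `ρ` with matrix entries `ρ_{ij}(A) = ∑_k (h_{ik}, A h_{jk})`, on all of
`B(H)`. -/
def rho : BH p →ₗ[ℂ] BK p where
  toFun A := Matrix.toEuclideanCLM (𝕜 := ℂ) (Matrix.of fun i j => ∑' k, ⟪D.h i k, A (D.h j k)⟫_ℂ)
  map_add' A B := by
    rw [← map_add]
    congr 1
    ext i j
    simp only [Matrix.of_apply, Matrix.add_apply, add_apply, inner_add_right]
    exact (D.summable_inner A i j).tsum_add (D.summable_inner B i j)
  map_smul' c A := by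
    rw [RingHom.id_apply, ← map_smul]
    congr 1
    ext i j
    simp only [Matrix.of_apply, Matrix.smul_apply, smul_apply,
      inner_smul_right, smul_eq_mul]
    exact tsum_mul_left

theorem inner_rho (A : BH p) (i j : Fin p) :
    ⟪basisVec i, D.rho A (basisVec j)⟫_ℂ = ∑' k, ⟪D.h i k, A (D.h j k)⟫_ℂ := by
  simp [rho, EuclideanSpace.inner_single_left, Matrix.ofLp_toEuclideanCLM]

/-- `ϑ` has the form `ϑ_{ij}(A) = ∑_k (g_{ik} + h_{ik}, A (g_{jk} + h_{jk}))` for `A ∈ 𝔄(ℂ^p)`;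
for `A = (I - Λ)^{1/2} B (I - Λ)^{1/2}` the `k`-th term means
`((I - Λ)^{1/2} (g_{ik} + h_{ik}), B (I - Λ)^{1/2} (g_{jk} + h_{jk}))`. -/
def Represents (ϑ : frakA p →ₗ[ℂ] BK p) : Prop :=
  ∀ (B : BH p) (i j : Fin p), HasSum (fun k => ⟪D.vec i k, B (D.vec j k)⟫_ℂ)
    ⟪basisVec i, ϑ (toFrakA p B) (basisVec j)⟫_ℂ

end StandardData

/-- `ψ` is a coefficient map of `ω` and `ϑ` the corresponding limiting `b`-weight map, where `ϑ` is
given in its standard form by the data `D`: `ω = ψ^{-1} ϑ`, `ψ` is invertible and conditionally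
negative with completely positive inverse, `1 / w_t → 0` as `t → 0+`, `ψ(I) ≥ ϑ(I - Λ)`, and
`ψ + ρΛ` is conditionally negative. -/
structure IsCoefficientPair {p : ℕ} {J : Type*} (ω : frakA p →ₗ[ℂ] BK p) (ψ : BK p ≃ₗ[ℂ] BK p)
    (ϑ : frakA p →ₗ[ℂ] BK p) (D : StandardData p J) : Prop where
  eq : ω = (ψ.symm : BK p →ₗ[ℂ] BK p) ∘ₗ ϑ
  condNeg : ConditionallyNegative (ψ : BK p →ₗ[ℂ] BK p)
  inv_cp : IsCP (ψ.symm : BK p →ₗ[ℂ] BK p)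
  represents : D.Represents ϑ
  w_tendsto : Tendsto D.w (𝓝[>] (0 : ℝ)) atTop
  le_one : ϑ (oneSubLam p) ≤ ψ 1
  add_condNeg : ConditionallyNegative ((ψ : BK p →ₗ[ℂ] BK p) + D.rho ∘ₗ Lam p)

end QWeight

end

noncomputable section

namespace QWeight

open MeasureTheory Filter Topology
open scoped ComplexOrder InnerProductSpace ENNReal

/-! ### Completely positive maps: closure properties, hermiticity and norm bounds. -/

section CompletePositivity

variable {E F G : Type*} [NormedAddCommGroup E] [InnerProductSpace ℂ E]
  [NormedAddCommGroup F] [InnerProductSpace ℂ F] [NormedAddCommGroup G] [InnerProductSpace ℂ G]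

/-! The pair `(ψ, ϑ)` can be read off from the boundary representations by rescaling. In standard
form, `ψ(ι + ω|_t Λ) = ψ + ϑ|_t Λ`, and `ϑ|_t Λ(A) = w_t A + A X_t + X_t^* A + ρ|_t Λ(A)`, with
`‖X_t‖ = o(w_t)` and the last term bounded (`Represents.lamMap_eq`, `norm_cross_le`). Hence `w_t (ι
+ ω|_t Λ)^{-1} → ψ` as `t → 0+`. The order `≥_q` compares boundary representations at every `t`, so
multiplying by `w_t` and passing to the limit turns it into relations between coefficient maps and
between limiting `b`-weight maps.

Sufficiency. For a non-zero `q`-subordinate `η`, domination by `ω` and compactness give an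
invertible limit `φ` of `w_t (ι + η|_t Λ)^{-1}` along an ultrafilter (`exists_scaledLimit`). In the
limit `φ - ψ`, `κ = ϑ - φη` and `φ - ψ - κ|_s Λ` are completely positive; the last relation makes
`κ` bounded, so strict infiniteness gives `φη = ϑ`. Also `φ + ρΛ` is conditionally negative. If `ψ +
ρΛ` is conditionally zero, then `φ - ψ` is completely positive and conditionally negative, so it
equals `λι` (`IsCP.eq_smul_one`). Thus every non-zero subordinate comes from `(ψ + λι, ϑ)`, and the
resolvent identity orders these by `λ`.

Necessity. Suitable pairs `(ζ, κ)` produce a subordinate with data `(ψ + ζ, ϑ - κ)`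
(`exists_subordinate`). Complete positivity of the new inverses rests on `CondPos.exists_inverse`: a
conditionally negative map which dominates a map with completely positive inverse again has a
completely positive inverse. For `c > ‖ζ(1)‖`, comparing this subordinate with the one from `(ψ +
cι, ϑ)` in a `q`-pure `ω` can only go one way, and forces `ζ` to be conditionally negative and `κ =
0`. With `κ = 0` and `ζ` the completely positive part of `-(ψ + ρΛ)` this gives conditional
zeroness; with `κ` bounded below `ϑ` and `ζ` a limit of `κ|_t Λ` it gives strict infiniteness. -/

theorem inner_self_eq_ofReal (x : E) : ⟪x, x⟫_ℂ = ((‖x‖ ^ 2 : ℝ) : ℂ) := by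
  rw [inner_self_eq_norm_sq_to_K]; push_cast; rfl

theorem inner_self_nonneg_complex (x : E) : 0 ≤ ⟪x, x⟫_ℂ := by
  rw [inner_self_eq_ofReal]
  exact Complex.zero_le_real.2 (sq_nonneg _)

theorem MatrixPos.add {n : ℕ} {A B : Fin n → Fin n → (E →L[ℂ] E)} (hA : MatrixPos A)
    (hB : MatrixPos B) : MatrixPos (fun i j => A i j + B i j) := fun x => by
  simp only [add_apply, inner_add_right, Finset.sum_add_distrib]
  exact add_nonneg (hA x) (hB x)

theorem MatrixPos.smul {n : ℕ} {A : Fin n → Fin n → (E →L[ℂ] E)} (hA : MatrixPos A) {r : ℝ}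
    (hr : 0 ≤ r) : MatrixPos (fun i j => (r : ℂ) • A i j) := fun x => by
  simp only [smul_apply, inner_smul_right, ← Finset.mul_sum]
  exact mul_nonneg (by exact_mod_cast hr) (hA x)

theorem matrixPos_zero {n : ℕ} : MatrixPos (fun _ _ : Fin n => (0 : E →L[ℂ] E)) := fun x => by
  simp

theorem MatrixPos.of_tendsto {α : Type*} {l : Filter α} [l.NeBot] {n : ℕ}
    {A : α → Fin n → Fin n → (E →L[ℂ] E)} {B : Fin n → Fin n → (E →L[ℂ] E)}
    (hA : ∀ᶠ a in l, MatrixPos (A a)) (h : ∀ i j, Tendsto (fun a => A a i j) l (𝓝 (B i j))) :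
    MatrixPos B := fun x => by
  refine ge_of_tendsto (f := fun a => ∑ i, ∑ j, ⟪x i, A a i j (x j)⟫_ℂ) ?_
    (hA.mono fun a ha => ha x)
  refine tendsto_finsetSum _ fun i _ => tendsto_finsetSum _ fun j _ => ?_
  exact (tendsto_const_nhds).inner
    (((ContinuousLinearMap.apply ℂ E (x j)).continuous.tendsto _).comp (h i j))

theorem MatrixPos.conj [CompleteSpace E] {n : ℕ} {A : Fin n → Fin n → (E →L[ℂ] E)}
    (hA : MatrixPos A) (C : E →L[ℂ] E) : MatrixPos (fun i j => star C * A i j * C) := fun x => by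
  have := hA (fun i => C (x i))
  simpa [ContinuousLinearMap.star_eq_adjoint, ContinuousLinearMap.adjoint_inner_right] using this

theorem matrixPos_gram [CompleteSpace E] {n : ℕ} (A : Fin n → (E →L[ℂ] E)) :
    MatrixPos (fun i j => star (A i) * A j) := fun x => by
  have : ∑ i, ∑ j, ⟪x i, (star (A i) * A j) (x j)⟫_ℂ
      = ⟪∑ i, A i (x i), ∑ j, A j (x j)⟫_ℂ := by
    simp only [ContinuousLinearMap.star_eq_adjoint, ContinuousLinearMap.adjoint_inner_right,
      sum_inner, inner_sum, mul_apply_eq_comp]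
    exact Finset.sum_comm
  rw [this]
  exact inner_self_nonneg_complex _

theorem MatrixPos.of_single {n : ℕ} {A : Fin n → Fin n → (E →L[ℂ] E)} (hA : MatrixPos A)
    (i : Fin n) (x : E) : 0 ≤ ⟪x, A i i x⟫_ℂ := by
  have := hA (Pi.single i x)
  rw [Finset.sum_eq_single i, Finset.sum_eq_single i] at this
  · simpa using this
  · intro j _ hj; simp [Pi.single_eq_of_ne hj]
  · simp
  · intro j _ hj; simp [Pi.single_eq_of_ne hj]
  · simp

theorem matrixPos_one_iff {A : E →L[ℂ] E} :
    MatrixPos (fun _ _ : Fin 1 => A) ↔ ∀ x, 0 ≤ ⟪x, A x⟫_ℂ :=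
  ⟨fun h x => h.of_single 0 x, fun h x => by simpa using h (x 0)⟩

theorem IsCP.nonneg_of_nonneg {φ : (E →L[ℂ] E) →ₗ[ℂ] (F →L[ℂ] F)} (hφ : IsCP φ)
    {A : E →L[ℂ] E} (hA : ∀ x, 0 ≤ ⟪x, A x⟫_ℂ) (x : F) : 0 ≤ ⟪x, φ A x⟫_ℂ :=
  matrixPos_one_iff.1 (hφ 1 (fun _ _ => A) (matrixPos_one_iff.2 hA)) x

theorem IsCP.comp {φ : (E →L[ℂ] E) →ₗ[ℂ] (F →L[ℂ] F)} {χ : (F →L[ℂ] F) →ₗ[ℂ] (G →L[ℂ] G)}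
    (hχ : IsCP χ) (hφ : IsCP φ) : IsCP (χ ∘ₗ φ) := fun n A hA => hχ n _ (hφ n A hA)

theorem IsCP.mul {φ χ : Module.End ℂ (E →L[ℂ] E)}
    (hχ : IsCP χ) (hφ : IsCP φ) : IsCP (χ * φ) := fun n A hA => hχ n _ (hφ n A hA)

theorem isCP_one : IsCP (1 : Module.End ℂ (E →L[ℂ] E)) := fun _ _ hA => hA

theorem isCP_zero : IsCP (0 : (E →L[ℂ] E) →ₗ[ℂ] (F →L[ℂ] F)) := fun _ _ _ => matrixPos_zero

theorem IsCP.pow {φ : Module.End ℂ (E →L[ℂ] E)} (hφ : IsCP φ) (n : ℕ) : IsCP (φ ^ n) := by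
  induction n with
  | zero => exact isCP_one
  | succ n ih => rw [pow_succ]; exact ih.mul hφ

theorem IsCP.add {φ χ : (E →L[ℂ] E) →ₗ[ℂ] (F →L[ℂ] F)} (hφ : IsCP φ) (hχ : IsCP χ) :
    IsCP (φ + χ) := fun n A hA => (hφ n A hA).add (hχ n A hA)

theorem IsCP.smul {φ : (E →L[ℂ] E) →ₗ[ℂ] (F →L[ℂ] F)} (hφ : IsCP φ) {r : ℝ} (hr : 0 ≤ r) :
    IsCP ((r : ℂ) • φ) := fun n A hA => (hφ n A hA).smul hr

theorem IsCP.sum {ι : Type*} {s : Finset ι} {φ : ι → (E →L[ℂ] E) →ₗ[ℂ] (F →L[ℂ] F)}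
    (hφ : ∀ i ∈ s, IsCP (φ i)) : IsCP (∑ i ∈ s, φ i) :=
  Finset.sum_induction _ IsCP (fun _ _ h1 h2 => h1.add h2) isCP_zero hφ

theorem IsCP.of_tendsto {α : Type*} {l : Filter α} [l.NeBot]
    {φ : α → (E →L[ℂ] E) →ₗ[ℂ] (F →L[ℂ] F)} {χ : (E →L[ℂ] E) →ₗ[ℂ] (F →L[ℂ] F)}
    (hφ : ∀ᶠ a in l, IsCP (φ a)) (h : ∀ A, Tendsto (fun a => φ a A) l (𝓝 (χ A))) : IsCP χ :=
  fun n A hA => MatrixPos.of_tendsto (A := fun a i j => φ a (A i j)) (hφ.mono fun _ ha => ha n A hA)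
    (fun i j => h (A i j))

theorem isCP_conj [CompleteSpace E] (C : E →L[ℂ] E) :
    IsCP (LinearMap.mulLeft ℂ (star C) ∘ₗ LinearMap.mulRight ℂ C) := fun n A hA => by
  simpa [mul_assoc] using hA.conj C

theorem matrixPos_two {A B C D : E →L[ℂ] E}
    (h : ∀ x y, 0 ≤ ⟪x, A x⟫_ℂ + ⟪x, B y⟫_ℂ + (⟪y, C x⟫_ℂ + ⟪y, D y⟫_ℂ)) :
    MatrixPos (fun i j : Fin 2 => !![A, B; C, D] i j) := fun x => by
  simpa [Fin.sum_univ_two] using h (x 0) (x 1)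

theorem IsCP.two {φ : (E →L[ℂ] E) →ₗ[ℂ] (F →L[ℂ] F)} (hφ : IsCP φ) {A B C D : E →L[ℂ] E}
    (h : ∀ x y, 0 ≤ ⟪x, A x⟫_ℂ + ⟪x, B y⟫_ℂ + (⟪y, C x⟫_ℂ + ⟪y, D y⟫_ℂ)) (x y : F) :
    0 ≤ ⟪x, φ A x⟫_ℂ + ⟪x, φ B y⟫_ℂ + (⟪y, φ C x⟫_ℂ + ⟪y, φ D y⟫_ℂ) := by
  simpa [Fin.sum_univ_two] using hφ 2 _ (matrixPos_two h) ![x, y]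

theorem re_inner_le_opNorm (T : F →L[ℂ] F) (x : F) : (⟪x, T x⟫_ℂ).re ≤ ‖T‖ * ‖x‖ ^ 2 :=
  (Complex.re_le_norm _).trans ((norm_inner_le_norm _ _).trans (by
    nlinarith [T.le_opNorm x, norm_nonneg x]))

variable [CompleteSpace E] [CompleteSpace F]

/-- Completely positive maps are hermitian. -/
theorem IsCP.map_star {φ : (E →L[ℂ] E) →ₗ[ℂ] (F →L[ℂ] F)} (hφ : IsCP φ) (A : E →L[ℂ] E) :
    φ (star A) = star (φ A) := by
  have key : ∀ f g : F, (⟪f, φ A g⟫_ℂ + ⟪g, φ (star A) f⟫_ℂ).im = 0 := fun f g => by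
    -- The Gram matrix of `(1, A)` is positive. Its image has a real quadratic form, and removing
    -- the diagonal values leaves the off-diagonal sum.
    have h := hφ.two (A := 1) (B := A) (C := star A) (D := star A * A) (fun x y => by
      have : ⟪x, (1 : E →L[ℂ] E) x⟫_ℂ + ⟪x, A y⟫_ℂ
          + (⟪y, (star A) x⟫_ℂ + ⟪y, (star A * A) y⟫_ℂ) = ⟪x + A y, x + A y⟫_ℂ := by
        simp only [ContinuousLinearMap.star_eq_adjoint, ContinuousLinearMap.adjoint_inner_right,
          inner_add_left, inner_add_right, mul_apply_eq_comp, one_apply_eq_self]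
        ring
      rw [this]
      exact inner_self_nonneg_complex _)
    have h1 := (Complex.le_def.1 (h f g)).2
    have h2 := (Complex.le_def.1 (h f 0)).2
    have h3 := (Complex.le_def.1 (h 0 g)).2
    simp at h1 h2 h3 ⊢
    linarith
  ext f
  refine ext_inner_left ℂ fun g => ?_
  rw [ContinuousLinearMap.star_eq_adjoint (φ A), ContinuousLinearMap.adjoint_inner_right,
    ← inner_conj_symm (φ A g) f]
  have h1 := key f g
  -- Replacing `g` by `i g` supplies the real-part half of the identity.
  have h2 := key f (Complex.I • g)
  simp only [map_smul, inner_smul_left, inner_smul_right, Complex.add_im, Complex.mul_im,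
    Complex.conj_I, Complex.neg_re, Complex.neg_im, Complex.I_re, Complex.I_im] at h1 h2
  apply Complex.ext
  · rw [Complex.conj_re]; linarith
  · rw [Complex.conj_im]; linarith

/-- The block matrix with `‖A‖` on the diagonal and `A`, `A^*` off it is positive. Its image is
tested at `(-s φ(A) g, g)`, where `s = ‖g‖ / ‖φ(A) g‖` gives both entries the same norm. -/
theorem IsCP.norm_le_of_quad {φ : (E →L[ℂ] E) →ₗ[ℂ] (F →L[ℂ] F)} (hφ : IsCP φ) {c : ℝ}
    (hc : 0 ≤ c) (h1 : ∀ x, (⟪x, φ 1 x⟫_ℂ).re ≤ c * ‖x‖ ^ 2) (A : E →L[ℂ] E) :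
    ‖φ A‖ ≤ c * ‖A‖ := by
  refine ContinuousLinearMap.opNorm_le_bound _ (by positivity) fun g => ?_
  have h := hφ.two (A := (‖A‖ : ℂ) • 1) (B := A) (C := star A) (D := (‖A‖ : ℂ) • 1) (fun x y => by
    have e : ⟪y, star A x⟫_ℂ = (starRingEnd ℂ) ⟪x, A y⟫_ℂ := by
      rw [ContinuousLinearMap.star_eq_adjoint, ContinuousLinearMap.adjoint_inner_right,
        inner_conj_symm]
    have b : ‖⟪x, A y⟫_ℂ‖ ≤ ‖x‖ * (‖A‖ * ‖y‖) :=
      (norm_inner_le_norm _ _).trans (by gcongr; exact A.le_opNorm y)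
    have b' := (Complex.abs_re_le_norm _).trans b
    rw [e]
    simp only [smul_apply, one_apply_eq_self, inner_smul_right, inner_self_eq_ofReal]
    rw [Complex.le_def]
    constructor
    · simp only [Complex.add_re, Complex.re_ofReal_mul, Complex.ofReal_re, Complex.conj_re,
        Complex.zero_re]
      nlinarith [(abs_le.1 b').1, mul_nonneg (norm_nonneg A) (sq_nonneg (‖x‖ - ‖y‖))]
    · simp only [Complex.add_im, Complex.im_ofReal_mul, Complex.ofReal_im, Complex.conj_im,
        Complex.zero_im]
      ring)
  set y := φ A g with hy
  by_cases h0 : y = 0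
  · rw [h0, norm_zero]; positivity
  have hy0 : 0 < ‖y‖ := norm_pos_iff.2 h0
  set s : ℝ := ‖g‖ / ‖y‖ with hs
  have h2 := (Complex.le_def.1 (h (-(s : ℂ) • y) g)).1
  rw [hφ.map_star, ContinuousLinearMap.star_eq_adjoint,
    ContinuousLinearMap.adjoint_inner_right, ← hy] at h2
  have h3 := h1 (-(s : ℂ) • y)
  have h4 := h1 g
  rw [norm_smul, norm_neg, Complex.norm_real, Real.norm_eq_abs, mul_pow, sq_abs] at h3
  have h5 := inner_self_eq_ofReal y
  rw [map_smul φ (‖A‖ : ℂ), smul_apply, smul_apply, inner_smul_right _ _ (‖A‖ : ℂ),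
    inner_smul_right _ _ (‖A‖ : ℂ)] at h2
  simp only [Complex.add_re, Complex.re_ofReal_mul, Complex.zero_re] at h2
  have h6 : (⟪-(s : ℂ) • y, y⟫_ℂ).re = -(s * ‖y‖ ^ 2) := by
    rw [inner_smul_left, h5]; simp [-Complex.ofReal_pow]
  have h7 : (⟪y, -(s : ℂ) • y⟫_ℂ).re = -(s * ‖y‖ ^ 2) := by
    rw [inner_smul_right, h5]; simp [-Complex.ofReal_pow]
  rw [h6, h7] at h2
  have h8 : s * ‖y‖ ^ 2 = ‖g‖ * ‖y‖ := by rw [hs]; field_simp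
  have h9 : s ^ 2 * ‖y‖ ^ 2 = ‖g‖ ^ 2 := by rw [hs]; field_simp
  rw [h9] at h3
  rw [h8] at h2
  have h10 : ‖g‖ * ‖y‖ ≤ ‖g‖ * (c * ‖A‖ * ‖g‖) := by
    nlinarith [mul_le_mul_of_nonneg_left h3 (norm_nonneg A),
      mul_le_mul_of_nonneg_left h4 (norm_nonneg A)]
  by_cases hg : g = 0
  · rw [hy, hg, map_zero, norm_zero]; positivity
  · exact le_of_mul_le_mul_left h10 (norm_pos_iff.2 hg)

/-- As a quadratic form `φ(1)` lies below `χ(1)`. This is how bounds pass from `ω` to its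
subordinates. -/
theorem IsCP.norm_le_of_sub {φ χ : (E →L[ℂ] E) →ₗ[ℂ] (F →L[ℂ] F)} (hφ : IsCP φ)
    (h : IsCP (χ - φ)) (A : E →L[ℂ] E) : ‖φ A‖ ≤ ‖χ 1‖ * ‖A‖ := by
  refine hφ.norm_le_of_quad (norm_nonneg _) (fun x => ?_) A
  refine le_trans ?_ (re_inner_le_opNorm (χ 1) x)
  have h1 := h.nonneg_of_nonneg (A := 1) (fun x => by
    exact inner_self_nonneg_complex x) x
  have h2 := (Complex.le_def.1 h1).1
  simp only [LinearMap.sub_apply, sub_apply, inner_sub_right, Complex.sub_re,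
    Complex.zero_re] at h2
  linarith

end CompletePositivity

end QWeight

end

noncomputable section

namespace QWeight

open MeasureTheory Filter Topology
open scoped ComplexOrder InnerProductSpace ENNReal

section ConditionalPositivity

variable {E : Type*} [NormedAddCommGroup E] [InnerProductSpace ℂ E] [CompleteSpace E]

/-! ### Conditionally positive maps -/

/-- Conditional positivity of a linear map of `B(E)`. -/
def CondPos (φ : Module.End ℂ (E →L[ℂ] E)) : Prop :=
  (∀ A, φ (star A) = star (φ A)) ∧
    ∀ (n : ℕ) (A : Fin n → (E →L[ℂ] E)) (f : Fin n → E), ∑ i, A i (f i) = 0 →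
      0 ≤ ∑ i, ∑ j, ⟪f i, φ (star (A i) * A j) (f j)⟫_ℂ

theorem IsCP.condPos {φ : Module.End ℂ (E →L[ℂ] E)} (hφ : IsCP φ) : CondPos φ :=
  ⟨hφ.map_star, fun n A f _ => hφ n _ (matrixPos_gram A) f⟩

theorem CondPos.add {φ χ : Module.End ℂ (E →L[ℂ] E)} (hφ : CondPos φ)
    (hχ : CondPos χ) : CondPos (φ + χ) :=
  ⟨fun A => by simp [hφ.1, hχ.1], fun n A f h => by
    simp only [LinearMap.add_apply, add_apply, inner_add_right, Finset.sum_add_distrib]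
    exact add_nonneg (hφ.2 n A f h) (hχ.2 n A f h)⟩

theorem CondPos.smul {φ : Module.End ℂ (E →L[ℂ] E)} (hφ : CondPos φ)
    {r : ℝ} (hr : 0 ≤ r) : CondPos ((r : ℂ) • φ) :=
  ⟨fun A => by simp [hφ.1], fun n A f h => by
    simp only [LinearMap.smul_apply, smul_apply, inner_smul_right, ← Finset.mul_sum]
    exact mul_nonneg (Complex.zero_le_real.2 hr) (hφ.2 n A f h)⟩

theorem CondPos.of_tendsto {α : Type*} {l : Filter α} [l.NeBot]
    {φ : α → Module.End ℂ (E →L[ℂ] E)} {χ : Module.End ℂ (E →L[ℂ] E)}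
    (hφ : ∀ᶠ a in l, CondPos (φ a))
    (h : ∀ A, Tendsto (fun a => φ a A) l (𝓝 (χ A))) : CondPos χ := by
  refine ⟨fun A => ?_, fun n A f hA => ?_⟩
  · refine tendsto_nhds_unique_of_eventuallyEq (h (star A))
      ((continuous_star.tendsto _).comp (h A)) (hφ.mono fun a ha => ha.1 A)
  · refine ge_of_tendsto (f := fun a => ∑ i, ∑ j, ⟪f i, φ a (star (A i) * A j) (f j)⟫_ℂ) ?_
      (hφ.mono fun a ha => ha.2 n A f hA)
    refine tendsto_finsetSum _ fun i _ => tendsto_finsetSum _ fun j _ => ?_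
    exact (tendsto_const_nhds).inner
      (((ContinuousLinearMap.apply ℂ (E) (f j)).continuous.tendsto _).comp (h _))

/-- The map `A ↦ A X + X^* A`. -/
def derivMap (X : E →L[ℂ] E) : Module.End ℂ (E →L[ℂ] E) :=
  LinearMap.mulRight ℂ X + LinearMap.mulLeft ℂ (star X)

theorem derivMap_apply (X A : E →L[ℂ] E) : derivMap X A = A * X + star X * A := rfl

theorem neg_derivMap (X : E →L[ℂ] E) : -derivMap X = derivMap (-X) := by
  ext1 A
  simp only [derivMap_apply, LinearMap.neg_apply, star_neg, mul_neg, neg_mul, neg_add]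

/-- Each half of the quadratic form has `∑ A_i f_i = 0` as one of its factors. With `neg_derivMap`,
these maps can be added or subtracted freely in conditional positivity arguments. -/
theorem condPos_derivMap (X : E →L[ℂ] E) : CondPos (derivMap X) := by
  refine ⟨fun A => ?_, fun n A f hA => ?_⟩
  · simp [derivMap_apply, add_comm]
  · have : ∑ i, ∑ j, ⟪f i, derivMap X (star (A i) * A j) (f j)⟫_ℂ
        = ⟪∑ i, A i (f i), ∑ j, A j (X (f j))⟫_ℂ + ⟪∑ i, A i (X (f i)), ∑ j, A j (f j)⟫_ℂ := by
      simp only [sum_inner, inner_sum, derivMap_apply, add_apply, inner_add_right,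
        Finset.sum_add_distrib]
      congr 1
      · rw [Finset.sum_comm]
        simp [ContinuousLinearMap.star_eq_adjoint, ContinuousLinearMap.adjoint_inner_right]
      · rw [Finset.sum_comm]
        simp [ContinuousLinearMap.star_eq_adjoint, ContinuousLinearMap.adjoint_inner_right]
    rw [this, hA]
    simp

theorem condPos_neg_derivMap (X : E →L[ℂ] E) : CondPos (-derivMap X) := by
  rw [neg_derivMap]; exact condPos_derivMap _

theorem smul_one_eq_derivMap (c : ℝ) :
    (c : ℂ) • (1 : Module.End ℂ (E →L[ℂ] E)) = derivMap (((c / 2 : ℝ) : ℂ) • 1) := by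
  ext1 A
  have : star (((c / 2 : ℝ) : ℂ) • (1 : E →L[ℂ] E)) = ((c / 2 : ℝ) : ℂ) • 1 := by
    rw [star_smul, star_one]
    congr 1
    exact Complex.conj_ofReal _
  rw [derivMap_apply, this, LinearMap.smul_apply, Module.End.one_apply,
    mul_smul_comm, smul_mul_assoc, mul_one, one_mul, ← add_smul]
  congr 1
  push_cast
  ring

theorem condPos_smul_one (c : ℝ) : CondPos ((c : ℂ) • (1 : Module.End ℂ (E →L[ℂ] E))) := by
  rw [smul_one_eq_derivMap]; exact condPos_derivMap _

/-- A completely positive, conditionally negative map is a multiple of the identity. -/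
theorem IsCP.eq_smul_one {ζ : Module.End ℂ (E →L[ℂ] E)} (hζ : IsCP ζ)
    (hn : CondPos (-ζ)) [Nontrivial E] :
    ∃ c : ℝ, 0 ≤ c ∧ ζ = (c : ℂ) • 1 := by
  -- Complete positivity at `(1, B, 1)` with vectors `(f, zg, -zBg)` gives a real polynomial in `z`.
  -- Its `|z|²` coefficient is nonpositive by conditional negativity at `(B, 1)`, `(g, -Bg)`. The
  -- affine part is therefore nonnegative for every `z`, so its linear coefficient vanishes.
  have hmul : ∀ (B : E →L[ℂ] E) (f g : E), ⟪f, ζ B g⟫_ℂ = ⟪f, ζ 1 (B g)⟫_ℂ := fun B f g => by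
    have hz := hn.2 2 ![B, 1] ![g, -(B g)] (by simp [Fin.sum_univ_two])
    have hpos : ∀ z : ℂ, 0 ≤ (z * (⟪f, ζ B g⟫_ℂ - ⟪f, ζ 1 (B g)⟫_ℂ)
        + (starRingEnd ℂ) z * (⟪g, ζ (star B) f⟫_ℂ - ⟪B g, ζ 1 f⟫_ℂ) + ⟪f, ζ 1 f⟫_ℂ).re := by
      intro z
      have h3 := hζ 3 _ (matrixPos_gram ![1, B, 1]) ![f, z • g, -(z • B g)]
      have e : ∑ i : Fin 3, ∑ j : Fin 3, ⟪(![f, z • g, -(z • B g)] : Fin 3 → E) i,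
            ζ (star ((![1, B, 1] : Fin 3 → (E →L[ℂ] E)) i) * (![1, B, 1] : Fin 3 → (E →L[ℂ] E)) j)
              ((![f, z • g, -(z • B g)] : Fin 3 → E) j)⟫_ℂ
          = z * (⟪f, ζ B g⟫_ℂ - ⟪f, ζ 1 (B g)⟫_ℂ)
            + (starRingEnd ℂ) z * (⟪g, ζ (star B) f⟫_ℂ - ⟪B g, ζ 1 f⟫_ℂ) + ⟪f, ζ 1 f⟫_ℂ
            - (starRingEnd ℂ) z * z * ∑ i : Fin 2, ∑ j : Fin 2,
              ⟪(![g, -(B g)] : Fin 2 → E) i,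
              (-ζ) (star ((![B, 1] : Fin 2 → (E →L[ℂ] E)) i) * (![B, 1] : Fin 2 → (E →L[ℂ] E)) j)
                ((![g, -(B g)] : Fin 2 → E) j)⟫_ℂ := by
        simp [Fin.sum_univ_three, Fin.sum_univ_two, inner_smul_left, inner_smul_right]
        ring
      rw [e] at h3
      have h4 := (Complex.le_def.1 h3).1
      have h5 := (Complex.le_def.1 (mul_nonneg (star_mul_self_nonneg z) hz)).1
      rw [Complex.sub_re] at h4
      simp only [Complex.zero_re] at h4 h5
      have h6 : star z = (starRingEnd ℂ) z := rfl
      rw [h6] at h5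
      linarith
    have hherm : ⟪g, ζ (star B) f⟫_ℂ - ⟪B g, ζ 1 f⟫_ℂ
        = (starRingEnd ℂ) (⟪f, ζ B g⟫_ℂ - ⟪f, ζ 1 (B g)⟫_ℂ) := by
      have h1 : star (ζ 1) = ζ 1 := by rw [← hζ.map_star, star_one]
      rw [hζ.map_star, map_sub, inner_conj_symm, inner_conj_symm,
        ContinuousLinearMap.star_eq_adjoint, ContinuousLinearMap.adjoint_inner_right]
      congr 1
      nth_rewrite 1 [← h1]
      rw [ContinuousLinearMap.star_eq_adjoint, ContinuousLinearMap.adjoint_inner_right]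
    set w := ⟪f, ζ B g⟫_ℂ - ⟪f, ζ 1 (B g)⟫_ℂ with hw
    by_contra hne
    have hw0 : w ≠ 0 := sub_ne_zero.2 hne
    have hn0 : 0 < Complex.normSq w := Complex.normSq_pos.2 hw0
    -- With `q = (f, ζ(1) f) ≥ 0`, this `z` makes the affine expression equal to `-2(q + 1) + q <
    -- 0`.
    have h7 := hpos (-(((⟪f, ζ 1 f⟫_ℂ).re + 1) / Complex.normSq w : ℝ) * (starRingEnd ℂ) w)
    rw [hherm] at h7
    have e1 : ∀ s : ℝ, ((-(s : ℂ) * (starRingEnd ℂ) w) * w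
        + (starRingEnd ℂ) (-(s : ℂ) * (starRingEnd ℂ) w) * (starRingEnd ℂ) w
        + ⟪f, ζ 1 f⟫_ℂ).re = -2 * (s * Complex.normSq w) + (⟪f, ζ 1 f⟫_ℂ).re := fun s => by
      simp [Complex.normSq_apply]
      ring
    rw [e1, div_mul_cancel₀ _ hn0.ne'] at h7
    have h8 := (Complex.le_def.1 (hζ.nonneg_of_nonneg (A := 1) inner_self_nonneg_complex f)).1
    simp only [Complex.zero_re] at h8
    linarith
  have hB : ∀ B : E →L[ℂ] E, ζ B = ζ 1 * B := fun B => by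
    ext1 g
    exact ext_inner_left ℂ fun f => hmul B f g
  have hcomm : ∀ B : E →L[ℂ] E, Commute B (ζ 1) := fun B => by
    have h1 : star (ζ 1) = ζ 1 := by rw [← hζ.map_star, star_one]
    have h2 := congrArg star (hB (star B))
    rw [hζ.map_star, star_star, star_mul, star_star, h1, hB B] at h2
    exact h2.symm
  obtain ⟨e, he⟩ := exists_ne (0 : E)
  set c : ℂ := ⟪e, ζ 1 e⟫_ℂ / ⟪e, e⟫_ℂ with hc
  -- Commuting with the rank-one operators `x ↦ (e, x) f` makes `ζ(1)` a scalar.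
  have hsc : ∀ f : E, ζ 1 f = c • f := fun f => by
    have h1 := congrArg (fun T : E →L[ℂ] E => ⟪f, T e⟫_ℂ)
      (hcomm ((innerSL ℂ e).smulRight f))
    have h2 : ((innerSL ℂ e).smulRight f) (ζ 1 e) = ζ 1 (((innerSL ℂ e).smulRight f) e) :=
      congrArg (fun T : E →L[ℂ] E => T e) (hcomm ((innerSL ℂ e).smulRight f))
    simp only [ContinuousLinearMap.smulRight_apply, innerSL_apply_apply, map_smul] at h2
    rw [hc, div_eq_inv_mul, mul_smul, h2, smul_smul, inv_mul_cancel₀ (inner_self_ne_zero.2 he),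
      one_smul]
  have hc0 : 0 ≤ c := by
    have h1 := hζ.nonneg_of_nonneg (A := 1) inner_self_nonneg_complex e
    rw [hc, inner_self_eq_ofReal, div_eq_mul_inv, ← Complex.ofReal_inv]
    exact mul_nonneg h1 (Complex.zero_le_real.2 (inv_nonneg.2 (sq_nonneg _)))
  refine ⟨c.re, (Complex.le_def.1 hc0).1, ?_⟩
  have hcre : ((c.re : ℝ) : ℂ) = c := by
    apply Complex.ext
    · simp
    · simpa using (Complex.le_def.1 hc0).2
  ext1 B
  rw [hB, hcre]
  ext1 f
  simp [hsc]

end ConditionalPositivity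

/-! ### Neumann series for completely positive maps. -/

section FiniteDimensional

theorem norm_pow_apply_le {E : Type*} [NormedAddCommGroup E] [InnerProductSpace ℂ E]
    {T : Module.End ℂ (E →L[ℂ] E)} {r : ℝ} (hr : 0 ≤ r)
    (h : ∀ A, ‖T A‖ ≤ r * ‖A‖) (n : ℕ) (A : E →L[ℂ] E) : ‖(T ^ n) A‖ ≤ r ^ n * ‖A‖ := by
  induction n with
  | zero => simp
  | succ n ih =>
    rw [pow_succ', Module.End.mul_apply, pow_succ', mul_assoc]
    exact (h _).trans (by gcongr)

variable {E : Type*} [NormedAddCommGroup E] [InnerProductSpace ℂ E] [FiniteDimensional ℂ E]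

theorem exists_norm_apply_le (T : Module.End ℂ (E →L[ℂ] E)) : ∃ C : ℝ, 0 ≤ C ∧ ∀ A, ‖T A‖ ≤ C * ‖A‖ :=
  ⟨‖LinearMap.toContinuousLinearMap T‖, ContinuousLinearMap.opNorm_nonneg _,
    (LinearMap.toContinuousLinearMap T).le_opNorm⟩

theorem tendsto_end_apply {α : Type*} {l : Filter α} (T : Module.End ℂ (E →L[ℂ] E)) {a : α → (E →L[ℂ] E)}
    {b : E →L[ℂ] E} (h : Tendsto a l (𝓝 b)) : Tendsto (fun x => T (a x)) l (𝓝 (T b)) :=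
  ((LinearMap.continuous_of_finiteDimensional T).tendsto b).comp h

/-- A left inverse of `1 - T`, with `T` completely positive and of norm less than `1`, is
completely positive. -/
theorem isCP_of_mul_one_sub {T U : Module.End ℂ (E →L[ℂ] E)} (hT : IsCP T) {r : ℝ} (hr : 0 ≤ r)
    (hr1 : r < 1) (h : ∀ A, ‖T A‖ ≤ r * ‖A‖) (hU : U * (1 - T) = 1) : IsCP U := by
  refine IsCP.of_tendsto (l := atTop) (φ := fun N : ℕ => ∑ n ∈ Finset.range N, T ^ n)
    (Eventually.of_forall fun N => IsCP.sum fun n _ => hT.pow n) fun A => ?_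
  have e : ∀ N, (∑ n ∈ Finset.range N, T ^ n) A = U A - U ((T ^ N) A) := fun N => by
    have : ∑ n ∈ Finset.range N, T ^ n = U - U * T ^ N := by
      rw [← one_mul (∑ n ∈ Finset.range N, T ^ n), ← hU, mul_assoc, mul_neg_geom_sum, mul_sub,
        mul_one]
    rw [this]; rfl
  have h0 : Tendsto (fun N => (T ^ N) A) atTop (𝓝 0) := by
    refine squeeze_zero_norm (norm_pow_apply_le hr h · A) ?_
    simpa using (tendsto_pow_atTop_nhds_zero_of_lt_one hr hr1).mul_const ‖A‖
  simp only [e]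
  simpa using (tendsto_const_nhds (x := U A)).sub (tendsto_end_apply U h0)

theorem exists_mul_one_sub {T : Module.End ℂ (E →L[ℂ] E)} {r : ℝ}
    (hr1 : r < 1) (h : ∀ A, ‖T A‖ ≤ r * ‖A‖) : ∃ U : Module.End ℂ (E →L[ℂ] E), U * (1 - T) = 1 := by
  have : IsUnit (1 - T) := by
    rw [LinearMap.isUnit_iff_ker_eq_bot, LinearMap.ker_eq_bot']
    intro A hA
    have h1 : A = T A := sub_eq_zero.1 hA
    have h2 := h A
    rw [← h1] at h2
    exact norm_le_zero_iff.1 (by nlinarith [norm_nonneg A])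
  obtain ⟨u, hu⟩ := this
  exact ⟨↑u⁻¹, by rw [← hu]; exact u.inv_mul⟩

end FiniteDimensional

end QWeight

end

noncomputable section

namespace QWeight

open MeasureTheory Filter Topology
open scoped ComplexOrder InnerProductSpace ENNReal

/-! ### Positive operator matrices as sums of Gram matrices. -/

section Gram

variable {E : Type*} [NormedAddCommGroup E] [InnerProductSpace ℂ E]

/-- The operator on the `n`-fold direct sum given by an operator matrix. -/
def blockOp {n : ℕ} (A : Fin n → Fin n → (E →L[ℂ] E)) :
    PiLp 2 (fun _ : Fin n => E) →L[ℂ] PiLp 2 (fun _ : Fin n => E) :=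
  ((PiLp.continuousLinearEquiv 2 ℂ (fun _ : Fin n => E)).symm : (Fin n → E) →L[ℂ] _) ∘L
    (ContinuousLinearMap.pi fun i => ∑ j, A i j ∘L PiLp.proj 2 (fun _ : Fin n => E) j)

theorem inner_blockOp {n : ℕ} (A : Fin n → Fin n → (E →L[ℂ] E)) (x y : PiLp 2 (fun _ : Fin n => E)) :
    ⟪x, blockOp A y⟫_ℂ = ∑ i, ∑ j, ⟪x i, A i j (y j)⟫_ℂ := by
  rw [PiLp.inner_apply]
  refine Finset.sum_congr rfl fun i _ => ?_
  rw [← inner_sum]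
  congr 1
  simp [blockOp]

variable [CompleteSpace E]

theorem star_ofReal_smul (r : ℝ) (A : E →L[ℂ] E) : star ((r : ℂ) • A) = (r : ℂ) • star A := by
  rw [star_smul]
  congr 1
  exact Complex.conj_ofReal _

theorem exists_eq_star_mul_self {T : E →L[ℂ] E} (hT : ∀ x, 0 ≤ ⟪x, T x⟫_ℂ) :
    ∃ S : E →L[ℂ] E, T = star S * S := by
  refine CStarAlgebra.nonneg_iff_eq_star_mul_self.1 ?_
  rw [ContinuousLinearMap.nonneg_iff_isPositive, ContinuousLinearMap.isPositive_iff_complex]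
  intro x
  have h1 := Complex.le_def.1 (hT x)
  have h2 : ⟪T x, x⟫_ℂ = ⟪x, T x⟫_ℂ := by
    rw [← inner_conj_symm]
    exact Complex.conj_eq_iff_im.2 h1.2.symm
  rw [h2]
  refine ⟨?_, h1.1⟩
  apply Complex.ext
  · simp
  · simpa using h1.2

/-- Factor the block operator as `S^* S` and read off the block entries of `S`. This lets complete
positivity be tested on matrices `A_i^* A_j`, the form occurring in conditional positivity. -/
theorem MatrixPos.exists_gram {n : ℕ} {A : Fin n → Fin n → (E →L[ℂ] E)} (hA : MatrixPos A) :
    ∃ B : Fin n → Fin n → (E →L[ℂ] E), ∀ i j, A i j = ∑ l, star (B l i) * B l j := by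
  obtain ⟨S, hS⟩ := exists_eq_star_mul_self (T := blockOp A) fun x => by
    rw [inner_blockOp]; exact hA x
  let inj : Fin n → E →L[ℂ] PiLp 2 (fun _ : Fin n => E) := fun i =>
    ((PiLp.continuousLinearEquiv 2 ℂ (fun _ : Fin n => E)).symm : (Fin n → E) →L[ℂ] _) ∘L
      ContinuousLinearMap.single ℂ (fun _ : Fin n => E) i
  refine ⟨fun l i => PiLp.proj 2 (fun _ : Fin n => E) l ∘L S ∘L inj i, fun i j => ?_⟩
  ext1 y
  refine ext_inner_left ℂ fun x => ?_
  have e1 : ⟪inj i x, blockOp A (inj j y)⟫_ℂ = ⟪x, A i j y⟫_ℂ := by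
    rw [inner_blockOp, Finset.sum_eq_single i, Finset.sum_eq_single j]
    · simp [inj]
    · intro k _ hk; simp [inj, hk]
    · simp
    · intro k _ hk; simp [inj, hk]
    · simp
  rw [← e1, hS, mul_apply_eq_comp, ContinuousLinearMap.star_eq_adjoint,
    ContinuousLinearMap.adjoint_inner_right, PiLp.inner_apply, sum_apply, inner_sum]
  refine Finset.sum_congr rfl fun l _ => ?_
  rw [mul_apply_eq_comp, ContinuousLinearMap.star_eq_adjoint,
    ContinuousLinearMap.adjoint_inner_right]
  rfl

theorem isCP_of_gram {φ : Module.End ℂ (E →L[ℂ] E)}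
    (h : ∀ (n : ℕ) (A : Fin n → (E →L[ℂ] E)) (f : Fin n → E),
      0 ≤ ∑ i, ∑ j, ⟪f i, φ (star (A i) * A j) (f j)⟫_ℂ) : IsCP φ := fun n A hA x => by
  obtain ⟨B, hB⟩ := hA.exists_gram
  have : ∑ i, ∑ j, ⟪x i, φ (A i j) (x j)⟫_ℂ
      = ∑ l, ∑ i, ∑ j, ⟪x i, φ (star (B l i) * B l j) (x j)⟫_ℂ := by
    simp only [hB, map_sum, sum_apply, inner_sum]
    exact (Finset.sum_congr rfl fun i _ => Finset.sum_comm).trans Finset.sum_comm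
  rw [this]
  exact Finset.sum_nonneg fun l _ => h n (B l) x

end Gram

/-! ### Structure and inverses of conditionally negative maps. -/

section Decomposition

variable {E : Type*} [NormedAddCommGroup E] [InnerProductSpace ℂ E] [FiniteDimensional ℂ E]
  [CompleteSpace E]

/-- A conditionally positive map is completely positive up to a map `A ↦ A X + X^* A`. -/
theorem CondPos.exists_decomp [Nontrivial E] {φ : Module.End ℂ (E →L[ℂ] E)} (hφ : CondPos φ) :
    ∃ (Ψ : Module.End ℂ (E →L[ℂ] E)) (X : E →L[ℂ] E), IsCP Ψ ∧ φ = Ψ + derivMap X := by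
  obtain ⟨e0, he0⟩ := exists_ne (0 : E)
  obtain ⟨e, he⟩ : ∃ e : E, ‖e‖ = 1 := ⟨((‖e0‖⁻¹ : ℝ) : ℂ) • e0, by
    rw [norm_smul, Complex.norm_real, norm_inv, norm_norm, inv_mul_cancel₀ (norm_ne_zero_iff.2 he0)]⟩
  let ro : E → E → (E →L[ℂ] E) := fun v w => (innerSL ℂ w).smulRight v
  have ro_apply : ∀ v w f, ro v w f = ⟪w, f⟫_ℂ • v := fun v w f => rfl
  have star_ro : ∀ v w, star (ro v w) = ro w v := fun v w => by
    ext1 f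
    refine ext_inner_left ℂ fun g => ?_
    rw [ContinuousLinearMap.star_eq_adjoint, ContinuousLinearMap.adjoint_inner_right, ro_apply,
      ro_apply, inner_smul_left, inner_smul_right, inner_conj_symm, mul_comm]
  let K : E →L[ℂ] E := LinearMap.toContinuousLinearMap
    { toFun := fun v => φ (ro v e) e
      map_add' := fun v w => by
        have : ro (v + w) e = ro v e + ro w e := by ext1 f; simp [ro_apply]
        rw [this, map_add, add_apply]
      map_smul' := fun c v => by
        have : ro (c • v) e = c • ro v e := by ext1 f; simp [ro_apply, smul_comm c]
        rw [this, map_smul, smul_apply]; rfl }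
  have hK : ∀ v, K v = φ (ro v e) e := fun v => rfl
  set c : ℝ := (⟪e, φ (ro e e) e⟫_ℂ).re with hc
  have hcc : ((c : ℝ) : ℂ) = ⟪e, φ (ro e e) e⟫_ℂ := by
    refine Complex.conj_eq_iff_re.1 ?_
    rw [inner_conj_symm, ← ContinuousLinearMap.adjoint_inner_right, ← ContinuousLinearMap.star_eq_adjoint,
      ← hφ.1, star_ro]
  -- With `K v = φ(|v⟩⟨e|) e` and `c = (e, φ(|e⟩⟨e|) e)`, the map to subtract is `A ↦ K A + A K^* -
  -- c A`. These are the terms created by the extra vector below.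
  let X : E →L[ℂ] E := star K - ((c / 2 : ℝ) : ℂ) • 1
  have hX : ∀ A : E →L[ℂ] E, derivMap X A = K * A + A * star K - (c : ℂ) • A := fun A => by
    rw [derivMap_apply, star_sub, star_star, star_ofReal_smul, star_one, mul_sub, sub_mul,
      mul_smul_comm, smul_mul_assoc, mul_one, one_mul]
    have : (c : ℂ) • A = ((c / 2 : ℝ) : ℂ) • A + ((c / 2 : ℝ) : ℂ) • A := by
      rw [← add_smul]; congr 1; push_cast; ring
    rw [this]
    abel
  refine ⟨φ - derivMap X, X, isCP_of_gram fun n A f => ?_, by rw [sub_add_cancel]⟩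
  set v : E := ∑ i, A i (f i) with hv
  have hvA : ∀ i, star (A i) * ro v e = ro (star (A i) v) e := fun i => by
    ext1 g; simp [ro_apply]
  -- Adjoining the operator `-|v⟩⟨e|` with the vector `e` cancels `v = ∑ A_i f_i`. Conditional
  -- positivity of the enlarged family is then positivity of the Gram form of `φ - derivMap X` on
  -- the original family.
  have h := hφ.2 (n + 1) (Fin.cons (-(ro v e)) A) (Fin.cons e f) (by
    rw [Fin.sum_univ_succ]
    simp [ro_apply, ← hv, inner_self_eq_norm_sq_to_K, he])
  have t1 : ⟪e, φ (star (-(ro v e)) * -(ro v e)) e⟫_ℂ = (c : ℂ) * ⟪v, v⟫_ℂ := by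
    have : star (-(ro v e)) * -(ro v e) = ⟪v, v⟫_ℂ • ro e e := by
      rw [star_neg, neg_mul_neg, star_ro]
      ext1 g
      simp only [mul_apply_eq_comp, ro_apply, smul_apply, inner_smul_right, smul_smul]
      rw [mul_comm]
    rw [this, map_smul, smul_apply, inner_smul_right, hcc, mul_comm]
  have t2 : ∀ i, ⟪f i, φ (star (A i) * -(ro v e)) e⟫_ℂ = -⟪f i, K (star (A i) v)⟫_ℂ := fun i => by
    rw [mul_neg, map_neg, hvA, hK, neg_apply, inner_neg_right]
  have t3 : ∀ i, ⟪e, φ (star (-(ro v e)) * A i) (f i)⟫_ℂ = -⟪v, A i (star K (f i))⟫_ℂ := fun i => by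
    have h1 : star (-(ro v e)) * A i = star (star (A i) * -(ro v e)) := by
      rw [star_mul, star_star]
    rw [h1, hφ.1, ContinuousLinearMap.star_eq_adjoint (φ _), ContinuousLinearMap.adjoint_inner_right,
      ← inner_conj_symm, t2, ContinuousLinearMap.star_eq_adjoint, ContinuousLinearMap.star_eq_adjoint,
      map_neg, inner_conj_symm,
      ← ContinuousLinearMap.adjoint_inner_right, ContinuousLinearMap.adjoint_inner_left]
  have e2 : ∑ i, ∑ j, ⟪f i, (φ - derivMap X) (star (A i) * A j) (f j)⟫_ℂ
      = ∑ i, ∑ j, ⟪f i, φ (star (A i) * A j) (f j)⟫_ℂ - ∑ i, ⟪f i, K (star (A i) v)⟫_ℂ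
        - ∑ i, ⟪v, A i (star K (f i))⟫_ℂ + (c : ℂ) * ⟪v, v⟫_ℂ := by
    have s1 : ∑ i, ⟪f i, K (star (A i) v)⟫_ℂ = ∑ i, ∑ j, ⟪f i, K (star (A i) (A j (f j)))⟫_ℂ := by
      simp only [hv, map_sum, inner_sum]
    have s2 : ∑ i, ⟪v, A i (star K (f i))⟫_ℂ
        = ∑ i, ∑ j, ⟪f i, star (A i) (A j (star K (f j)))⟫_ℂ := by
      rw [Finset.sum_comm]
      refine Finset.sum_congr rfl fun j _ => ?_
      rw [hv, sum_inner]
      refine Finset.sum_congr rfl fun i _ => ?_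
      rw [ContinuousLinearMap.star_eq_adjoint (A i), ContinuousLinearMap.adjoint_inner_right]
    have s3 : ⟪v, v⟫_ℂ = ∑ i, ∑ j, ⟪f i, star (A i) (A j (f j))⟫_ℂ := by
      nth_rewrite 1 [hv]
      rw [sum_inner]
      refine Finset.sum_congr rfl fun i _ => ?_
      rw [hv, inner_sum]
      refine Finset.sum_congr rfl fun j _ => ?_
      rw [ContinuousLinearMap.star_eq_adjoint (A i), ContinuousLinearMap.adjoint_inner_right]
    rw [s1, s2, s3, Finset.mul_sum]
    simp only [Finset.mul_sum, ← Finset.sum_sub_distrib, ← Finset.sum_add_distrib]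
    refine Finset.sum_congr rfl fun i _ => Finset.sum_congr rfl fun j _ => ?_
    rw [LinearMap.sub_apply, hX]
    simp only [sub_apply, add_apply, mul_apply_eq_comp, smul_apply, inner_sub_right,
      inner_add_right, inner_smul_right]
    ring
  rw [e2]
  simp only [Fin.sum_univ_succ, Fin.cons_zero, Fin.cons_succ, t1, t2, t3,
    Finset.sum_add_distrib, Finset.sum_neg_distrib] at h
  convert h using 1
  ring

/-- Write `L(A) = A Y + Y^* A - Ψ(A)` and complete the square: `L + m = Ad_c - (Ψ + m⁻¹ Ad_Y)`,
where `Ad_c(A) = c^* A c` and `c = √m (1 + Y/m)`. Factoring out `Ad_c`, whose inverse `Ad_{c⁻¹}` is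
completely positive, leaves `1 - T` with `T` completely positive and small for large `m`, so a
Neumann series applies. -/
theorem CondPos.exists_shift_inverse [Nontrivial E] {L : Module.End ℂ (E →L[ℂ] E)}
    (hL : CondPos (-L)) : ∃ lam : ℝ, 0 ≤ lam ∧ ∃ R : Module.End ℂ (E →L[ℂ] E), IsCP R ∧
      R * (L + (lam : ℂ) • 1) = 1 := by
  obtain ⟨Ψ, X, hΨ, hdec⟩ := hL.exists_decomp
  set Y : E →L[ℂ] E := -X with hY
  have hL' : L = derivMap Y - Ψ := by
    rw [hY, ← neg_derivMap, ← neg_neg L, hdec]; abel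
  obtain ⟨C, hC0, hC⟩ := exists_norm_apply_le Ψ
  -- The first summand yields `‖T A‖ ≤ ‖A‖/2` (as `‖d‖² ≤ 4/m`), the second yields `‖t‖ ≤ 1/2`, and
  -- the third yields `m ≥ 1`.
  set m : ℝ := 8 * (C + ‖Y‖ ^ 2) + 2 * ‖Y‖ + 1 with hm
  have hm1 : 1 ≤ m := by rw [hm]; nlinarith [norm_nonneg Y, sq_nonneg ‖Y‖]
  set μ : ℝ := √m with hμ
  have hμm : μ * μ = m := Real.mul_self_sqrt (by linarith)
  have hμ0 : 0 < μ := Real.sqrt_pos.2 (by linarith)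
  have hμC : (μ : ℂ) * μ = m := by exact_mod_cast hμm
  have hμne : (μ : ℂ) ≠ 0 := by exact_mod_cast hμ0.ne'
  have hmne : (m : ℂ) ≠ 0 := by exact_mod_cast (by linarith : m ≠ 0)
  set t : E →L[ℂ] E := ((m⁻¹ : ℝ) : ℂ) • X with ht
  have htn : ‖t‖ ≤ 1 / 2 := by
    rw [ht, norm_smul, Complex.norm_real, Real.norm_of_nonneg (by positivity), ← norm_neg, ← hY,
      inv_mul_le_iff₀ (by linarith), hm]
    nlinarith [norm_nonneg Y, sq_nonneg ‖Y‖]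
  set u := Units.oneSub t (lt_of_le_of_lt htn (by norm_num)) with hu
  have hun : ‖(↑u⁻¹ : E →L[ℂ] E)‖ ≤ 2 := by
    have h1 : (↑u⁻¹ : E →L[ℂ] E) = 1 + ↑u⁻¹ * t := by
      have h2 : (↑u⁻¹ : E →L[ℂ] E) * (1 - t) = 1 := u.inv_mul
      rw [mul_sub, mul_one] at h2
      exact eq_add_of_sub_eq h2
    have h3 : ‖(↑u⁻¹ : E →L[ℂ] E)‖ ≤ 1 + ‖(↑u⁻¹ : E →L[ℂ] E)‖ * ‖t‖ := by
      conv_lhs => rw [h1]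
      exact (norm_add_le _ _).trans (add_le_add norm_one.le (norm_mul_le _ _))
    nlinarith [norm_nonneg (↑u⁻¹ : E →L[ℂ] E)]
  set d : E →L[ℂ] E := ((μ⁻¹ : ℝ) : ℂ) • (↑u⁻¹ : E →L[ℂ] E) with hd
  set c : E →L[ℂ] E := ((μ : ℝ) : ℂ) • (1 - t) with hc
  have hcd : c * d = 1 := by
    rw [hc, hd, smul_mul_smul_comm, ← Complex.ofReal_mul, mul_inv_cancel₀ hμ0.ne', Complex.ofReal_one,
      one_smul]
    exact u.mul_inv
  have hdn : ‖d‖ ≤ 2 / μ := by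
    rw [hd, norm_smul, Complex.norm_real, Real.norm_of_nonneg (by positivity), div_eq_inv_mul]
    gcongr
  let Ad : (E →L[ℂ] E) → Module.End ℂ (E →L[ℂ] E) := fun c =>
    LinearMap.mulLeft ℂ (star c) ∘ₗ LinearMap.mulRight ℂ c
  have hAd : ∀ c A, Ad c A = star c * (A * c) := fun c A => rfl
  set T : Module.End ℂ (E →L[ℂ] E) := Ad d * (Ψ + ((m⁻¹ : ℝ) : ℂ) • Ad Y) with hT
  have hTcp : IsCP T := (isCP_conj d).mul (hΨ.add ((isCP_conj Y).smul (by positivity)))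
  have key : Ad d * (L + (m : ℂ) • 1) = 1 - T := by
    have e1 : L + (m : ℂ) • 1 = Ad c - (Ψ + ((m⁻¹ : ℝ) : ℂ) • Ad Y) := by
      ext1 A
      have ht' : t = -(((m⁻¹ : ℝ) : ℂ) • Y) := by rw [ht, hY, smul_neg, neg_neg]
      have hcA : Ad c A = (m : ℂ) • A + (A * Y + star Y * A) + ((m⁻¹ : ℝ) : ℂ) • (star Y * (A * Y)) := by
        rw [hAd, hc, star_ofReal_smul, mul_smul_comm, smul_mul_assoc, mul_smul_comm, smul_smul, hμC,
          star_sub, star_one, ht', star_neg, star_ofReal_smul, sub_neg_eq_add, sub_neg_eq_add]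
        simp only [mul_add, add_mul, mul_one, one_mul, mul_smul_comm, smul_mul_assoc, smul_add,
          smul_smul]
        have : (m : ℂ) * ((m⁻¹ : ℝ) : ℂ) = 1 := by push_cast; exact mul_inv_cancel₀ hmne
        simp only [this, one_smul, one_mul, ← mul_assoc]
        abel
      simp only [LinearMap.add_apply, LinearMap.sub_apply, LinearMap.smul_apply,
        Module.End.one_apply]
      rw [hcA, hL', LinearMap.sub_apply, derivMap_apply, hAd]
      abel
    have e2 : Ad d * Ad c = 1 := by
      ext1 A
      have h1 : star d * star c = 1 := by rw [← star_mul, hcd, star_one]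
      rw [Module.End.mul_apply, hAd, hAd, Module.End.one_apply]
      calc star d * (star c * (A * c) * d) = (star d * star c) * A * (c * d) := by
            simp only [mul_assoc]
        _ = A := by rw [h1, hcd, one_mul, mul_one]
    rw [e1, mul_sub, e2]
  have hAdn : ∀ c A, ‖Ad c A‖ ≤ ‖c‖ ^ 2 * ‖A‖ := fun c A => by
    rw [hAd]
    calc ‖star c * (A * c)‖ ≤ ‖star c‖ * (‖A‖ * ‖c‖) :=
          (norm_mul_le _ _).trans (by gcongr; exact norm_mul_le _ _)
      _ = ‖c‖ ^ 2 * ‖A‖ := by rw [norm_star]; ring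
  have hTn : ∀ A, ‖T A‖ ≤ 1 / 2 * ‖A‖ := fun A => by
    have h1 : ‖(Ψ + ((m⁻¹ : ℝ) : ℂ) • Ad Y) A‖ ≤ (C + ‖Y‖ ^ 2) * ‖A‖ := by
      rw [LinearMap.add_apply, LinearMap.smul_apply, add_mul]
      refine (norm_add_le _ _).trans (add_le_add (hC A) ?_)
      rw [norm_smul, Complex.norm_real, Real.norm_of_nonneg (by positivity)]
      calc m⁻¹ * ‖Ad Y A‖ ≤ 1 * (‖Y‖ ^ 2 * ‖A‖) := by
            gcongr
            · exact inv_le_one_of_one_le₀ hm1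
            · exact hAdn Y A
        _ = _ := one_mul _
    calc ‖T A‖ ≤ ‖d‖ ^ 2 * ‖(Ψ + ((m⁻¹ : ℝ) : ℂ) • Ad Y) A‖ := hAdn d _
      _ ≤ (2 / μ) ^ 2 * ((C + ‖Y‖ ^ 2) * ‖A‖) := by gcongr
      _ = (4 * (C + ‖Y‖ ^ 2) / m) * ‖A‖ := by
        rw [div_pow, pow_two μ, hμm]; ring
      _ ≤ 1 / 2 * ‖A‖ := by
        refine mul_le_mul_of_nonneg_right ?_ (norm_nonneg _)
        rw [div_le_iff₀ (by linarith), hm]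
        nlinarith [norm_nonneg Y]
  obtain ⟨U, hU⟩ := exists_mul_one_sub (by norm_num : (1 / 2 : ℝ) < 1) hTn
  have hUcp := isCP_of_mul_one_sub hTcp (by norm_num) (by norm_num : (1 / 2 : ℝ) < 1) hTn hU
  exact ⟨m, by linarith, U * Ad d, hUcp.mul (isCP_conj d), by rw [mul_assoc, key, hU]⟩

/-- A conditionally negative map dominating a map with completely positive inverse has a
completely positive inverse. -/
theorem CondPos.exists_inverse [Nontrivial E] {L L₀ R₀ : Module.End ℂ (E →L[ℂ] E)}
    (hL : CondPos (-L)) (hR₀ : IsCP R₀) (h₀ : R₀ * L₀ = 1) (hZ : IsCP (L - L₀)) :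
    ∃ R : Module.End ℂ (E →L[ℂ] E), IsCP R ∧ R * L = 1 := by
  obtain ⟨lam, hlam, hstart⟩ := hL.exists_shift_inverse
  set C : ℝ := ‖R₀ 1‖ with hC
  -- Continuation in the shift: it is lowered from `lam` to `0` in steps whose admissible length
  -- depends only on `C = ‖R₀(1)‖`.
  have step : ∀ a ε : ℝ, 0 ≤ a → 0 ≤ ε → ε * C ≤ 1 / 2 →
      (∃ R : Module.End ℂ (E →L[ℂ] E), IsCP R ∧ R * (L + (a : ℂ) • 1) = 1) →
      ∃ R : Module.End ℂ (E →L[ℂ] E), IsCP R ∧ R * (L + ((a - ε : ℝ) : ℂ) • 1) = 1 := by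
    rintro a ε ha hε hεC ⟨R, hR, hRL⟩
    have hRL' : (L + (a : ℂ) • 1) * R = 1 := mul_eq_one_comm.1 hRL
    -- The resolvent identity `R₀ - R = R₀ (L - L₀ + a) R` bounds `R` by `R₀`, uniformly in the
    -- shift `a`.
    have hsub : IsCP (R₀ - R) := by
      have e : R₀ - R = R₀ * ((L - L₀) + (a : ℂ) • 1) * R := by
        have : (L - L₀) + (a : ℂ) • 1 = (L + (a : ℂ) • 1) - L₀ := by abel
        rw [this, mul_sub, sub_mul, mul_assoc, hRL', mul_one, h₀, one_mul]
      rw [e]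
      exact (hR₀.mul (hZ.add (isCP_one.smul ha))).mul hR
    have hn : ∀ A, ‖((ε : ℂ) • R) A‖ ≤ 1 / 2 * ‖A‖ := fun A => by
      rw [LinearMap.smul_apply, norm_smul, Complex.norm_real, Real.norm_of_nonneg hε]
      calc ε * ‖R A‖ ≤ ε * (C * ‖A‖) := by gcongr; exact hR.norm_le_of_sub hsub A
        _ = (ε * C) * ‖A‖ := by ring
        _ ≤ 1 / 2 * ‖A‖ := by gcongr
    obtain ⟨U, hU⟩ := exists_mul_one_sub (by norm_num : (1 / 2 : ℝ) < 1) hn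
    refine ⟨U * R, (isCP_of_mul_one_sub (hR.smul hε) (by norm_num)
      (by norm_num : (1 / 2 : ℝ) < 1) hn hU).mul hR, ?_⟩
    have e : L + ((a - ε : ℝ) : ℂ) • (1 : Module.End ℂ (E →L[ℂ] E))
        = (L + (a : ℂ) • 1) - (ε : ℂ) • 1 := by
      ext1 A
      simp only [LinearMap.add_apply, LinearMap.sub_apply, LinearMap.smul_apply,
        Module.End.one_apply]
      rw [Complex.ofReal_sub, sub_smul, add_sub_assoc]
    rw [e, mul_assoc, mul_sub, hRL, mul_smul_comm, mul_one, hU]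
  obtain ⟨n, hn⟩ := exists_nat_gt (2 * (lam * C))
  have hn0 : (0 : ℝ) < n := lt_of_le_of_lt (by positivity) hn
  have iter : ∀ k : ℕ, k ≤ n → ∃ R : Module.End ℂ (E →L[ℂ] E), IsCP R ∧
      R * (L + ((lam - k * (lam / n) : ℝ) : ℂ) • 1) = 1 := by
    intro k
    induction k with
    | zero => intro _; simpa using hstart
    | succ k ih =>
      intro hk
      have hk' : ((k : ℝ) + 1) ≤ n := by exact_mod_cast hk
      have h1 := step (lam - k * (lam / n)) (lam / n) (by
        have : (k : ℝ) * (lam / n) ≤ n * (lam / n) := by gcongr; linarith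
        rw [mul_div_cancel₀ _ hn0.ne'] at this
        linarith) (by positivity) (by
          rw [div_mul_eq_mul_div, div_le_iff₀ hn0]; linarith) (ih (by omega))
      have e : lam - (k : ℝ) * (lam / n) - lam / n = lam - ((k + 1 : ℕ) : ℝ) * (lam / n) := by
        push_cast; ring
      rwa [e] at h1
  have := iter n le_rfl
  rwa [mul_div_cancel₀ _ hn0.ne', sub_self, Complex.ofReal_zero, zero_smul, add_zero] at this

end Decomposition

end QWeight

end

/-! ### Multiplication operators, cut-off projections and the pieces of `Λ`. -/

noncomputable section

namespace QWeight

open MeasureTheory Filter Topology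
open scoped ComplexOrder InnerProductSpace ENNReal

variable {p : ℕ}

theorem mulOp_norm_le {φ : ℝ → ℝ} (hφ : MemLp (fun x => (φ x : ℂ)) ∞ halfLine) {C : ℝ}
    (h : ∀ x, 0 < x → |φ x| ≤ C) (F : Hp p) : ‖mulOp φ hφ F‖ ≤ C * ‖F‖ := by
  refine Lp.norm_le_mul_norm_of_ae_le_mul ?_
  filter_upwards [mulOp_ae φ hφ F, ae_restrict_mem measurableSet_Ioi] with x h1 h2
  rw [h1, norm_smul, Complex.norm_real, Real.norm_eq_abs]
  gcongr
  exact h x h2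

theorem inner_mulOp {φ : ℝ → ℝ} (hφ : MemLp (fun x => (φ x : ℂ)) ∞ halfLine) (F G : Hp p) :
    ⟪F, mulOp φ hφ G⟫_ℂ = ⟪mulOp φ hφ F, G⟫_ℂ := by
  rw [L2.inner_def, L2.inner_def]
  refine integral_congr_ae ?_
  filter_upwards [mulOp_ae φ hφ F, mulOp_ae φ hφ G] with x h1 h2
  rw [h1, h2, inner_smul_left, inner_smul_right, Complex.conj_ofReal]

theorem star_mulOp {φ : ℝ → ℝ} (hφ : MemLp (fun x => (φ x : ℂ)) ∞ halfLine) :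
    star (mulOp φ hφ : BH p) = mulOp φ hφ := by
  ext1 F
  refine ext_inner_left ℂ fun G => ?_
  rw [ContinuousLinearMap.star_eq_adjoint, ContinuousLinearMap.adjoint_inner_right, inner_mulOp]

theorem star_cutProj (t : ℝ) : star (cutProj p t) = cutProj p t := star_mulOp _

theorem star_sqrtOp : star (sqrtOp p) = sqrtOp p := star_mulOp _

theorem mulOp_comm {φ χ : ℝ → ℝ} (hφ : MemLp (fun x => (φ x : ℂ)) ∞ halfLine)
    (hχ : MemLp (fun x => (χ x : ℂ)) ∞ halfLine) :
    (mulOp φ hφ : BH p) * mulOp χ hχ = mulOp χ hχ * mulOp φ hφ := by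
  ext1 F
  apply Lp.ext
  filter_upwards [mulOp_ae φ hφ (mulOp χ hχ F), mulOp_ae χ hχ F, mulOp_ae χ hχ (mulOp φ hφ F),
    mulOp_ae φ hφ F] with x h1 h2 h3 h4
  rw [mul_apply_eq_comp, mul_apply_eq_comp, h1, h2, h3, h4, smul_comm]

theorem mulOp_comm_Lam {φ : ℝ → ℝ} (hφ : MemLp (fun x => (φ x : ℂ)) ∞ halfLine) (A : BK p) :
    mulOp φ hφ * Lam p A = Lam p A * mulOp φ hφ := by
  ext1 F
  apply Lp.ext
  filter_upwards [mulOp_ae φ hφ (Lam p A F), mulOp_ae φ hφ F, Lam_ae A F,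
    Lam_ae A (mulOp φ hφ F)] with x h1 h2 h3 h4
  rw [mul_apply_eq_comp, mul_apply_eq_comp, h1, h3, h4, h2, map_smul, smul_comm]

theorem inner_Lam (A : BK p) (F G : Hp p) : ⟪F, Lam p A G⟫_ℂ = ⟪Lam p (star A) F, G⟫_ℂ := by
  rw [L2.inner_def, L2.inner_def]
  refine integral_congr_ae ?_
  filter_upwards [Lam_ae A G, Lam_ae (star A) F] with x h1 h2
  rw [h1, h2, inner_smul_left, inner_smul_right, Complex.conj_ofReal,
    ContinuousLinearMap.star_eq_adjoint, ContinuousLinearMap.adjoint_inner_left]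

theorem isCP_Lam : IsCP (Lam p) := fun n A hA F => by
  have hint : ∀ i j, Integrable (fun x => ⟪F i x, Lam p (A i j) (F j) x⟫_ℂ) halfLine :=
    fun i j => L2.integrable_inner _ _
  have e : ∑ i, ∑ j, ⟪F i, Lam p (A i j) (F j)⟫_ℂ
      = ∫ x, ∑ i, ∑ j, ⟪F i x, Lam p (A i j) (F j) x⟫_ℂ ∂halfLine := by
    rw [integral_finsetSum _ fun i _ => integrable_finsetSum _ fun j _ => hint i j]
    refine Finset.sum_congr rfl fun i _ => ?_
    rw [integral_finsetSum _ fun j _ => hint i j]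
    exact Finset.sum_congr rfl fun j _ => L2.inner_def _ _
  rw [e]
  refine integral_nonneg_of_ae ?_
  have hae : ∀ᵐ x ∂halfLine, ∀ i j, (Lam p (A i j) (F j) : ℝ → Kp p) x
      = (Real.exp (-x) : ℂ) • A i j (F j x) :=
    ae_all_iff.2 fun i => ae_all_iff.2 fun j => Lam_ae (A i j) (F j)
  filter_upwards [hae] with x hx
  simp only [hx, inner_smul_right, ← Finset.mul_sum]
  exact mul_nonneg (Complex.zero_le_real.2 (Real.exp_pos _).le) (hA fun i => F i x)

theorem isCP_sandwich {C : BH p} (hC : star C = C) : IsCP (sandwich C) := fun n A hA => by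
  have := hA.conj C
  rw [hC] at this
  exact this

theorem isCP_sandwich_cutProj (t : ℝ) : IsCP (sandwich (cutProj p t)) :=
  isCP_sandwich (star_cutProj t)

theorem norm_cutProj_le (t : ℝ) : ‖cutProj p t‖ ≤ 1 := by
  refine ContinuousLinearMap.opNorm_le_bound _ zero_le_one fun F => mulOp_norm_le _ (fun x _ => ?_) F
  by_cases h : x ∈ Set.Ici t <;> simp [h]

theorem norm_one_sub_cutProj_le (t : ℝ) : ‖1 - cutProj p t‖ ≤ 1 := by
  refine ContinuousLinearMap.opNorm_le_bound _ zero_le_one fun F =>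
    Lp.norm_le_mul_norm_of_ae_le_mul ?_
  filter_upwards [mulOp_ae _ (memLp_indicator t) F, Lp.coeFn_sub F (cutProj p t F)] with x h1 h2
  change ‖((F - cutProj p t F : Hp p) : ℝ → Kp p) x‖ ≤ _
  change (cutProj p t F : ℝ → Kp p) x = _ at h1
  rw [h2, Pi.sub_apply, h1]
  by_cases h : x ∈ Set.Ici t <;> simp [h]

theorem norm_sandwich_le {C : BH p} (hC : ‖C‖ ≤ 1) (A : BH p) : ‖sandwich C A‖ ≤ ‖A‖ := by
  calc ‖C * A * C‖ ≤ ‖C‖ * ‖A‖ * ‖C‖ :=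
        (norm_mul_le _ _).trans (by gcongr; exact norm_mul_le _ _)
    _ ≤ 1 * ‖A‖ * 1 := by gcongr
    _ = ‖A‖ := by ring

theorem cutProj_mul_of_le {t s : ℝ} (hts : t ≤ s) : cutProj p t * cutProj p s = cutProj p s :=
  mulOp_comp _ _ _ fun x _ => by
    by_cases h : x ∈ Set.Ici s
    · have h' : x ∈ Set.Ici t := le_trans hts h
      simp [Set.indicator_of_mem h, Set.indicator_of_mem h']
    · simp [Set.indicator_of_notMem h]

theorem mul_cutProj_of_le {t s : ℝ} (hts : t ≤ s) : cutProj p s * cutProj p t = cutProj p s := by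
  rw [cutProj, cutProj, mulOp_comm]; exact cutProj_mul_of_le hts

theorem sandwich_cutProj_of_le {t s : ℝ} (hts : t ≤ s) (A : BH p) :
    sandwich (cutProj p t) (sandwich (cutProj p s) A) = sandwich (cutProj p s) A := by
  change cutProj p t * (cutProj p s * A * cutProj p s) * cutProj p t = cutProj p s * A * cutProj p s
  calc _ = (cutProj p t * cutProj p s) * A * (cutProj p s * cutProj p t) := by
        simp only [mul_assoc]
    _ = _ := by rw [cutProj_mul_of_le hts, mul_cutProj_of_le hts]

theorem coe_cut {t : ℝ} (ht : 0 < t) (A : BH p) : (cut p t A : BH p) = sandwich (cutProj p t) A := by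
  rw [cut, dif_pos ht]; rfl

theorem cut_sandwich {t s : ℝ} (ht : 0 < t) (hts : t ≤ s) (A : BH p) :
    cut p t (sandwich (cutProj p s) A) = cut p s A := by
  apply Subtype.ext
  rw [coe_cut ht, coe_cut (ht.trans_le hts), sandwich_cutProj_of_le hts]

theorem coe_toFrakA (B : BH p) : (toFrakA p B : BH p) = sqrtOp p * B * sqrtOp p := rfl

theorem toFrakA_surjective : Function.Surjective (toFrakA p) :=
  LinearMap.surjective_rangeRestrict _

theorem cut_toFrakA {t : ℝ} (ht : 0 < t) (B : BH p) :
    cut p t (toFrakA p B : BH p) = toFrakA p (sandwich (cutProj p t) B) := by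
  apply Subtype.ext
  rw [coe_cut ht, coe_toFrakA, coe_toFrakA]
  change cutProj p t * (sqrtOp p * B * sqrtOp p) * cutProj p t
    = sqrtOp p * (cutProj p t * B * cutProj p t) * sqrtOp p
  have h : cutProj p t * sqrtOp p = sqrtOp p * cutProj p t := mulOp_comm _ _
  calc _ = (cutProj p t * sqrtOp p) * B * (sqrtOp p * cutProj p t) := by simp only [mul_assoc]
    _ = (sqrtOp p * cutProj p t) * B * (cutProj p t * sqrtOp p) := by rw [h]
    _ = _ := by simp only [mul_assoc]

/-- Multiplication by `(1 - e^{-x})^{-1/2}` on `[t, ∞)`. -/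
def invSqrtOp (p : ℕ) {t : ℝ} (ht : 0 < t) : BH p := mulOp _ (memLp_indicator_inv ht)

theorem star_invSqrtOp {t : ℝ} (ht : 0 < t) : star (invSqrtOp p ht) = invSqrtOp p ht := star_mulOp _

theorem wt_mul_indicator (t : ℝ) (x : ℝ) (hx : 0 < x) :
    wt x * (Set.Ici t).indicator (fun y => (wt y)⁻¹) x
      = (Set.Ici t).indicator (fun _ => (1 : ℝ)) x := by
  by_cases h : x ∈ Set.Ici t
  · rw [Set.indicator_of_mem h, Set.indicator_of_mem h, mul_inv_cancel₀ (wt_pos hx).ne']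
  · rw [Set.indicator_of_notMem h, Set.indicator_of_notMem h, mul_zero]

theorem sqrtOp_mul_invSqrtOp {t : ℝ} (ht : 0 < t) : sqrtOp p * invSqrtOp p ht = cutProj p t :=
  mulOp_comp _ _ _ (wt_mul_indicator t)

theorem invSqrtOp_mul_sqrtOp {t : ℝ} (ht : 0 < t) : invSqrtOp p ht * sqrtOp p = cutProj p t :=
  mulOp_comp _ _ _ fun x hx => by rw [mul_comm]; exact wt_mul_indicator t x hx

theorem cut_eq_toFrakA {t : ℝ} (ht : 0 < t) (A : BH p) :
    cut p t A = toFrakA p (sandwich (invSqrtOp p ht) A) := by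
  apply Subtype.ext
  rw [coe_cut ht, coe_toFrakA]
  change cutProj p t * A * cutProj p t
    = sqrtOp p * (invSqrtOp p ht * A * invSqrtOp p ht) * sqrtOp p
  calc cutProj p t * A * cutProj p t
      = (sqrtOp p * invSqrtOp p ht) * A * (invSqrtOp p ht * sqrtOp p) := by
        rw [sqrtOp_mul_invSqrtOp, invSqrtOp_mul_sqrtOp]
    _ = _ := by simp only [mul_assoc]

/-- The part `Λ - E(t, ∞) Λ E(t, ∞)` of `Λ` living on `(0, t)`. -/
def lamBelow (p : ℕ) (t : ℝ) : BK p →ₗ[ℂ] BH p := Lam p - sandwich (cutProj p t) ∘ₗ Lam p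

/-- The cut-off commutes with `Λ(A)`, so the off-diagonal corners vanish; the difference is a
compression, hence completely positive. -/
theorem lamBelow_eq (t : ℝ) : lamBelow p t = sandwich (1 - cutProj p t) ∘ₗ Lam p := by
  ext1 A
  change Lam p A - cutProj p t * Lam p A * cutProj p t
    = (1 - cutProj p t) * Lam p A * (1 - cutProj p t)
  have h1 : cutProj p t * Lam p A = Lam p A * cutProj p t := mulOp_comm_Lam _ A
  have h2 : cutProj p t * cutProj p t = cutProj p t := cutProj_mul_of_le le_rfl
  simp only [sub_mul, mul_sub, one_mul, mul_one, h1, mul_assoc, h2]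
  abel

theorem isCP_lamBelow (t : ℝ) : IsCP (lamBelow p t) := by
  rw [lamBelow_eq]
  exact (isCP_sandwich (by rw [star_sub, star_one, star_cutProj])).comp isCP_Lam

/-- On `[t, ∞)` one has `e^{-x} ≤ e^{-t} < 1` when `t > 0`. This strict contraction makes the later
Neumann series converge. -/
theorem norm_cut_Lam_le {t : ℝ} (A : BK p) :
    ‖sandwich (cutProj p t) (Lam p A)‖ ≤ Real.exp (-t) * ‖A‖ := by
  refine ContinuousLinearMap.opNorm_le_bound _ (by positivity) fun F => ?_
  have h0 : ‖cutProj p t F‖ ≤ ‖F‖ := by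
    simpa using (cutProj p t).le_of_opNorm_le (norm_cutProj_le t) F
  refine le_trans ?_ (mul_le_mul_of_nonneg_left h0 (by positivity))
  refine Lp.norm_le_mul_norm_of_ae_le_mul ?_
  filter_upwards [mulOp_ae _ (memLp_indicator t) (Lam p A (cutProj p t F)),
    Lam_ae A (cutProj p t F)] with x h1 h2
  change ‖(cutProj p t (Lam p A (cutProj p t F)) : ℝ → Kp p) x‖ ≤ _
  change (cutProj p t (Lam p A (cutProj p t F)) : ℝ → Kp p) x = _ at h1
  rw [h1, h2, norm_smul, norm_smul, Complex.norm_real, Complex.norm_real, Real.norm_eq_abs,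
    Real.norm_eq_abs, Real.abs_exp]
  by_cases h : x ∈ Set.Ici t
  · rw [Set.indicator_of_mem h, abs_one, one_mul, mul_assoc]
    have hx : t ≤ x := h
    gcongr
    exact A.le_opNorm _
  · rw [Set.indicator_of_notMem h, abs_zero, zero_mul]
    positivity

theorem norm_cut_lamBelow_le {t s : ℝ} (A : BK p) :
    ‖sandwich (cutProj p t) (lamBelow p s A)‖ ≤ Real.exp (-t) * ‖A‖ := by
  have e : sandwich (cutProj p t) (lamBelow p s A)
      = sandwich (1 - cutProj p s) (sandwich (cutProj p t) (Lam p A)) := by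
    rw [lamBelow_eq]
    change cutProj p t * ((1 - cutProj p s) * Lam p A * (1 - cutProj p s)) * cutProj p t
      = (1 - cutProj p s) * (cutProj p t * Lam p A * cutProj p t) * (1 - cutProj p s)
    have h : cutProj p t * (1 - cutProj p s) = (1 - cutProj p s) * cutProj p t := by
      rw [mul_sub, sub_mul, one_mul, mul_one]
      congr 1
      exact mulOp_comm _ _
    calc _ = (cutProj p t * (1 - cutProj p s)) * Lam p A * ((1 - cutProj p s) * cutProj p t) := by
          simp only [mul_assoc]
      _ = ((1 - cutProj p s) * cutProj p t) * Lam p A * (cutProj p t * (1 - cutProj p s)) := by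
          rw [h]
      _ = _ := by simp only [mul_assoc]
  rw [e]
  exact (norm_sandwich_le (norm_one_sub_cutProj_le s) _).trans (norm_cut_Lam_le A)

theorem tendsto_cutProj (F : Hp p) :
    Tendsto (fun t => cutProj p t F) (𝓝[>] (0 : ℝ)) (𝓝 F) := by
  rw [tendsto_iff_norm_sub_tendsto_zero]
  have hsq : Tendsto (fun t => ‖cutProj p t F - F‖ ^ 2) (𝓝[>] (0 : ℝ)) (𝓝 0) := by
    have e : ∀ t, ‖cutProj p t F - F‖ ^ 2
        = ∫ x, ‖(((Set.Ici t).indicator (fun _ => (1 : ℝ)) x : ℝ) : ℂ) • F x - F x‖ ^ 2 ∂halfLine := by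
      intro t
      have h1 := inner_self_eq_ofReal (cutProj p t F - F)
      rw [L2.inner_def] at h1
      have h2 : ∫ a, ⟪(cutProj p t F - F : Hp p) a, (cutProj p t F - F : Hp p) a⟫_ℂ ∂halfLine
          = ∫ x, ((‖(((Set.Ici t).indicator (fun _ => (1 : ℝ)) x : ℝ) : ℂ) • F x - F x‖ ^ 2 : ℝ) : ℂ)
            ∂halfLine := by
        refine integral_congr_ae ?_
        filter_upwards [mulOp_ae _ (memLp_indicator t) F, Lp.coeFn_sub (cutProj p t F) F]
          with x h3 h4
        change (cutProj p t F : ℝ → Kp p) x = _ at h3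
        rw [inner_self_eq_ofReal, h4, Pi.sub_apply, h3]
      rw [h2, integral_complex_ofReal] at h1
      exact (Complex.ofReal_injective h1).symm
    simp only [e]
    have hF : Integrable (fun x => ‖F x‖ ^ 2) halfLine := (Lp.memLp F).integrable_norm_pow (by norm_num)
    rw [show 𝓝 (0 : ℝ) = 𝓝 (∫ _, (0 : ℝ) ∂halfLine) by rw [integral_zero]]
    refine tendsto_integral_filter_of_dominated_convergence (fun x => ‖F x‖ ^ 2) ?_ ?_ hF ?_
    · refine Eventually.of_forall fun t => ?_
      have h := (memLp_indicator t).aestronglyMeasurable.smul (Lp.aestronglyMeasurable F)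
      exact ((h.sub (Lp.aestronglyMeasurable F)).norm).pow 2
    · refine Eventually.of_forall fun t => Eventually.of_forall fun x => ?_
      by_cases h : x ∈ Set.Ici t <;> simp [h]
    · filter_upwards [ae_restrict_mem measurableSet_Ioi] with x hx
      refine tendsto_const_nhds.congr' ?_
      have hev : ∀ᶠ t in 𝓝[>] (0 : ℝ), t < x := nhdsWithin_le_nhds (Iio_mem_nhds hx)
      filter_upwards [hev] with t ht
      have h : x ∈ Set.Ici t := ht.le
      simp [Set.indicator_of_mem h]
  have := hsq.sqrt
  simpa [Real.sqrt_sq] using this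

end QWeight

end

noncomputable section

namespace QWeight

open MeasureTheory Filter Topology
open scoped ComplexOrder InnerProductSpace ENNReal

variable {p : ℕ}

/-! ### Normal functionals and `b`-weight maps -/

theorem inner_sandwich {C : BH p} (hC : star C = C) (A : BH p) (F G : Hp p) :
    ⟪F, sandwich C A G⟫_ℂ = ⟪C F, A (C G)⟫_ℂ := by
  change ⟪F, C (A (C G))⟫_ℂ = _
  nth_rewrite 1 [← hC]
  rw [ContinuousLinearMap.star_eq_adjoint, ContinuousLinearMap.adjoint_inner_right]

theorem norm_inner_apply_le (A : BH p) (F G : Hp p) :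
    ‖⟪F, A G⟫_ℂ‖ ≤ ‖A‖ * (‖F‖ ^ 2 + ‖G‖ ^ 2) := by
  calc ‖⟪F, A G⟫_ℂ‖ ≤ ‖F‖ * (‖A‖ * ‖G‖) :=
        (norm_inner_le_norm _ _).trans (by gcongr; exact A.le_opNorm _)
    _ = ‖A‖ * (‖F‖ * ‖G‖) := by ring
    _ ≤ ‖A‖ * (‖F‖ ^ 2 + ‖G‖ ^ 2) := by
      gcongr
      nlinarith [sq_nonneg (‖F‖ - ‖G‖), sq_nonneg ‖F‖, sq_nonneg ‖G‖]

theorem tendsto_tsum_inner_cutProj {J : Type*} {F G : J → Hp p} (hF : Summable fun k => ‖F k‖ ^ 2)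
    (hG : Summable fun k => ‖G k‖ ^ 2) (A : BH p) :
    Tendsto (fun t => ∑' k, ⟪F k, sandwich (cutProj p t) A (G k)⟫_ℂ) (𝓝[>] (0 : ℝ))
      (𝓝 (∑' k, ⟪F k, A (G k)⟫_ℂ)) := by
  refine tendsto_tsum_of_dominated_convergence ((hF.add hG).mul_left ‖A‖) (fun k => ?_)
    (Eventually.of_forall fun t k => (norm_inner_apply_le _ _ _).trans ?_)
  · simp only [inner_sandwich (star_cutProj _)]
    exact (tendsto_cutProj (F k)).inner ((A.continuous.tendsto _).comp (tendsto_cutProj (G k)))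
  · gcongr
    exact norm_sandwich_le (norm_cutProj_le t) A

theorem IsNormalFunctional.tendsto_cutProj {η : BH p → ℂ} (hη : IsNormalFunctional η) (A : BH p) :
    Tendsto (fun t => η (sandwich (cutProj p t) A)) (𝓝[>] (0 : ℝ)) (𝓝 (η A)) := by
  obtain ⟨F, G, hF, hG, h⟩ := hη
  have := tendsto_tsum_inner_cutProj hF hG A
  simpa only [(h _).tsum_eq] using this

theorem isNormalFunctional_zero : IsNormalFunctional (fun _ : BH p => (0 : ℂ)) :=
  ⟨0, 0, by simp, by simp, fun A => by simp⟩

theorem IsNormalFunctional.add {η χ : BH p → ℂ} (hη : IsNormalFunctional η)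
    (hχ : IsNormalFunctional χ) : IsNormalFunctional (fun A => η A + χ A) := by
  obtain ⟨F, G, hF, hG, h⟩ := hη
  obtain ⟨F', G', hF', hG', h'⟩ := hχ
  have e0 : ∀ k, (2 * k + 1) / 2 = k := fun k => by omega
  refine ⟨fun n => if Even n then F (n / 2) else F' (n / 2),
    fun n => if Even n then G (n / 2) else G' (n / 2), ?_, ?_, fun A => ?_⟩
  · refine (HasSum.even_add_odd (f := fun n => ‖if Even n then F (n / 2) else F' (n / 2)‖ ^ 2)
      (by simpa [e0] using hF.hasSum) (by simpa [e0] using hF'.hasSum)).summable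
  · refine (HasSum.even_add_odd (f := fun n => ‖if Even n then G (n / 2) else G' (n / 2)‖ ^ 2)
      (by simpa [e0] using hG.hasSum) (by simpa [e0] using hG'.hasSum)).summable
  · exact HasSum.even_add_odd (by simpa [e0] using h A) (by simpa [e0] using h' A)

theorem IsNormalFunctional.const_mul {η : BH p → ℂ} (hη : IsNormalFunctional η) (c : ℂ) :
    IsNormalFunctional (fun A => c * η A) := by
  obtain ⟨F, G, hF, hG, h⟩ := hη
  refine ⟨F, fun n => c • G n, hF, ?_, fun A => ?_⟩
  · simpa [norm_smul, mul_pow] using hG.mul_left (‖c‖ ^ 2)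
  · simpa [inner_smul_right] using (h A).mul_left c

theorem IsNormalFunctional.sum {ι : Type*} (s : Finset ι) {η : ι → BH p → ℂ}
    (hη : ∀ i, IsNormalFunctional (η i)) : IsNormalFunctional (fun A => ∑ i ∈ s, η i A) := by
  classical
  induction s using Finset.induction_on with
  | empty => simpa using isNormalFunctional_zero
  | insert a s ha ih => simpa [Finset.sum_insert ha] using (hη a).add ih

theorem IsNormalFunctional.sandwich {η : BH p → ℂ} (hη : IsNormalFunctional η) {C : BH p}
    (hC : star C = C) : IsNormalFunctional (fun A => η (QWeight.sandwich C A)) := by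
  obtain ⟨F, G, hF, hG, h⟩ := hη
  have hs : ∀ {F : ℕ → Hp p}, Summable (fun n => ‖F n‖ ^ 2) → Summable fun n => ‖C (F n)‖ ^ 2 :=
    fun hF => Summable.of_nonneg_of_le (fun n => sq_nonneg _)
      (fun n => by
        rw [← mul_pow]
        exact pow_le_pow_left₀ (norm_nonneg _) (C.le_opNorm _) 2) (hF.mul_left (‖C‖ ^ 2))
  refine ⟨fun n => C (F n), fun n => C (G n), hs hF, hs hG, fun A => ?_⟩
  have := h (QWeight.sandwich C A)
  simpa only [inner_sandwich hC] using this

/-- The matrix unit `e_i ⊗ e_j^*`. -/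
def matrixUnit (i j : Fin p) : BK p := (innerSL ℂ (basisVec j)).smulRight (basisVec i)

theorem eq_sum_matrixUnit (X : BK p) :
    X = ∑ i, ∑ j, ⟪basisVec i, X (basisVec j)⟫_ℂ • matrixUnit i j := by
  ext1 f
  have hf : f = ∑ j, ⟪basisVec j, f⟫_ℂ • (basisVec j : Kp p) := by
    have := (EuclideanSpace.basisFun (Fin p) ℂ).sum_repr' f
    simpa using this.symm
  conv_lhs => rw [hf, map_sum]
  rw [Finset.sum_comm, sum_apply]
  refine Finset.sum_congr rfl fun j _ => ?_
  have hX : X (basisVec j) = ∑ i, ⟪basisVec i, X (basisVec j)⟫_ℂ • (basisVec i : Kp p) := by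
    have := (EuclideanSpace.basisFun (Fin p) ℂ).sum_repr' (X (basisVec j))
    simpa using this.symm
  rw [map_smul, sum_apply]
  conv_lhs => rw [hX, Finset.smul_sum]
  refine Finset.sum_congr rfl fun i _ => ?_
  rw [smul_apply, matrixUnit, ContinuousLinearMap.smulRight_apply, innerSL_apply_apply, smul_comm]

theorem eq_of_entries {X Y : BK p}
    (h : ∀ i j, ⟪basisVec i, X (basisVec j)⟫_ℂ = ⟪basisVec i, Y (basisVec j)⟫_ℂ) : X = Y := by
  rw [eq_sum_matrixUnit X, eq_sum_matrixUnit Y]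
  simp only [h]

theorem tendsto_of_entries {α : Type*} {l : Filter α} {X : α → BK p} {Y : BK p}
    (h : ∀ i j, Tendsto (fun a => ⟪basisVec i, X a (basisVec j)⟫_ℂ) l
      (𝓝 ⟪basisVec i, Y (basisVec j)⟫_ℂ)) : Tendsto X l (𝓝 Y) := by
  rw [eq_sum_matrixUnit Y, funext fun a => eq_sum_matrixUnit (X a)]
  exact tendsto_finsetSum _ fun i _ => tendsto_finsetSum _ fun j _ => (h i j).smul_const _

theorem norm_le_of_entries {X : BK p} {C : ℝ} (h : ∀ i j, ‖⟪basisVec i, X (basisVec j)⟫_ℂ‖ ≤ C) :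
    ‖X‖ ≤ C * ∑ i, ∑ j, ‖(matrixUnit i j : BK p)‖ := by
  rw [eq_sum_matrixUnit X, Finset.mul_sum]
  refine norm_sum_le_of_le _ fun i _ => ?_
  rw [Finset.mul_sum]
  refine norm_sum_le_of_le _ fun j _ => ?_
  rw [norm_smul]
  gcongr
  exact h i j

theorem IsNormalMap.comp_left {φ : BH p →ₗ[ℂ] BK p} (hφ : IsNormalMap φ) (T : BK p →ₗ[ℂ] BK p) :
    IsNormalMap (T ∘ₗ φ) := fun f g => by
  have e : (fun A => ⟪f, (T ∘ₗ φ) A g⟫_ℂ) = fun A => ∑ i, ∑ j, ⟪f, T (matrixUnit i j) g⟫_ℂ *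
      ⟪basisVec i, φ A (basisVec j)⟫_ℂ := by
    ext A
    rw [LinearMap.comp_apply]
    conv_lhs => rw [eq_sum_matrixUnit (φ A)]
    simp only [map_sum, map_smul, sum_apply, smul_apply, inner_sum, inner_smul_right]
    exact Finset.sum_congr rfl fun i _ => Finset.sum_congr rfl fun j _ => mul_comm _ _
  rw [e]
  exact IsNormalFunctional.sum _ fun i => IsNormalFunctional.sum _ fun j => (hφ _ _).const_mul _

theorem IsNormalMap.add {φ χ : BH p →ₗ[ℂ] BK p} (hφ : IsNormalMap φ) (hχ : IsNormalMap χ) :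
    IsNormalMap (φ + χ) := fun f g => by
  simpa [inner_add_right] using (hφ f g).add (hχ f g)

theorem IsNormalMap.neg {φ : BH p →ₗ[ℂ] BK p} (hφ : IsNormalMap φ) : IsNormalMap (-φ) :=
  fun f g => by simpa using (hφ f g).const_mul (-1)

theorem IsBWeightMap.sub {ω η : frakA p →ₗ[ℂ] BK p} (hω : IsBWeightMap ω) (hη : IsBWeightMap η) :
    IsBWeightMap (ω - η) := by
  have : (ω - η) ∘ₗ toFrakA p = ω ∘ₗ toFrakA p + -(η ∘ₗ toFrakA p) := by
    rw [LinearMap.sub_comp]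
    abel
  rw [IsBWeightMap, this]
  exact IsNormalMap.add hω hη.neg

theorem IsBWeightMap.comp_left {ω : frakA p →ₗ[ℂ] BK p} (hω : IsBWeightMap ω)
    (T : BK p →ₗ[ℂ] BK p) : IsBWeightMap (T ∘ₗ ω) := IsNormalMap.comp_left hω T

theorem IsBWeightMap.isNormalMap_cutMap {ω : frakA p →ₗ[ℂ] BK p} (hω : IsBWeightMap ω) {t : ℝ}
    (ht : 0 < t) : IsNormalMap (cutMap ω t) := fun f g => by
  have := (hω f g).sandwich (star_invSqrtOp (p := p) ht)
  simpa only [cutMap, LinearMap.comp_apply, cut_eq_toFrakA ht] using this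

/-- The cut-off commutes with `(I - Λ)^{1/2}`, so this is continuity of normal functionals under
`E_t → 1` strongly. A `b`-weight map is therefore determined by its cut-offs, and its complete
positivity can be tested on them. -/
theorem IsBWeightMap.tendsto_cutMap {ω : frakA p →ₗ[ℂ] BK p} (hω : IsBWeightMap ω) (A : frakA p) :
    Tendsto (fun t => cutMap ω t (A : BH p)) (𝓝[>] (0 : ℝ)) (𝓝 (ω A)) := by
  obtain ⟨B, rfl⟩ := toFrakA_surjective A
  refine tendsto_of_entries fun i j => ?_
  refine ((hω (basisVec i) (basisVec j)).tendsto_cutProj B).congr' ?_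
  filter_upwards [self_mem_nhdsWithin] with t ht
  rw [cutMap, LinearMap.comp_apply, LinearMap.comp_apply, cut_toFrakA ht]

theorem IsCPOn.isCP_cutMap {ω : frakA p →ₗ[ℂ] BK p} (hω : IsCPOn ω) {t : ℝ} (ht : 0 < t) :
    IsCP (cutMap ω t) := fun n A hA => hω n (fun i j => cut p t (A i j)) (by
  simpa only [coe_cut ht] using isCP_sandwich_cutProj t n A hA)

theorem IsBWeightMap.isCPOn {ω : frakA p →ₗ[ℂ] BK p} (hω : IsBWeightMap ω)
    {l : Filter ℝ} [l.NeBot] (hl : l ≤ 𝓝[>] (0 : ℝ)) (h : ∀ᶠ t in l, IsCP (cutMap ω t)) :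
    IsCPOn ω := fun n A hA =>
  MatrixPos.of_tendsto (A := fun t i j => cutMap ω t (A i j : BH p)) (h.mono fun _ ht => ht n _ hA)
    fun i j => (hω.tendsto_cutMap (A i j)).mono_left hl

theorem IsBWeightMap.eq_of_cutMap {ω η : frakA p →ₗ[ℂ] BK p} (hω : IsBWeightMap ω)
    (hη : IsBWeightMap η) (h : ∀ t, 0 < t → cutMap ω t = cutMap η t) : ω = η := by
  ext1 A
  refine tendsto_nhds_unique_of_eventuallyEq (hω.tendsto_cutMap A) (hη.tendsto_cutMap A) ?_
  filter_upwards [self_mem_nhdsWithin] with t ht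
  rw [h t ht]

theorem cutMap_sandwich (ω : frakA p →ₗ[ℂ] BK p) {t s : ℝ} (ht : 0 < t) (hts : t ≤ s) (A : BH p) :
    cutMap ω t (sandwich (cutProj p s) A) = cutMap ω s A := by
  rw [cutMap, cutMap, LinearMap.comp_apply, LinearMap.comp_apply, cut_sandwich ht hts]

theorem cutMap_comp_lamBelow (ω : frakA p →ₗ[ℂ] BK p) {t s : ℝ} (ht : 0 < t) (hts : t ≤ s) :
    cutMap ω t ∘ₗ lamBelow p s = cutMap ω t ∘ₗ Lam p - cutMap ω s ∘ₗ Lam p := by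
  ext1 A
  rw [LinearMap.comp_apply, lamBelow, LinearMap.sub_apply, map_sub, LinearMap.comp_apply,
    cutMap_sandwich ω ht hts]
  rfl

/-! ### Generalized boundary representations -/

theorem end_mul_sub (A B C : Module.End ℂ (BK p)) : A * (B - C) = A * B - A * C := mul_sub A B C

theorem end_sub_mul (A B C : Module.End ℂ (BK p)) : (A - B) * C = A * C - B * C := sub_mul A B C

theorem end_mul_add (A B C : Module.End ℂ (BK p)) : A * (B + C) = A * B + A * C := mul_add A B C

theorem end_add_mul (A B C : Module.End ℂ (BK p)) : (A + B) * C = A * C + B * C := add_mul A B C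

/-- The endomorphism `ω|_t Λ` of `B(ℂ^p)`. -/
def lamMap (ω : frakA p →ₗ[ℂ] BK p) (t : ℝ) : Module.End ℂ (BK p) := cutMap ω t ∘ₗ Lam p

theorem iotaAdd_eq (ω : frakA p →ₗ[ℂ] BK p) (t : ℝ) : iotaAdd ω t = 1 + lamMap ω t := rfl

/-- The endomorphism `π_t^# (Λ - Λ|_s)` of `B(ℂ^p)`. -/
def belowMap (ω : frakA p →ₗ[ℂ] BK p) (t s : ℝ) : Module.End ℂ (BK p) :=
  boundaryRep ω t ∘ₗ lamBelow p s

/-- The endomorphism `π_t^# Λ` of `B(ℂ^p)`. -/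
def repLam (ω : frakA p →ₗ[ℂ] BK p) (t : ℝ) : Module.End ℂ (BK p) := boundaryRep ω t ∘ₗ Lam p

/-- The inverse of `ι + ω|_t Λ`. -/
def iotaInv (ω : frakA p →ₗ[ℂ] BK p) (t : ℝ) : Module.End ℂ (BK p) := Ring.inverse (iotaAdd ω t)

theorem boundaryRep_apply (ω : frakA p →ₗ[ℂ] BK p) (t : ℝ) (A : BH p) :
    boundaryRep ω t A = iotaInv ω t (cutMap ω t A) := rfl

theorem boundaryRep_sandwich (ω : frakA p →ₗ[ℂ] BK p) {t s : ℝ} (ht : 0 < t) (hts : t ≤ s)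
    (A : BH p) : boundaryRep ω t (sandwich (cutProj p s) A) = iotaInv ω t (cutMap ω s A) := by
  rw [boundaryRep_apply, cutMap_sandwich ω ht hts]

namespace IsQWeightMap

variable {ω : frakA p →ₗ[ℂ] BK p} (hω : IsQWeightMap ω)
include hω

theorem iotaInv_mul {t : ℝ} (ht : 0 < t) : iotaInv ω t * iotaAdd ω t = 1 :=
  Ring.inverse_mul_cancel _ (hω.invertible t ht)

theorem mul_iotaInv {t : ℝ} (ht : 0 < t) : iotaAdd ω t * iotaInv ω t = 1 :=
  Ring.mul_inverse_cancel _ (hω.invertible t ht)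

/-- Here `ι + ω|_s Λ` is `ι + ω|_t Λ` minus `ω|_t (Λ - Λ|_s)`. The identity links two cut-off levels
through a completely positive strict contraction. -/
theorem iotaInv_mul_iotaAdd {t s : ℝ} (ht : 0 < t) (hts : t ≤ s) :
    iotaInv ω t * iotaAdd ω s = 1 - belowMap ω t s := by
  have h1 : iotaAdd ω s = iotaAdd ω t - (lamMap ω t - lamMap ω s) := by
    rw [iotaAdd_eq, iotaAdd_eq]
    abel
  have h2 : belowMap ω t s = iotaInv ω t * (lamMap ω t - lamMap ω s) := by
    change iotaInv ω t ∘ₗ (cutMap ω t ∘ₗ lamBelow p s) = _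
    rw [cutMap_comp_lamBelow ω ht hts]
    rfl
  rw [h1, end_mul_sub, hω.iotaInv_mul ht, h2]

theorem iotaInv_eq {t : ℝ} (ht : 0 < t) : iotaInv ω t = 1 - repLam ω t := by
  have h1 : iotaInv ω t * (1 + lamMap ω t) = iotaInv ω t + repLam ω t := by
    rw [end_mul_add, mul_one]
    rfl
  rw [← iotaAdd_eq, hω.iotaInv_mul ht] at h1
  rw [h1]
  abel

theorem isCP_iotaAdd {t : ℝ} (ht : 0 < t) : IsCP (iotaAdd ω t) :=
  isCP_one.add ((hω.cp.isCP_cutMap ht).comp isCP_Lam)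

theorem isCP_belowMap {t : ℝ} (ht : 0 < t) (s : ℝ) :
    IsCP (belowMap ω t s) := (hω.rep_cp t ht).comp (isCP_lamBelow s)

theorem norm_belowMap_le {t : ℝ} (ht : 0 < t) (s : ℝ) (A : BK p) :
    ‖belowMap ω t s A‖ ≤ Real.exp (-t) * ‖A‖ := by
  have : belowMap ω t s A
      = boundaryRep ω t (sandwich (cutProj p t) (lamBelow p s A)) := by
    rw [boundaryRep_sandwich ω ht le_rfl]; rfl
  rw [this]
  exact (hω.rep_contractive t ht _).trans (norm_cut_lamBelow_le A)

/-- This product is the inverse of `1 - π_t^# (Λ - Λ|_s)`, given by a Neumann series. -/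
theorem isCP_iotaInv_mul_iotaAdd {t s : ℝ} (ht : 0 < t) (hts : t ≤ s) :
    IsCP (iotaInv ω s * iotaAdd ω t) := by
  refine isCP_of_mul_one_sub (hω.isCP_belowMap ht s) (Real.exp_pos _).le
    (Real.exp_lt_one_iff.2 (by linarith : -t < 0)) (hω.norm_belowMap_le ht s) ?_
  rw [← hω.iotaInv_mul_iotaAdd ht hts, mul_assoc, ← mul_assoc (iotaAdd ω t), hω.mul_iotaInv ht,
    one_mul, hω.iotaInv_mul (ht.trans_le hts)]

theorem condPos_neg_iotaInv_mul_iotaAdd {t s : ℝ} (ht : 0 < t) (hts : t ≤ s) :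
    CondPos (-(iotaInv ω t * iotaAdd ω s)) := by
  have e : -(1 - belowMap ω t s) = belowMap ω t s + ((-1 : ℝ) : ℂ) • 1 := by
    ext1 A
    simp
    abel
  rw [hω.iotaInv_mul_iotaAdd ht hts, e]
  exact (hω.isCP_belowMap ht s).condPos.add (condPos_smul_one (-1))

end IsQWeightMap

end QWeight

end

/-! ### The standard form: asymptotics of `ϑ|_t Λ` as `t → 0+`. -/

noncomputable section

namespace QWeight

open MeasureTheory Filter Topology
open scoped ComplexOrder InnerProductSpace ENNReal

variable {p : ℕ}

namespace StandardData

variable {J : Type*} (D : StandardData p J)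

/-- The operator `f ↦ (x ↦ g_k(x) f)` of `ℂ^p` into `ℂ^p ⊗ L²(0, ∞)`, cut off to `[t, ∞)`. -/
def gOp {t : ℝ} (ht : 0 < t) (k : J) : Kp p →L[ℂ] Hp p :=
  LinearMap.toContinuousLinearMap
    { toFun := fun f => invSqrtOp p ht
        ((ContinuousLinearMap.toSpanSingleton ℂ f).compLpL 2 halfLine ((D.g_mem k).toLp _))
      map_add' := fun f f' => by
        rw [← map_add, ContinuousLinearMap.toSpanSingleton_add, ContinuousLinearMap.add_compLpL]
        rfl
      map_smul' := fun c f => by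
        rw [RingHom.id_apply, ← map_smul, ContinuousLinearMap.toSpanSingleton_smul,
          ContinuousLinearMap.smul_compLpL]
        rfl }

theorem gOp_apply {t : ℝ} (ht : 0 < t) (k : J) (f : Kp p) : D.gOp ht k f = invSqrtOp p ht
    ((ContinuousLinearMap.toSpanSingleton ℂ f).compLpL 2 halfLine ((D.g_mem k).toLp _)) := rfl

theorem gOp_ae {t : ℝ} (ht : 0 < t) (k : J) (f : Kp p) :
    (D.gOp ht k f : ℝ → Kp p) =ᵐ[halfLine] fun x => (Set.Ici t).indicator (D.g k) x • f := by
  rw [gOp_apply]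
  filter_upwards [mulOp_ae _ (memLp_indicator_inv ht)
    ((ContinuousLinearMap.toSpanSingleton ℂ f).compLpL 2 halfLine ((D.g_mem k).toLp _)),
    (ContinuousLinearMap.toSpanSingleton ℂ f).coeFn_compLpL ((D.g_mem k).toLp _),
    (D.g_mem k).coeFn_toLp, ae_restrict_mem measurableSet_Ioi] with x h1 h2 h3 h4
  change (invSqrtOp p ht _ : ℝ → Kp p) x = _ at h1
  rw [h1, h2, h3, ContinuousLinearMap.toSpanSingleton_apply, smul_smul]
  congr 1
  by_cases h : x ∈ Set.Ici t
  · rw [Set.indicator_of_mem h, Set.indicator_of_mem h, ← mul_assoc, ← Complex.ofReal_mul,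
      inv_mul_cancel₀ (wt_pos h4).ne', Complex.ofReal_one, one_mul]
  · rw [Set.indicator_of_notMem h, Set.indicator_of_notMem h, Complex.ofReal_zero, zero_mul]

theorem Lam_gOp {t : ℝ} (ht : 0 < t) (k : J) (A : BK p) (f : Kp p) :
    Lam p A (D.gOp ht k f) = Lam p 1 (D.gOp ht k (A f)) := by
  apply Lp.ext
  filter_upwards [Lam_ae A (D.gOp ht k f), Lam_ae 1 (D.gOp ht k (A f)), D.gOp_ae ht k f,
    D.gOp_ae ht k (A f)] with x h1 h2 h3 h4
  rw [h1, h2, h3, h4, map_smul, one_apply_eq_self]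

/-- The weight `(g_k, Λ|_t g_k)`. -/
def gWeight (t : ℝ) (k : J) : ℝ := ∫ x in Set.Ici t, Real.exp (-x) * ‖D.g k x‖ ^ 2

theorem w_eq (t : ℝ) : D.w t = ∑' k, D.gWeight t k := rfl

theorem gWeight_eq {t : ℝ} (ht : 0 < t) (k : J) : D.gWeight t k
    = ∫ x, (Set.Ici t).indicator (fun x => Real.exp (-x) * ‖D.g k x‖ ^ 2) x ∂halfLine := by
  rw [integral_indicator measurableSet_Ici, Measure.restrict_restrict measurableSet_Ici, gWeight]
  congr 2
  symm
  rw [Set.inter_eq_left]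
  exact fun x hx => lt_of_lt_of_le ht hx

theorem gWeight_nonneg {t : ℝ} (k : J) : 0 ≤ D.gWeight t k :=
  integral_nonneg fun x => by positivity

/-- On `[t, ∞)`, `e^{-x} ≤ 1 ≤ (1 - e^{-t})⁻¹ (1 - e^{-x})`. -/
theorem summable_gWeight {t : ℝ} (ht : 0 < t) : Summable (D.gWeight t) := by
  have h1 : 0 < 1 - Real.exp (-t) := by
    have : Real.exp (-t) < 1 := Real.exp_lt_one_iff.2 (by linarith)
    linarith
  refine Summable.of_nonneg_of_le (fun k => D.gWeight_nonneg k) (fun k => ?_)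
    (D.g_summable.mul_left (1 - Real.exp (-t))⁻¹)
  rw [D.gWeight_eq ht, ← integral_const_mul]
  refine integral_mono_of_nonneg (Eventually.of_forall fun x => ?_) ?_ ?_
  · exact Set.indicator_nonneg (fun x _ => by positivity) x
  · have h2 := ((D.g_mem k).integrable_norm_pow (by norm_num)).const_mul (1 - Real.exp (-t))⁻¹
    refine h2.congr ?_
    filter_upwards [ae_restrict_mem measurableSet_Ioi] with x hx
    have hx' : (0 : ℝ) < x := hx
    have h3 : Real.exp (-x) ≤ 1 := Real.exp_le_one_iff.2 (by linarith)
    simp only [norm_mul, Complex.norm_real, Real.norm_eq_abs, mul_pow, sq_abs,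
      wt, Real.sq_sqrt (by linarith : 0 ≤ 1 - Real.exp (-x))]
  · filter_upwards [ae_restrict_mem measurableSet_Ioi] with x hx
    have hx' : (0 : ℝ) < x := hx
    have h3 : Real.exp (-x) ≤ 1 := Real.exp_le_one_iff.2 (by linarith)
    by_cases h : x ∈ Set.Ici t
    · rw [Set.indicator_of_mem h, ← mul_assoc]
      have h4 : Real.exp (-x) ≤ Real.exp (-t) := Real.exp_le_exp.2 (neg_le_neg h)
      gcongr
      rw [inv_mul_eq_div, le_div_iff₀ h1]
      nlinarith [Real.exp_pos (-x), Real.exp_pos (-t)]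
    · rw [Set.indicator_of_notMem h]
      have : 0 ≤ 1 - Real.exp (-x) := by linarith
      positivity

theorem inner_gOp_Lam_gOp {t : ℝ} (ht : 0 < t) (k : J) (f f' : Kp p) :
    ⟪D.gOp ht k f, Lam p 1 (D.gOp ht k f')⟫_ℂ = (D.gWeight t k : ℂ) * ⟪f, f'⟫_ℂ := by
  rw [L2.inner_def, D.gWeight_eq ht, ← integral_complex_ofReal, ← integral_mul_const]
  refine integral_congr_ae ?_
  filter_upwards [Lam_ae 1 (D.gOp ht k f'), D.gOp_ae ht k f, D.gOp_ae ht k f'] with x h1 h2 h3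
  rw [h1, h2, h3, one_apply_eq_self, inner_smul_left, inner_smul_right, inner_smul_right]
  by_cases h : x ∈ Set.Ici t
  · rw [Set.indicator_of_mem h, Set.indicator_of_mem h]
    have : (starRingEnd ℂ) (D.g k x) * D.g k x = ((‖D.g k x‖ ^ 2 : ℝ) : ℂ) := by
      rw [mul_comm, Complex.mul_conj, Complex.normSq_eq_norm_sq]
    rw [Complex.ofReal_mul, ← this]
    ring
  · simp [Set.indicator_of_notMem h]

/-- Factor `Λ(I) = S²` with `S` multiplication by `e^{-x/2}`, a contraction; the weight is the
square of the norm of `S g_k`. Only the square root of the weight enters, which is why the cross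
term is of lower order than `w_t`. -/
theorem norm_Lam_gOp_le {t : ℝ} (ht : 0 < t) (k : J) (f : Kp p) :
    ‖Lam p 1 (D.gOp ht k f)‖ ≤ √(D.gWeight t k) * ‖f‖ := by
  have hm : MemLp (fun x => ((Real.exp (-x / 2) : ℝ) : ℂ)) ∞ halfLine :=
    memLp_of_bound (by fun_prop) 1 fun x hx => by
      rw [Real.abs_exp]; exact Real.exp_le_one_iff.2 (by linarith)
  have hb : ∀ F : Hp p, ‖mulOp _ hm F‖ ≤ 1 * ‖F‖ := mulOp_norm_le hm fun x hx => by
    rw [Real.abs_exp]; exact Real.exp_le_one_iff.2 (by linarith)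
  have hS : ∀ F : Hp p, Lam p 1 F = mulOp _ hm (mulOp _ hm F) := fun F => by
    apply Lp.ext
    filter_upwards [Lam_ae 1 F, mulOp_ae _ hm (mulOp _ hm F), mulOp_ae _ hm F] with x h1 h2 h3
    rw [h1, h2, h3, smul_smul, ← Complex.ofReal_mul, ← Real.exp_add, one_apply_eq_self]
    congr 4
    ring
  have h1 : ‖mulOp _ hm (D.gOp ht k f)‖ ^ 2 = D.gWeight t k * ‖f‖ ^ 2 := by
    have h2 := D.inner_gOp_Lam_gOp ht k f f
    rw [hS, inner_mulOp, inner_self_eq_ofReal, inner_self_eq_ofReal, ← Complex.ofReal_mul] at h2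
    exact Complex.ofReal_injective h2
  calc ‖Lam p 1 (D.gOp ht k f)‖ ≤ ‖mulOp _ hm (D.gOp ht k f)‖ := by
        rw [hS]; simpa using hb (mulOp _ hm (D.gOp ht k f))
    _ = √(D.gWeight t k * ‖f‖ ^ 2) := by rw [← h1, Real.sqrt_sq (norm_nonneg _)]
    _ = √(D.gWeight t k) * ‖f‖ := by
      rw [Real.sqrt_mul (D.gWeight_nonneg k), Real.sqrt_sq (norm_nonneg _)]

/-- The operator `f ↦ (x ↦ e^{-x} g_k(x) f)`, cut off to `[t, ∞)`. -/
def lamGOp {t : ℝ} (ht : 0 < t) (k : J) : Kp p →L[ℂ] Hp p := Lam p 1 ∘L D.gOp ht k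

theorem norm_adjoint_lamGOp_le {t : ℝ} (ht : 0 < t) (k : J) (F : Hp p) :
    ‖ContinuousLinearMap.adjoint (D.lamGOp ht k) F‖ ≤ √(D.gWeight t k) * ‖F‖ := by
  refine ContinuousLinearMap.le_of_opNorm_le _ ?_ F
  rw [LinearIsometryEquiv.norm_map]
  exact ContinuousLinearMap.opNorm_le_bound _ (Real.sqrt_nonneg _) (D.norm_Lam_gOp_le ht k)

/-- The `k`-th summand of the cross term. -/
def crossTerm {t : ℝ} (ht : 0 < t) (k : J) : BK p :=
  ∑ j, (innerSL ℂ (basisVec j)).smulRight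
    (ContinuousLinearMap.adjoint (D.lamGOp ht k) (cutProj p t (D.h j k)))

theorem crossTerm_basisVec {t : ℝ} (ht : 0 < t) (k : J) (j : Fin p) :
    D.crossTerm ht k (basisVec j)
      = ContinuousLinearMap.adjoint (D.lamGOp ht k) (cutProj p t (D.h j k)) := by
  rw [crossTerm, sum_apply, Finset.sum_eq_single j]
  · simp
  · intro i _ hij
    have h0 : ⟪(basisVec i : Kp p), basisVec j⟫_ℂ = 0 := by
      rw [EuclideanSpace.inner_single_left]
      simp [hij]
    rw [ContinuousLinearMap.smulRight_apply, innerSL_apply_apply, h0, zero_smul]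
  · simp

/-- Weighted arithmetic-geometric mean, `√w ‖h‖ ≤ ε w + ε⁻¹ ‖h‖²`, for each of the `p` columns. -/
theorem norm_crossTerm_le {t : ℝ} (ht : 0 < t) {ε : ℝ} (hε : 0 < ε) (k : J) :
    ‖D.crossTerm ht k‖ ≤ p * (ε * D.gWeight t k) + ε⁻¹ * ∑ j, ‖D.h j k‖ ^ 2 := by
  have h1 : ∀ j : Fin p, ‖(innerSL ℂ (basisVec j)).smulRight
      (ContinuousLinearMap.adjoint (D.lamGOp ht k) (cutProj p t (D.h j k)))‖
      ≤ ε * D.gWeight t k + ε⁻¹ * ‖D.h j k‖ ^ 2 := fun j => by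
    rw [ContinuousLinearMap.norm_smulRight_apply, innerSL_apply_norm]
    have h2 : ‖(basisVec j : Kp p)‖ = 1 := by simp
    have h3 : ‖cutProj p t (D.h j k)‖ ≤ ‖D.h j k‖ := by
      simpa using (cutProj p t).le_of_opNorm_le (norm_cutProj_le t) (D.h j k)
    rw [h2, one_mul]
    refine (D.norm_adjoint_lamGOp_le ht k _).trans ?_
    refine (mul_le_mul_of_nonneg_left h3 (Real.sqrt_nonneg _)).trans ?_
    have h4 : √(D.gWeight t k) ^ 2 = D.gWeight t k := Real.sq_sqrt (D.gWeight_nonneg k)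
    nth_rewrite 2 [← h4]
    have h5 : 0 ≤ (ε * √(D.gWeight t k) - ‖D.h j k‖) ^ 2 := sq_nonneg _
    have h6 : 0 ≤ √(D.gWeight t k) * ‖D.h j k‖ := by positivity
    rw [← mul_le_mul_iff_right₀ hε]
    have h7 : ε * (ε * √(D.gWeight t k) ^ 2 + ε⁻¹ * ‖D.h j k‖ ^ 2)
        = ε ^ 2 * √(D.gWeight t k) ^ 2 + ‖D.h j k‖ ^ 2 := by field_simp
    rw [h7]
    nlinarith
  refine (norm_sum_le_of_le _ fun j _ => h1 j).trans (le_of_eq ?_)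
  rw [Finset.sum_add_distrib, Finset.mul_sum]
  simp

theorem summable_crossTerm {t : ℝ} (ht : 0 < t) : Summable (D.crossTerm ht) :=
  Summable.of_norm_bounded ((((D.summable_gWeight ht).mul_left 1).mul_left (p : ℝ)).add
    ((summable_sum fun j (_ : j ∈ Finset.univ) => D.h_summable j).mul_left 1⁻¹))
    (D.norm_crossTerm_le ht one_pos)

/-- The operator `X` in `ϑ|_t Λ(A) = w_t A + A X + X^* A + ρ|_t Λ(A)`. -/
def cross {t : ℝ} (ht : 0 < t) : BK p := ∑' k, D.crossTerm ht k

/-- Since `∑ ‖h_{jk}‖²` is finite and `C` does not depend on `t`, this says that the cross term is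
`o(w_t)` once `w_t → ∞`. -/
theorem norm_cross_le {ε : ℝ} (hε : 0 < ε) : ∃ C : ℝ, ∀ (t : ℝ) (ht : 0 < t),
    ‖D.cross ht‖ ≤ ε * D.w t + C := by
  set δ : ℝ := ε / (p + 1) with hδ
  have hδ0 : 0 < δ := by positivity
  refine ⟨δ⁻¹ * ∑' k, ∑ j, ‖D.h j k‖ ^ 2, fun t ht => ?_⟩
  have h1 := ((D.summable_gWeight ht).hasSum.mul_left δ).mul_left (p : ℝ) |>.add
    ((summable_sum fun j (_ : j ∈ Finset.univ) => D.h_summable j).hasSum.mul_left δ⁻¹)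
  refine (tsum_of_norm_bounded h1 (D.norm_crossTerm_le ht hδ0)).trans ?_
  rw [← w_eq]
  have hw : 0 ≤ D.w t := tsum_nonneg fun k => D.gWeight_nonneg k
  have h2 : p * (δ * D.w t) ≤ ε * D.w t := by
    rw [← mul_assoc]
    gcongr
    rw [hδ, mul_div_assoc', div_le_iff₀ (by positivity)]
    nlinarith
  gcongr

/-- The endomorphism `ρ|_t Λ` of `B(ℂ^p)`. -/
def rhoLam (t : ℝ) : Module.End ℂ (BK p) := D.rho ∘ₗ sandwich (cutProj p t) ∘ₗ Lam p

theorem tendsto_rhoLam (A : BK p) :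
    Tendsto (fun t => D.rhoLam t A) (𝓝[>] (0 : ℝ)) (𝓝 ((D.rho ∘ₗ Lam p) A)) := by
  refine tendsto_of_entries fun i j => ?_
  simp only [rhoLam, LinearMap.comp_apply, inner_rho]
  exact tendsto_tsum_inner_cutProj (D.h_summable i) (D.h_summable j) _

theorem exists_norm_rhoLam_le : ∃ C : ℝ, ∀ t A, ‖D.rhoLam t A‖ ≤ C * ‖A‖ := by
  obtain ⟨C₀, h₀0, h₀⟩ : ∃ C₀ : ℝ, 0 ≤ C₀ ∧ ∀ A, ‖Lam p A‖ ≤ C₀ * ‖A‖ :=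
    ⟨‖LinearMap.toContinuousLinearMap (Lam p)‖, ContinuousLinearMap.opNorm_nonneg _,
      (LinearMap.toContinuousLinearMap (Lam p)).le_opNorm⟩
  set S : ℝ := ∑ i, ∑' k, ‖D.h i k‖ ^ 2 with hS
  have hSi : ∀ i, ∑' k, ‖D.h i k‖ ^ 2 ≤ S := fun i =>
    Finset.single_le_sum (f := fun i => ∑' k, ‖D.h i k‖ ^ 2)
      (fun i _ => tsum_nonneg fun k => sq_nonneg _) (Finset.mem_univ i)
  have hS0 : 0 ≤ S := Finset.sum_nonneg fun i _ => tsum_nonneg fun k => sq_nonneg _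
  refine ⟨C₀ * (S + S) * ∑ i, ∑ j, ‖(matrixUnit i j : BK p)‖, fun t A => ?_⟩
  have := norm_le_of_entries (X := D.rhoLam t A) (C := C₀ * ‖A‖ * (S + S)) fun i j => by
    rw [rhoLam, LinearMap.comp_apply, inner_rho]
    have hsum := ((D.h_summable i).add (D.h_summable j)).hasSum.mul_left
      ‖sandwich (cutProj p t) (Lam p A)‖
    refine (tsum_of_norm_bounded hsum fun k => norm_inner_apply_le _ _ _).trans ?_
    rw [(D.h_summable i).tsum_add (D.h_summable j)]
    have h1 : ‖sandwich (cutProj p t) (Lam p A)‖ ≤ C₀ * ‖A‖ :=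
      (norm_sandwich_le (norm_cutProj_le t) _).trans (h₀ A)
    have h2 : 0 ≤ ∑' k, ‖D.h i k‖ ^ 2 := tsum_nonneg fun k => sq_nonneg _
    have h3 : 0 ≤ ∑' k, ‖D.h j k‖ ^ 2 := tsum_nonneg fun k => sq_nonneg _
    exact mul_le_mul h1 (add_le_add (hSi i) (hSi j)) (by positivity) (by positivity)
  refine this.trans (le_of_eq ?_)
  ring

variable {D} {ϑ : frakA p →ₗ[ℂ] BK p}

theorem invSqrtOp_vec {t : ℝ} (ht : 0 < t) (i : Fin p) (k : J) :
    invSqrtOp p ht (D.vec i k) = D.gOp ht k (basisVec i) + cutProj p t (D.h i k) := by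
  rw [vec, map_add, gOp_apply, ← invSqrtOp_mul_sqrtOp ht]
  rfl

theorem inner_gOp_Lam {t : ℝ} (ht : 0 < t) (k : J) (A : BK p) (f : Kp p) (j : Fin p) :
    ⟪D.gOp ht k f, Lam p A (cutProj p t (D.h j k))⟫_ℂ
      = ⟪f, A (D.crossTerm ht k (basisVec j))⟫_ℂ := by
  rw [inner_Lam, Lam_gOp, crossTerm_basisVec]
  change ⟪D.lamGOp ht k (star A f), _⟫_ℂ = _
  rw [← ContinuousLinearMap.adjoint_inner_right, ContinuousLinearMap.star_eq_adjoint,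
    ContinuousLinearMap.adjoint_inner_left]

/-- Expand the inner product of the vectors `g + h`. Since `Λ(A)` sends `g_k ⊗ f` to `e^{-x} g_k ⊗ A
f`, the `gg` terms give `w_t A`, the two mixed terms give `A X` and `X^* A`, and the `hh` terms give
`ρ|_t Λ(A)`. All but the last are conditionally zero. -/
theorem Represents.lamMap_eq (h : D.Represents ϑ) {t : ℝ} (ht : 0 < t) :
    lamMap ϑ t = (D.w t : ℂ) • 1 + derivMap (D.cross ht) + D.rhoLam t := by
  ext1 A
  refine eq_of_entries fun i j => ?_
  have h0 := h (sandwich (invSqrtOp p ht) (Lam p A)) i j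
  rw [← cut_eq_toFrakA] at h0
  refine h0.unique ?_
  have hX := (D.summable_crossTerm ht).hasSum
  have t1 : HasSum (fun k => (D.gWeight t k : ℂ) * ⟪basisVec i, A (basisVec j)⟫_ℂ)
      ((D.w t : ℂ) * ⟪basisVec i, A (basisVec j)⟫_ℂ) :=
    (Complex.hasSum_ofReal.2 (D.summable_gWeight ht).hasSum).mul_right _
  have t2 : HasSum (fun k => ⟪basisVec i, A (D.crossTerm ht k (basisVec j))⟫_ℂ)
      ⟪basisVec i, A (D.cross ht (basisVec j))⟫_ℂ := by
    let ℓ : BK p →L[ℂ] ℂ := innerSL ℂ (basisVec i) ∘L A ∘L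
      ContinuousLinearMap.apply ℂ (Kp p) (basisVec j)
    exact hX.mapL ℓ
  have t3 : HasSum (fun k => ⟪D.crossTerm ht k (basisVec i), A (basisVec j)⟫_ℂ)
      ⟪D.cross ht (basisVec i), A (basisVec j)⟫_ℂ := by
    let ℓ : BK p →L[ℂ] ℂ := innerSL ℂ (A (basisVec j)) ∘L
      ContinuousLinearMap.apply ℂ (Kp p) (basisVec i)
    have h3 := (hX.mapL ℓ).star
    have e : ∀ Y : BK p, star (ℓ Y) = ⟪Y (basisVec i), A (basisVec j)⟫_ℂ :=
      fun Y => inner_conj_symm (𝕜 := ℂ) (Y (basisVec i)) (A (basisVec j))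
    simp only [e] at h3
    exact h3
  have t4 := (D.summable_inner (sandwich (cutProj p t) (Lam p A)) i j).hasSum
  rw [← inner_rho] at t4
  convert ((t1.add t2).add t3).add t4 using 1
  · ext k
    rw [inner_sandwich (star_invSqrtOp ht), inner_sandwich (star_cutProj t), invSqrtOp_vec,
      invSqrtOp_vec, map_add, inner_add_left, inner_add_right, inner_add_right, inner_gOp_Lam,
      Lam_gOp, inner_gOp_Lam_gOp]
    have : ⟪cutProj p t (D.h i k), Lam p 1 (D.gOp ht k (A (basisVec j)))⟫_ℂ
        = ⟪D.crossTerm ht k (basisVec i), A (basisVec j)⟫_ℂ := by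
      rw [← Lam_gOp, ← inner_conj_symm, ← star_star A, ← inner_Lam, inner_gOp_Lam, star_star,
        inner_conj_symm, ContinuousLinearMap.star_eq_adjoint,
        ContinuousLinearMap.adjoint_inner_left]
    rw [this]
    ring
  · simp only [LinearMap.add_apply, LinearMap.smul_apply, Module.End.one_apply, derivMap_apply,
      add_apply, smul_apply, inner_add_right, inner_smul_right, mul_apply_eq_comp,
      ContinuousLinearMap.star_eq_adjoint, ContinuousLinearMap.adjoint_inner_right]
    rw [← add_assoc]
    rfl

end StandardData

end QWeight

end

noncomputable section

namespace QWeight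

open MeasureTheory Filter Topology
open scoped ComplexOrder InnerProductSpace ENNReal

variable {p : ℕ}

theorem conditionallyPositive_iff {φ : BK p →ₗ[ℂ] BK p} :
    ConditionallyPositive φ ↔ CondPos (φ : Module.End ℂ (BK p)) := Iff.rfl

/-! ### Scaled limits -/

/-- `L_t ∼ w_t ι` in norm. -/
def IsAsymptoticTo (l : Filter ℝ) (L : ℝ → Module.End ℂ (BK p)) (w : ℝ → ℝ) : Prop :=
  ∀ ε : ℝ, 0 < ε → ∀ᶠ t in l, ∀ A, ‖L t A - (w t : ℂ) • A‖ ≤ ε * w t * ‖A‖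

theorem IsAsymptoticTo.add_bounded {l : Filter ℝ} {L Z : ℝ → Module.End ℂ (BK p)} {w : ℝ → ℝ}
    (hL : IsAsymptoticTo l L w) (hw : Tendsto w l atTop) {C : ℝ}
    (hZ : ∀ᶠ t in l, ∀ A, ‖Z t A‖ ≤ C * ‖A‖) : IsAsymptoticTo l (fun t => L t + Z t) w := by
  intro ε hε
  filter_upwards [hL (ε / 2) (by positivity), hZ, hw.eventually_ge_atTop (2 * C / ε)]
    with t h1 h2 h3 A
  have e : (L t + Z t) A - (w t : ℂ) • A = (L t A - (w t : ℂ) • A) + Z t A := by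
    rw [LinearMap.add_apply]; abel
  rw [e]
  refine (norm_add_le_of_le (h1 A) (h2 A)).trans ?_
  rw [← add_mul]
  gcongr
  rw [div_le_iff₀ hε] at h3
  linarith

theorem IsAsymptoticTo.tendsto_apply {l : Filter ℝ} {L : ℝ → Module.End ℂ (BK p)} {w : ℝ → ℝ}
    (hL : IsAsymptoticTo l L w) (hw : Tendsto w l atTop) (A : BK p) :
    Tendsto (fun t => ((w t)⁻¹ : ℂ) • L t A) l (𝓝 A) := by
  rw [Metric.tendsto_nhds]
  intro ε hε
  have hε' : 0 < ε / (‖A‖ + 1) := by positivity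
  filter_upwards [hL _ hε', hw.eventually_gt_atTop 0] with t h1 h2
  have hne : (w t : ℂ) ≠ 0 := by exact_mod_cast h2.ne'
  have e : ((w t)⁻¹ : ℂ) • L t A - A = ((w t)⁻¹ : ℂ) • (L t A - (w t : ℂ) • A) := by
    rw [smul_sub, smul_smul, inv_mul_cancel₀ hne, one_smul]
  rw [dist_eq_norm, e, norm_smul, norm_inv, Complex.norm_real, Real.norm_of_nonneg h2.le,
    inv_mul_lt_iff₀ h2]
  refine (h1 A).trans_lt ?_
  have h3 : ε / (‖A‖ + 1) * ‖A‖ < ε := by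
    rw [div_mul_eq_mul_div, div_lt_iff₀ (by positivity)]
    nlinarith [norm_nonneg A]
  nlinarith

theorem IsAsymptoticTo.tendsto_inverse {l : Filter ℝ} {L R : ℝ → Module.End ℂ (BK p)} {w : ℝ → ℝ}
    (hL : IsAsymptoticTo l L w) (hw : Tendsto w l atTop) (hR : ∀ᶠ t in l, L t * R t = 1)
    (A : BK p) : Tendsto (fun t => (w t : ℂ) • R t A) l (𝓝 A) := by
  rw [Metric.tendsto_nhds]
  intro ε hε
  -- For `x = w_t R_t A` one has `L_t x = w_t A`, so `‖A - x‖ ≤ δ ‖x‖`. The bound `δ ≤ 1/2` gives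
  -- `‖x‖ ≤ 2‖A‖`, and the other bound makes the error less than `ε`.
  set δ : ℝ := min (1 / 2) (ε / (4 * (‖A‖ + 1))) with hδ
  have hδ0 : 0 < δ := lt_min (by norm_num) (by positivity)
  filter_upwards [hL _ hδ0, hw.eventually_gt_atTop 0, hR] with t h1 h2 h3
  have h4 := h1 ((w t : ℂ) • R t A)
  have e : L t ((w t : ℂ) • R t A) = (w t : ℂ) • A := by
    rw [map_smul, ← Module.End.mul_apply, h3, Module.End.one_apply]
  set x := (w t : ℂ) • R t A with hx
  have e2 : (w t : ℂ) • A - (w t : ℂ) • x = (w t : ℂ) • (A - x) := (smul_sub _ _ _).symm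
  rw [e, e2, norm_smul, Complex.norm_real, Real.norm_of_nonneg h2.le, mul_comm δ, mul_assoc,
    mul_le_mul_iff_right₀ h2] at h4
  have h5 : ‖x‖ ≤ ‖A‖ + ‖A - x‖ := by
    have := norm_sub_le A (A - x)
    rwa [sub_sub_cancel] at this
  have h6 : δ ≤ 1 / 2 := min_le_left _ _
  have h7 : ‖x‖ ≤ 2 * ‖A‖ := by nlinarith [norm_nonneg x]
  rw [dist_eq_norm, norm_sub_rev]
  have h8 : δ * (4 * (‖A‖ + 1)) ≤ ε := by
    rw [← le_div_iff₀ (by positivity)]; exact min_le_right _ _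
  nlinarith [norm_nonneg A, norm_nonneg x]

/-- `φ = lim w_t (ι + η|_t Λ)^{-1}`. -/
def IsScaledLimit (l : Filter ℝ) (w : ℝ → ℝ) (η : frakA p →ₗ[ℂ] BK p) (φ : Module.End ℂ (BK p)) :
    Prop :=
  ∀ A, Tendsto (fun t => (w t : ℂ) • iotaInv η t A) l (𝓝 (φ A))

theorem eventually_mem_Ioc {l : Filter ℝ} (hl : l ≤ 𝓝[>] (0 : ℝ)) {s : ℝ} (hs : 0 < s) :
    ∀ᶠ t in l, 0 < t ∧ t ≤ s := by
  refine hl ?_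
  filter_upwards [Ioc_mem_nhdsGT hs] with t ht using ht

section ScaledLimit

variable {l : Filter ℝ} [l.NeBot] {w : ℝ → ℝ} {ω η : frakA p →ₗ[ℂ] BK p}
  {ψ φ : Module.End ℂ (BK p)}

theorem isCP_repLam_sub (h : QGe ω η) {t : ℝ} (ht : 0 < t) : IsCP (repLam ω t - repLam η t) := by
  have := (h t ht).comp (isCP_Lam (p := p))
  rwa [LinearMap.sub_comp] at this

theorem isCP_belowMap_sub (h : QGe ω η) {t : ℝ} (ht : 0 < t) (s : ℝ) :
    IsCP (belowMap ω t s - belowMap η t s) := by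
  have := (h t ht).comp (isCP_lamBelow (p := p) s)
  rwa [LinearMap.sub_comp] at this

/-- Since `(ι + ω|_t Λ)^{-1} = ι - π_t^# Λ`, passing to inverses reverses the order. -/
theorem IsQWeightMap.isCP_iotaInv_sub (hω : IsQWeightMap ω) (hη : IsQWeightMap η) (h : QGe ω η)
    {t : ℝ} (ht : 0 < t) : IsCP (iotaInv η t - iotaInv ω t) := by
  have e : iotaInv η t - iotaInv ω t = repLam ω t - repLam η t := by
    rw [hω.iotaInv_eq ht, hη.iotaInv_eq ht]; abel
  rw [e]
  exact isCP_repLam_sub h ht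

variable (hl : l ≤ 𝓝[>] (0 : ℝ)) (hw : Tendsto w l atTop)
include hl hw

theorem IsScaledLimit.condPos (hφ : IsScaledLimit l w η φ) (hη : IsQWeightMap η) {s : ℝ}
    (hs : 0 < s) : CondPos (-(φ * iotaAdd η s)) := by
  refine CondPos.of_tendsto (l := l)
    (φ := fun t => (w t : ℂ) • -(iotaInv η t * iotaAdd η s)) ?_ fun A => ?_
  · filter_upwards [hw.eventually_ge_atTop 0, eventually_mem_Ioc hl hs] with t h1 h2
    exact (hη.condPos_neg_iotaInv_mul_iotaAdd h2.1 h2.2).smul h1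
  · refine (hφ (iotaAdd η s A)).neg.congr fun t => ?_
    rw [LinearMap.smul_apply, LinearMap.neg_apply, Module.End.mul_apply, smul_neg]

theorem IsScaledLimit.isCP_comp (hφ : IsScaledLimit l w η φ) (hη : IsQWeightMap η) {s : ℝ}
    (hs : 0 < s) : IsCP (φ ∘ₗ cutMap η s) := by
  refine IsCP.of_tendsto (l := l)
    (φ := fun t => (w t : ℂ) • boundaryRep η t ∘ₗ sandwich (cutProj p s)) ?_ fun A => ?_
  · filter_upwards [hw.eventually_ge_atTop 0, eventually_mem_Ioc hl hs] with t h1 h2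
    exact ((hη.rep_cp t h2.1).comp (isCP_sandwich_cutProj s)).smul h1
  · refine (hφ (cutMap η s A)).congr' ?_
    filter_upwards [eventually_mem_Ioc hl hs] with t h2
    rw [LinearMap.smul_apply, LinearMap.comp_apply, boundaryRep_sandwich η h2.1 h2.2]

/-- For `t ≤ s`, `π_t^#` on operators cut at `s` is `(ι + ω|_t Λ)^{-1} ω|_s`. Only the inverse
varies with `t`, so the scaled order relation passes to the limit. -/
theorem IsScaledLimit.isCP_comp_sub (hψ : IsScaledLimit l w ω ψ) (hφ : IsScaledLimit l w η φ)
    (h : QGe ω η) {s : ℝ} (hs : 0 < s) :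
    IsCP (ψ ∘ₗ cutMap ω s - φ ∘ₗ cutMap η s) := by
  refine IsCP.of_tendsto (l := l)
    (φ := fun t => (w t : ℂ) • (boundaryRep ω t - boundaryRep η t) ∘ₗ sandwich (cutProj p s))
    ?_ fun A => ?_
  · filter_upwards [hw.eventually_ge_atTop 0, eventually_mem_Ioc hl hs] with t h1 h2
    exact ((h t h2.1).comp (isCP_sandwich_cutProj s)).smul h1
  · refine ((hψ (cutMap ω s A)).sub (hφ (cutMap η s A))).congr' ?_
    filter_upwards [eventually_mem_Ioc hl hs] with t h2
    rw [LinearMap.smul_apply, LinearMap.comp_apply, LinearMap.sub_apply,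
      boundaryRep_sandwich η h2.1 h2.2, boundaryRep_sandwich ω h2.1 h2.2, smul_sub]

theorem IsScaledLimit.isCP_sub (hψ : IsScaledLimit l w ω ψ) (hφ : IsScaledLimit l w η φ)
    (hω : IsQWeightMap ω) (hη : IsQWeightMap η) (h : QGe ω η) : IsCP (φ - ψ) := by
  refine IsCP.of_tendsto (l := l)
    (φ := fun t => (w t : ℂ) • (iotaInv η t - iotaInv ω t)) ?_ fun A => ?_
  · filter_upwards [hw.eventually_ge_atTop 0, eventually_mem_Ioc hl one_pos] with t h1 h2
    exact (hω.isCP_iotaInv_sub hη h h2.1).smul h1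
  · refine ((hφ A).sub (hψ A)).congr fun t => ?_
    rw [LinearMap.smul_apply, LinearMap.sub_apply, smul_sub]

/-- The identities in `1 - π_t^# (Λ - Λ|_s)` cancel between `ω` and `η`, so the difference survives
multiplication by `w_t`. This relation later bounds `ϑ - φη` uniformly in the cut-off. -/
theorem IsScaledLimit.isCP_mul_iotaAdd_sub (hψ : IsScaledLimit l w ω ψ)
    (hφ : IsScaledLimit l w η φ) (hω : IsQWeightMap ω) (hη : IsQWeightMap η) (h : QGe ω η) {s : ℝ}
    (hs : 0 < s) : IsCP (φ * iotaAdd η s - ψ * iotaAdd ω s) := by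
  refine IsCP.of_tendsto (l := l)
    (φ := fun t => (w t : ℂ) • (belowMap ω t s - belowMap η t s)) ?_ fun A => ?_
  · filter_upwards [hw.eventually_ge_atTop 0, eventually_mem_Ioc hl one_pos] with t h1 h2
    exact (isCP_belowMap_sub h h2.1 s).smul h1
  · refine ((hφ (iotaAdd η s A)).sub (hψ (iotaAdd ω s A))).congr' ?_
    filter_upwards [eventually_mem_Ioc hl hs] with t h2
    have h3 := congrArg (fun T : Module.End ℂ (BK p) => T A) (hω.iotaInv_mul_iotaAdd h2.1 h2.2)
    have h4 := congrArg (fun T : Module.End ℂ (BK p) => T A) (hη.iotaInv_mul_iotaAdd h2.1 h2.2)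
    simp only [Module.End.mul_apply, LinearMap.sub_apply, Module.End.one_apply] at h3 h4
    rw [h3, h4, LinearMap.smul_apply, LinearMap.sub_apply]
    refine (smul_sub _ _ _).symm.trans ?_
    congr 1
    abel

theorem IsQWeightMap.isCP_iotaInv_mul_limit (hη : IsQWeightMap η) {φ' : Module.End ℂ (BK p)}
    (hφ' : ∀ A, Tendsto (fun t => ((w t)⁻¹ : ℂ) • iotaAdd η t A) l (𝓝 (φ' A))) {s : ℝ}
    (hs : 0 < s) : IsCP (iotaInv η s * φ') := by
  refine IsCP.of_tendsto (l := l)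
    (φ := fun t => (((w t)⁻¹ : ℝ) : ℂ) • (iotaInv η s * iotaAdd η t)) ?_ fun A => ?_
  · filter_upwards [hw.eventually_ge_atTop 0, eventually_mem_Ioc hl hs] with t h1 h2
    exact (hη.isCP_iotaInv_mul_iotaAdd h2.1 h2.2).smul (inv_nonneg.2 h1)
  · refine (tendsto_end_apply (iotaInv η s) (hφ' A)).congr fun t => ?_
    rw [map_smul, LinearMap.smul_apply, Complex.ofReal_inv]
    rfl

end ScaledLimit

/-! ### Recovering `ψ` as the scaled limit of `ω`. -/

namespace IsCoefficientPair

variable {J : Type*} {ω ϑ : frakA p →ₗ[ℂ] BK p} {ψ : BK p ≃ₗ[ℂ] BK p} {D : StandardData p J}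

/-- The coefficient map as an endomorphism. -/
def coefEnd (ψ : BK p ≃ₗ[ℂ] BK p) : Module.End ℂ (BK p) := (ψ : BK p →ₗ[ℂ] BK p)

/-- The map `ψ + ϑ|_t Λ`. -/
def coefLam (φ : Module.End ℂ (BK p)) (ϑ : frakA p →ₗ[ℂ] BK p) (t : ℝ) : Module.End ℂ (BK p) :=
  φ + lamMap ϑ t

theorem mul_iotaAdd_eq {φ : Module.End ℂ (BK p)} {η ϑ : frakA p →ₗ[ℂ] BK p} (h : φ ∘ₗ η = ϑ)
    (t : ℝ) : φ * iotaAdd η t = coefLam φ ϑ t := by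
  rw [iotaAdd_eq, end_mul_add, mul_one, coefLam, ← h]
  rfl

theorem comp_cutMap_eq {φ : Module.End ℂ (BK p)} {η ϑ : frakA p →ₗ[ℂ] BK p} (h : φ ∘ₗ η = ϑ)
    (t : ℝ) : φ ∘ₗ cutMap η t = cutMap ϑ t := by
  rw [← h]; rfl

theorem coefEnd_mul_symm : coefEnd ψ * (ψ.symm : BK p →ₗ[ℂ] BK p) = 1 := by
  ext1 A
  exact ψ.apply_symm_apply A

theorem symm_mul_coefEnd : ((ψ.symm : BK p →ₗ[ℂ] BK p) : Module.End ℂ (BK p)) * coefEnd ψ = 1 := by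
  ext1 A
  exact ψ.symm_apply_apply A

variable (hD : IsCoefficientPair ω ψ ϑ D)
include hD

theorem comp_eq : coefEnd ψ ∘ₗ ω = ϑ := by
  rw [hD.eq]
  ext1 A
  exact ψ.apply_symm_apply _

theorem isAsymptoticTo : IsAsymptoticTo (𝓝[>] (0 : ℝ)) (coefLam (coefEnd ψ) ϑ) D.w := by
  obtain ⟨C₁, h₁0, h₁⟩ := exists_norm_apply_le (coefEnd ψ)
  obtain ⟨C₂, h₂⟩ := D.exists_norm_rhoLam_le
  intro ε hε
  -- The cross operator enters twice and so costs `ε w_t / 2 + 2C`; the remaining `ε w_t / 2`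
  -- absorbs all constants.
  obtain ⟨C, hC⟩ := D.norm_cross_le (ε := ε / 4) (by positivity)
  have hw : ∀ᶠ t in 𝓝[>] (0 : ℝ), 2 * (C₁ + C₂ + 2 * C) / ε ≤ D.w t :=
    hD.w_tendsto.eventually_ge_atTop _
  filter_upwards [hw, self_mem_nhdsWithin] with t h3 ht A
  have e : coefLam (coefEnd ψ) ϑ t A - (D.w t : ℂ) • A
      = coefEnd ψ A + (A * D.cross ht + star (D.cross ht) * A) + D.rhoLam t A := by
    rw [coefLam, hD.represents.lamMap_eq ht]
    simp only [LinearMap.add_apply, LinearMap.smul_apply, Module.End.one_apply, derivMap_apply]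
    abel
  rw [e]
  have h4 : ‖star (D.cross ht)‖ = ‖D.cross ht‖ := norm_star (E := Kp p →L[ℂ] Kp p) (D.cross ht)
  have h5 : ‖A * D.cross ht + star (D.cross ht) * A‖ ≤ 2 * ‖D.cross ht‖ * ‖A‖ := by
    refine (norm_add_le_of_le (norm_mul_le _ _) (norm_mul_le _ _)).trans (le_of_eq ?_)
    rw [h4]; ring
  refine (norm_add_le_of_le (norm_add_le_of_le (h₁ A) h5) (h₂ t A)).trans ?_
  rw [← add_mul, ← add_mul]
  gcongr
  rw [div_le_iff₀ hε] at h3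
  have := hC t ht
  linarith

/-- The map `(ι + ω|_t Λ)^{-1} ψ^{-1}` inverts `ψ + ϑ|_t Λ`, which is asymptotic to `w_t ι`. -/
theorem isScaledLimit (hω : IsQWeightMap ω) :
    IsScaledLimit (𝓝[>] (0 : ℝ)) D.w ω (coefEnd ψ) := fun A => by
  have h := hD.isAsymptoticTo.tendsto_inverse (R := fun t => iotaInv ω t *
    (ψ.symm : BK p →ₗ[ℂ] BK p)) hD.w_tendsto (by
      filter_upwards [self_mem_nhdsWithin] with t ht
      rw [← mul_iotaAdd_eq hD.comp_eq, mul_assoc, ← mul_assoc (iotaAdd ω t), hω.mul_iotaInv ht,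
        one_mul, coefEnd_mul_symm]) (ψ A)
  refine h.congr fun t => ?_
  rw [Module.End.mul_apply]
  congr 2
  exact ψ.symm_apply_apply A

end IsCoefficientPair

end QWeight

end

/-! ### Compactness: scaled limits of `q`-subordinates. -/

noncomputable section

namespace QWeight

open MeasureTheory Filter Topology
open scoped ComplexOrder InnerProductSpace ENNReal

variable {p : ℕ}

theorem exists_tendsto_of_norm_le {α : Type*} (U : Ultrafilter α) {f : α → BK p} {C : ℝ}
    (h : ∀ᶠ a in (U : Filter α), ‖f a‖ ≤ C) : ∃ B, Tendsto f (U : Filter α) (𝓝 B) := by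
  have : ProperSpace (BK p) := FiniteDimensional.proper ℂ (BK p)
  obtain ⟨B, -, hB⟩ := (isCompact_closedBall (0 : BK p) C).ultrafilter_le_nhds' (U.map f)
    (by
      change ∀ᶠ a in (U : Filter α), f a ∈ Metric.closedBall (0 : BK p) C
      filter_upwards [h] with a ha
      rwa [mem_closedBall_zero_iff])
  exact ⟨B, hB⟩

/-- Pointwise limits of linear maps are linear. -/
theorem exists_end_of_tendsto {α : Type*} {l : Filter α} [l.NeBot] {T : α → Module.End ℂ (BK p)}
    (h : ∀ A, ∃ B, Tendsto (fun a => T a A) l (𝓝 B)) :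
    ∃ S : Module.End ℂ (BK p), ∀ A, Tendsto (fun a => T a A) l (𝓝 (S A)) := by
  choose S hS using h
  exact ⟨linearMapOfTendsto S T (tendsto_pi_nhds.2 hS), hS⟩

theorem exists_end_of_norm_le {α : Type*} (U : Ultrafilter α) {T : α → Module.End ℂ (BK p)}
    (h : ∀ A, ∃ C : ℝ, ∀ᶠ a in (U : Filter α), ‖T a A‖ ≤ C) :
    ∃ S : Module.End ℂ (BK p), ∀ A, Tendsto (fun a => T a A) (U : Filter α) (𝓝 (S A)) :=
  exists_end_of_tendsto fun A => by
    obtain ⟨C, hC⟩ := h A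
    exact exists_tendsto_of_norm_le U hC

theorem oneSubLam_eq : oneSubLam p = toFrakA p 1 := by
  apply Subtype.ext
  rw [coe_toFrakA, mul_one, sqrtOp_mul_self]
  rfl

/-- A completely positive `b`-weight map `κ` with `κ|_s Λ` dominated uniformly in `s` is bounded. -/
theorem IsBWeightMap.isBoundedMap {κ : frakA p →ₗ[ℂ] BK p} (hκ : IsBWeightMap κ) (hcp : IsCPOn κ)
    {Z : Module.End ℂ (BK p)} (hZ : ∀ s, 0 < s → IsCP (Z - lamMap κ s)) : IsBoundedMap κ := by
  refine ⟨‖Z 1‖ + ‖κ (oneSubLam p)‖, fun A => ?_⟩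
  refine le_of_tendsto (hκ.tendsto_cutMap A).norm ?_
  filter_upwards [self_mem_nhdsWithin] with s hs
  refine (hcp.isCP_cutMap hs).norm_le_of_quad (by positivity) (fun x => ?_) _
  -- Split `E_s` into `E_s Λ E_s` and `E_s (I - Λ) E_s`. The hypothesis bounds the first
  -- contribution by `Z(1)`, and positivity bounds the second by `κ(I - Λ)`, both uniformly in `s`.
  have e : cutMap κ s 1 = lamMap κ s 1 + κ (toFrakA p (sandwich (cutProj p s) 1)) := by
    rw [← cut_toFrakA hs, ← oneSubLam_eq]
    change κ (cut p s 1) = κ (cut p s (Lam p 1)) + κ (cut p s (1 - Lam p 1))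
    rw [← map_add, ← map_add, add_sub_cancel]
  have h1 := (Complex.le_def.1 ((hZ s hs).nonneg_of_nonneg (A := 1) inner_self_nonneg_complex x)).1
  have h2 : 0 ≤ ⟪x, κ (toFrakA p (sandwich (1 - cutProj p s) 1)) x⟫_ℂ := by
    have hpos : IsCP (sandwich (sqrtOp p) ∘ₗ sandwich (1 - cutProj p s)) :=
      (isCP_sandwich star_sqrtOp).comp (isCP_sandwich (by rw [star_sub, star_one, star_cutProj]))
    exact matrixPos_one_iff.1 (hcp 1 (fun _ _ => toFrakA p (sandwich (1 - cutProj p s) 1))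
      (matrixPos_one_iff.2 (hpos.nonneg_of_nonneg inner_self_nonneg_complex))) x
  have e2 : κ (toFrakA p (sandwich (1 - cutProj p s) 1))
      = κ (oneSubLam p) - κ (toFrakA p (sandwich (cutProj p s) 1)) := by
    rw [oneSubLam_eq, ← map_sub, ← map_sub]
    congr 2
    change (1 - cutProj p s) * 1 * (1 - cutProj p s) = 1 - cutProj p s * 1 * cutProj p s
    have h : cutProj p s * cutProj p s = cutProj p s := cutProj_mul_of_le le_rfl
    simp only [mul_one, sub_mul, mul_sub, one_mul, h]
    abel
  rw [e2] at h2
  have h3 := (Complex.le_def.1 h2).1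
  have h4 := re_inner_le_opNorm (Z 1) x
  have h5 := re_inner_le_opNorm (κ (oneSubLam p)) x
  simp only [LinearMap.sub_apply, sub_apply, inner_sub_right, Complex.sub_re,
    Complex.zero_re] at h1 h3
  rw [e, add_apply, inner_add_right, Complex.add_re, add_mul]
  linarith

namespace IsCoefficientPair

variable {J : Type*} {ω ϑ η : frakA p →ₗ[ℂ] BK p} {ψ : BK p ≃ₗ[ℂ] BK p} {D : StandardData p J}
variable (hD : IsCoefficientPair ω ψ ϑ D)
include hD

theorem tendsto_iotaInv (hω : IsQWeightMap ω) (A : BK p) :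
    Tendsto (fun t => iotaInv ω t A) (𝓝[>] (0 : ℝ)) (𝓝 0) := by
  have h1 : Tendsto (fun t => ((D.w t)⁻¹ : ℂ)) (𝓝[>] (0 : ℝ)) (𝓝 0) := by
    have := (Complex.continuous_ofReal.tendsto 0).comp (tendsto_inv_atTop_zero.comp hD.w_tendsto)
    simpa [Function.comp_def] using this
  have h2 := h1.smul (hD.isScaledLimit hω A)
  have e0 : (0 : ℂ) • coefEnd ψ A = 0 := by ext; simp
  rw [e0] at h2
  refine h2.congr' ?_
  filter_upwards [hD.w_tendsto.eventually_gt_atTop 0] with t ht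
  have hne : (D.w t : ℂ) ≠ 0 := by exact_mod_cast ht.ne'
  rw [smul_smul, inv_mul_cancel₀ hne, one_smul]

theorem tendsto_iotaAdd (A : BK p) :
    Tendsto (fun t => ((D.w t)⁻¹ : ℂ) • iotaAdd ω t A) (𝓝[>] (0 : ℝ)) (𝓝 (ψ.symm A)) := by
  have h := tendsto_end_apply ((ψ.symm : BK p →ₗ[ℂ] BK p) : Module.End ℂ (BK p))
    (hD.isAsymptoticTo.tendsto_apply hD.w_tendsto A)
  refine h.congr fun t => ?_
  rw [map_smul, ← mul_iotaAdd_eq hD.comp_eq]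
  congr 1
  exact ψ.symm_apply_apply _

theorem isBWeightMap (hω : IsQWeightMap ω) : IsBWeightMap ϑ := by
  rw [← hD.comp_eq]
  exact hω.bweight.comp_left _

/-- A `q`-subordinate `η` for which `(ι + η|_t Λ)^{-1}` does not tend to `0` vanishes. -/
theorem eq_zero_of_tendsto (hω : IsQWeightMap ω) (hη : IsQWeightMap η) (hge : QGe ω η)
    {l : Filter ℝ} [l.NeBot] (hl : l ≤ 𝓝[>] (0 : ℝ)) {d : ℂ} (hd : d ≠ 0)
    (h : ∀ A, Tendsto (fun t => iotaInv η t A) l (𝓝 (d • A))) : η = 0 := by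
  ext1 A
  refine tendsto_nhds_unique (hη.bweight.tendsto_cutMap A) ?_
  refine tendsto_const_nhds.congr' ?_
  filter_upwards [self_mem_nhdsWithin] with s hs
  have hs' : 0 < s := hs
  have h1 := h (cutMap η s A)
  -- On operators cut at `s`, the boundary representation of `η` is dominated by that of `ω`, which
  -- tends to `0`.
  have h2 : Tendsto (fun t => iotaInv η t (cutMap η s A)) l (𝓝 0) := by
    have h3 : Tendsto (fun t => ‖iotaInv ω t (cutMap ω s 1)‖ * ‖(A : BH p)‖) l (𝓝 0) := by
      have := ((hD.tendsto_iotaInv hω (cutMap ω s 1)).mono_left hl).norm.mul_const ‖(A : BH p)‖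
      simpa using this
    refine squeeze_zero_norm' ?_ h3
    filter_upwards [eventually_mem_Ioc hl hs'] with t ht
    have h4 := ((hη.rep_cp t ht.1).comp (isCP_sandwich_cutProj s)).norm_le_of_sub
      (χ := boundaryRep ω t ∘ₗ sandwich (cutProj p s))
      (by
        have := (hge t ht.1).comp (isCP_sandwich_cutProj s)
        rwa [LinearMap.sub_comp] at this) A
    rwa [LinearMap.comp_apply, LinearMap.comp_apply, boundaryRep_sandwich η ht.1 ht.2,
      boundaryRep_sandwich ω ht.1 ht.2] at h4
  exact ((smul_eq_zero.1 (tendsto_nhds_unique h1 h2)).resolve_left hd).symm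

/-- For a non-zero `q`-subordinate `η`, the maps `w_t (ι + η|_t Λ)^{-1}` converge along an
ultrafilter at `0+` to an invertible map. -/
theorem exists_scaledLimit (hp : 0 < p) (hω : IsQWeightMap ω) (hη : IsQWeightMap η)
    (hge : QGe ω η) (hne : η ≠ 0) : ∃ (U : Ultrafilter ℝ) (φ φ' : Module.End ℂ (BK p)),
      (U : Filter ℝ) ≤ 𝓝[>] (0 : ℝ) ∧ IsScaledLimit (U : Filter ℝ) D.w η φ ∧
      (∀ A, Tendsto (fun t => ((D.w t)⁻¹ : ℂ) • iotaAdd η t A) (U : Filter ℝ) (𝓝 (φ' A))) ∧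
      φ' * φ = 1 := by
  have : Nonempty (Fin p) := ⟨⟨0, hp⟩⟩
  set U : Ultrafilter ℝ := Ultrafilter.of (𝓝[>] (0 : ℝ)) with hU
  have hl : (U : Filter ℝ) ≤ 𝓝[>] (0 : ℝ) := Ultrafilter.of_le _
  have hw : Tendsto D.w (U : Filter ℝ) atTop := hD.w_tendsto.mono_left hl
  have hpos : ∀ᶠ t in (U : Filter ℝ), 0 < t := hl self_mem_nhdsWithin
  -- the unscaled limit
  obtain ⟨M, hM⟩ := exists_end_of_norm_le U (T := iotaInv η) fun A =>
    ⟨‖A‖ + ‖Lam p A‖, by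
      filter_upwards [hpos] with t ht
      rw [hη.iotaInv_eq ht]
      exact (norm_sub_le _ _).trans (add_le_add le_rfl (hη.rep_contractive t ht _))⟩
  have hMcp : IsCP M := by
    refine IsCP.of_tendsto (l := (U : Filter ℝ)) (φ := fun t => iotaInv η t - iotaInv ω t)
      (hpos.mono fun t ht => hω.isCP_iotaInv_sub hη hge ht) fun A => ?_
    have := (hM A).sub ((hD.tendsto_iotaInv hω A).mono_left hl)
    rwa [sub_zero] at this
  have hM1 : IsCP (1 - M) := by
    refine IsCP.of_tendsto (l := (U : Filter ℝ)) (φ := fun t => repLam η t)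
      (hpos.mono fun t ht => (hη.rep_cp t ht).comp isCP_Lam) fun A => ?_
    refine ((tendsto_const_nhds (x := A)).sub (hM A)).congr' ?_
    filter_upwards [hpos] with t ht
    rw [hη.iotaInv_eq ht, LinearMap.sub_apply, Module.End.one_apply]
    abel
  -- Both `M` and `1 - M` are completely positive, so `M` is a scalar `d`; a non-zero `d` would
  -- force `η = 0`.
  obtain ⟨d, -, hMd⟩ := hMcp.eq_smul_one (by
    have e : -M = (1 - M) + ((-1 : ℝ) : ℂ) • 1 := by
      ext1 A
      simp
      abel
    rw [e]
    exact hM1.condPos.add (condPos_smul_one _))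
  have hd0 : (d : ℂ) = 0 := by
    by_contra hd
    refine hne (hD.eq_zero_of_tendsto hω hη hge hl hd fun A => ?_)
    have := hM A
    rwa [hMd] at this
  have hM0 : ∀ A, Tendsto (fun t => iotaInv η t A) (U : Filter ℝ) (𝓝 0) := fun A => by
    have := hM A
    rwa [hMd, hd0, zero_smul, LinearMap.zero_apply] at this
  -- the scaled limit
  let W : Submodule ℂ (BK p) :=
    { carrier := {A | ∃ B, Tendsto (fun t => (D.w t : ℂ) • iotaInv η t A) (U : Filter ℝ) (𝓝 B)}
      zero_mem' := ⟨0, tendsto_const_nhds.congr fun t => by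
        rw [map_zero]; ext; simp⟩
      add_mem' := by
        rintro A A' ⟨B, hB⟩ ⟨B', hB'⟩
        refine ⟨B + B', (hB.add hB').congr fun t => ?_⟩
        rw [map_add, smul_add]
      smul_mem' := by
        rintro c A ⟨B, hB⟩
        refine ⟨c • B, (hB.const_smul c).congr fun t => ?_⟩
        rw [map_smul, smul_comm] }
  -- On the range of `η|_s` the scaled inverses are dominated by those of `ω`, which converge, so a
  -- limit exists along the ultrafilter.
  have hWcut : ∀ s, 0 < s → ∀ B, cutMap η s B ∈ W := fun s hs B => by
    have hb := ((hD.isScaledLimit hω (cutMap ω s 1)).mono_left hl).norm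
    refine exists_tendsto_of_norm_le U
      (C := (‖coefEnd ψ (cutMap ω s 1)‖ + 1) * ‖(B : BH p)‖) ?_
    filter_upwards [eventually_mem_Ioc hl hs, hb.eventually_le_const (lt_add_one _)] with t ht h1
    have h2 := ((hη.rep_cp t ht.1).comp (isCP_sandwich_cutProj s)).norm_le_of_sub
      (χ := boundaryRep ω t ∘ₗ sandwich (cutProj p s))
      (by
        have := (hge t ht.1).comp (isCP_sandwich_cutProj s)
        rwa [LinearMap.sub_comp] at this) B
    rw [LinearMap.comp_apply, LinearMap.comp_apply, boundaryRep_sandwich η ht.1 ht.2,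
      boundaryRep_sandwich ω ht.1 ht.2] at h2
    have h3 : ‖(D.w t : ℂ) • iotaInv η t (cutMap η s B)‖
        ≤ ‖(D.w t : ℂ) • iotaInv ω t (cutMap ω s 1)‖ * ‖B‖ := by
      rw [norm_smul, norm_smul, mul_assoc]
      exact mul_le_mul_of_nonneg_left h2 (norm_nonneg _)
    exact h3.trans (mul_le_mul_of_nonneg_right h1 (norm_nonneg _))
  -- The vector `A - (ι + η|_t Λ)^{-1} A` lies in the range of `η|_t`, hence in `W`, and tends to
  -- `A`; the finite-dimensional space `W` is closed.
  have hW : ∀ A, A ∈ W := fun A => by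
    have hclosed : IsClosed (W : Set (BK p)) := W.closed_of_finiteDimensional
    have h1 : Tendsto (fun t => A - iotaInv η t A) (U : Filter ℝ) (𝓝 A) := by
      simpa using (tendsto_const_nhds (x := A)).sub (hM0 A)
    refine hclosed.mem_of_tendsto h1 (hpos.mono fun t ht => ?_)
    have h2 := congrArg (fun T : Module.End ℂ (BK p) => T A) (hη.mul_iotaInv ht)
    have h3 : A - iotaInv η t A = cutMap η t (Lam p (iotaInv η t A)) := by
      rw [sub_eq_iff_eq_add']
      exact h2.symm
    rw [h3]
    exact hWcut t ht _
  obtain ⟨φ, hφ⟩ := exists_end_of_tendsto (l := (U : Filter ℝ))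
    (T := fun t => (D.w t : ℂ) • iotaInv η t) hW
  -- the inverse of the scaled limit
  have hbd : ∀ᶠ t in (U : Filter ℝ), ∀ A,
      ‖((D.w t)⁻¹ : ℂ) • iotaAdd η t A‖ ≤ (‖ψ.symm 1‖ + 1) * ‖A‖ := by
    have h1 := ((hD.tendsto_iotaAdd (1 : BK p)).mono_left hl).norm
    filter_upwards [hpos, h1.eventually_le_const (lt_add_one _)] with t ht h2 A
    -- This resolvent identity exhibits the difference as a product of completely positive maps, so
    -- `ι + η|_t Λ` inherits the `O(w_t)` bound of `ι + ω|_t Λ`.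
    have e : iotaAdd ω t - iotaAdd η t
        = iotaAdd ω t * (iotaInv η t - iotaInv ω t) * iotaAdd η t := by
      rw [end_mul_sub, end_sub_mul, hω.mul_iotaInv ht, mul_assoc, hη.iotaInv_mul ht, one_mul,
        mul_one]
    have hcp : IsCP (iotaAdd ω t - iotaAdd η t) := by
      rw [e]
      exact (((hω.isCP_iotaAdd ht).mul (hω.isCP_iotaInv_sub hη hge ht)).mul (hη.isCP_iotaAdd ht))
    have h3 := (hη.isCP_iotaAdd ht).norm_le_of_sub hcp A
    have h4 : ‖((D.w t)⁻¹ : ℂ) • iotaAdd η t A‖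
        ≤ ‖((D.w t)⁻¹ : ℂ) • iotaAdd ω t 1‖ * ‖A‖ := by
      rw [norm_smul, norm_smul, mul_assoc]
      exact mul_le_mul_of_nonneg_left h3 (norm_nonneg _)
    exact h4.trans (mul_le_mul_of_nonneg_right h2 (norm_nonneg _))
  obtain ⟨φ', hφ'⟩ := exists_end_of_norm_le U
    (T := fun t => ((D.w t)⁻¹ : ℂ) • iotaAdd η t) fun A => ⟨_, hbd.mono fun t h => h A⟩
  refine ⟨U, φ, φ', hl, hφ, hφ', ?_⟩
  ext1 A
  have h1 : Tendsto (fun t => ((D.w t)⁻¹ : ℂ) • iotaAdd η t ((D.w t : ℂ) • iotaInv η t A - φ A))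
      (U : Filter ℝ) (𝓝 0) := by
    have h2 : Tendsto (fun t => (‖ψ.symm 1‖ + 1) * ‖(D.w t : ℂ) • iotaInv η t A - φ A‖)
        (U : Filter ℝ) (𝓝 0) := by
      have h3 := ((tendsto_iff_norm_sub_tendsto_zero.1 (hφ A)).const_mul (‖ψ.symm 1‖ + 1))
      rwa [mul_zero] at h3
    exact squeeze_zero_norm' (hbd.mono fun t h => h _) h2
  have h3 := h1.add (hφ' (φ A))
  rw [zero_add] at h3
  refine tendsto_nhds_unique h3 (tendsto_const_nhds.congr' ?_)
  filter_upwards [hpos, hw.eventually_gt_atTop 0] with t ht hwt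
  have hne : (D.w t : ℂ) ≠ 0 := by exact_mod_cast hwt.ne'
  have h4 : iotaAdd η t (iotaInv η t A) = A :=
    congrArg (fun T : Module.End ℂ (BK p) => T A) (hη.mul_iotaInv ht)
  have h5 : (iotaAdd η t) ((D.w t : ℂ) • iotaInv η t A - φ A)
      = (D.w t : ℂ) • A - iotaAdd η t (φ A) := by rw [map_sub, map_smul, h4]
  have h6 : ((D.w t)⁻¹ : ℂ) • ((D.w t : ℂ) • A - iotaAdd η t (φ A))
      = A - ((D.w t)⁻¹ : ℂ) • iotaAdd η t (φ A) := by
    refine (smul_sub _ _ _).trans ?_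
    rw [smul_smul, inv_mul_cancel₀ hne, one_smul]
  rw [LinearMap.smul_apply, h5, h6, Module.End.one_apply]
  abel

end IsCoefficientPair

end QWeight

end

/-! ### Sufficiency: the `q`-subordinates form a chain. -/

noncomputable section

namespace QWeight

open MeasureTheory Filter Topology
open scoped ComplexOrder InnerProductSpace ENNReal

variable {p : ℕ}

theorem boundaryRep_zero (t : ℝ) : boundaryRep (0 : frakA p →ₗ[ℂ] BK p) t = 0 := by
  ext1 A
  rw [boundaryRep_apply]
  exact map_zero _

theorem IsQWeightMap.qGe_zero {ω : frakA p →ₗ[ℂ] BK p} (hω : IsQWeightMap ω) : QGe ω 0 :=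
  fun t ht => by
    have e : boundaryRep ω t - boundaryRep 0 t = boundaryRep ω t := by
      rw [boundaryRep_zero]; abel
    rw [e]
    exact hω.rep_cp t ht

namespace IsCoefficientPair

variable {J : Type*} {ω ϑ η : frakA p →ₗ[ℂ] BK p} {ψ : BK p ≃ₗ[ℂ] BK p} {D : StandardData p J}

/-- If `ψ + ϑ|_s Λ` is conditionally negative for all `s`, so is `ψ + ρΛ`. -/
theorem condPos_neg_add_rho {φ : Module.End ℂ (BK p)} (hϑ : D.Represents ϑ)
    (h : ∀ s, 0 < s → CondPos (-(coefLam φ ϑ s))) :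
    CondPos (-(φ + D.rho ∘ₗ Lam p)) := by
  refine CondPos.of_tendsto (l := 𝓝[>] (0 : ℝ)) (φ := fun s => -(φ + D.rhoLam s)) ?_ fun A =>
    ((tendsto_const_nhds (x := φ A)).add (D.tendsto_rhoLam A)).neg
  filter_upwards [self_mem_nhdsWithin] with s hs
  -- The terms of `ϑ|_s Λ` other than `ρ|_s Λ` are conditionally zero and may be removed.
  have e : -(φ + D.rhoLam s)
      = -(coefLam φ ϑ s) + ((D.w s : ℝ) : ℂ) • 1 + derivMap (D.cross hs) := by
    rw [coefLam, hϑ.lamMap_eq hs]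
    abel
  rw [e]
  exact ((h s hs).add (condPos_smul_one _)).add (condPos_derivMap _)

/-- The resolvent identity `R₁ - R₂ = (b - a) R₁ R₂` shows that the smaller shift gives the larger
boundary representation. -/
theorem isCP_boundaryRep_sub {η₁ η₂ : frakA p →ₗ[ℂ] BK p} (h₂ : IsQWeightMap η₂) {a b : ℝ}
    (hab : a ≤ b) {s : ℝ} (hs : 0 < s) {L R₁ R₂ : Module.End ℂ (BK p)} (hR₁ : IsCP R₁)
    (e₁ : R₁ * (L + (a : ℂ) • 1) = 1) (e₂ : R₂ * (L + (b : ℂ) • 1) = 1)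
    (b₁ : boundaryRep η₁ s = R₁ ∘ₗ cutMap ϑ s) (b₂ : boundaryRep η₂ s = R₂ ∘ₗ cutMap ϑ s) :
    IsCP (boundaryRep η₁ s - boundaryRep η₂ s) := by
  have e : R₁ - R₂ = ((b - a : ℝ) : ℂ) • (R₁ * R₂) := by
    have h1 : R₁ * (L + (b : ℂ) • 1) * R₂ = R₁ := by
      rw [mul_assoc, mul_eq_one_comm.1 e₂, mul_one]
    have h2 : L + (b : ℂ) • 1 = (L + (a : ℂ) • 1) + ((b - a : ℝ) : ℂ) • 1 := by
      push_cast
      have := sub_smul (b : ℂ) a (1 : Module.End ℂ (BK p))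
      rw [this]
      abel
    rw [h2, end_mul_add, e₁, end_add_mul, one_mul, mul_smul_comm, mul_one, smul_mul_assoc] at h1
    nth_rewrite 1 [← h1]
    abel
  have e' : boundaryRep η₁ s - boundaryRep η₂ s
      = ((b - a : ℝ) : ℂ) • R₁ ∘ₗ boundaryRep η₂ s := by
    rw [b₁, b₂, ← LinearMap.sub_comp, e]
    rfl
  rw [e']
  exact (hR₁.comp (h₂.rep_cp s hs)).smul (sub_nonneg.2 hab)

variable (hD : IsCoefficientPair ω ψ ϑ D)
include hD

/-- If `ψ + ρΛ` is conditionally zero and `ϑ` is strictly infinite, the non-zero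
`q`-subordinates are those given by `ψ + λι` and `ϑ`, with `λ ≥ 0`. -/
theorem exists_shift (hp : 0 < p) (hω : IsQWeightMap ω) (hη : IsQWeightMap η)
    (hge : QGe ω η) (hne : η ≠ 0)
    (hz : ConditionallyZero ((ψ : BK p →ₗ[ℂ] BK p) + D.rho ∘ₗ Lam p))
    (hs : StrictlyInfinite ϑ) : ∃ lam : ℝ, 0 ≤ lam ∧ ∀ s, 0 < s → ∃ R : Module.End ℂ (BK p),
      IsCP R ∧ R * (coefLam (coefEnd ψ) ϑ s + (lam : ℂ) • 1) = 1 ∧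
        boundaryRep η s = R ∘ₗ cutMap ϑ s := by
  have : Nonempty (Fin p) := ⟨⟨0, hp⟩⟩
  obtain ⟨U, φ, φ', hl, hφ, hφ', hinv⟩ := hD.exists_scaledLimit hp hω hη hge hne
  have hw : Tendsto D.w (U : Filter ℝ) atTop := hD.w_tendsto.mono_left hl
  have hψ : IsScaledLimit (U : Filter ℝ) D.w ω (coefEnd ψ) :=
    fun A => (hD.isScaledLimit hω A).mono_left hl
  have hηb : IsBWeightMap (φ ∘ₗ η) := hη.bweight.comp_left φ
  have hκb : IsBWeightMap (ϑ - φ ∘ₗ η) := (hD.isBWeightMap hω).sub hηb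
  have hκcp : IsCPOn (ϑ - φ ∘ₗ η) := by
    refine hκb.isCPOn (l := 𝓝[>] (0 : ℝ)) le_rfl ?_
    filter_upwards [self_mem_nhdsWithin] with s hs
    have := hψ.isCP_comp_sub hl hw hφ hge hs
    rw [comp_cutMap_eq hD.comp_eq] at this
    exact this
  have hηcp : IsCPOn (φ ∘ₗ η) := by
    refine hηb.isCPOn (l := 𝓝[>] (0 : ℝ)) le_rfl ?_
    filter_upwards [self_mem_nhdsWithin] with s hs
    exact hφ.isCP_comp hl hw hη hs
  -- All cut-offs of `κ = ϑ - φη` satisfy `κ|_s Λ ≤ φ - ψ`, so `κ` is bounded and strict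
  -- infiniteness applies.
  have hκ0 : ϑ - φ ∘ₗ η = 0 := by
    refine hs _ hκb hκcp (hκb.isBoundedMap hκcp (Z := φ - coefEnd ψ) fun s hs => ?_) ?_
    · have := hψ.isCP_mul_iotaAdd_sub hl hw hφ hω hη hge hs
      rw [mul_iotaAdd_eq hD.comp_eq, mul_iotaAdd_eq rfl] at this
      have e : φ - coefEnd ψ - lamMap (ϑ - φ ∘ₗ η) s
          = coefLam φ (φ ∘ₗ η) s - coefLam (coefEnd ψ) ϑ s := by
        have e' : lamMap (ϑ - φ ∘ₗ η) s = lamMap ϑ s - lamMap (φ ∘ₗ η) s := rfl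
        rw [e', coefLam, coefLam]
        abel
      rw [e]
      exact this
    · have e : ϑ - (ϑ - φ ∘ₗ η) = φ ∘ₗ η := by abel
      rwa [e]
  have hφη : φ ∘ₗ η = ϑ := (sub_eq_zero.1 hκ0).symm
  have hneg : CondPos (-(φ + D.rho ∘ₗ Lam p)) := by
    refine condPos_neg_add_rho hD.represents fun s hs => ?_
    rw [← mul_iotaAdd_eq hφη]
    exact hφ.condPos hl hw hη hs
  -- `φ - ψ` is conditionally negative: `φ + ρΛ` is, and subtracting the conditionally zero `ψ + ρΛ`
  -- does not change that.
  obtain ⟨lam, hlam, hlam'⟩ := (hψ.isCP_sub hl hw hφ hω hη hge).eq_smul_one (by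
    have e : -(φ - coefEnd ψ) = -(φ + D.rho ∘ₗ Lam p) + (coefEnd ψ + D.rho ∘ₗ Lam p) := by
      abel
    rw [e]
    exact hneg.add hz.1)
  have hφψ : φ = coefEnd ψ + (lam : ℂ) • 1 := by
    rw [← hlam']; abel
  have hinv' : φ * φ' = 1 := mul_eq_one_comm.1 hinv
  refine ⟨lam, hlam, fun s hs => ⟨iotaInv η s * φ', hη.isCP_iotaInv_mul_limit hl hw hφ' hs, ?_, ?_⟩⟩
  · have e : coefLam (coefEnd ψ) ϑ s + (lam : ℂ) • 1 = φ * iotaAdd η s := by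
      rw [mul_iotaAdd_eq hφη, coefLam, coefLam, hφψ]
      abel
    rw [e, mul_assoc, ← mul_assoc φ', hinv, one_mul, hη.iotaInv_mul hs]
  · rw [← hφη]
    ext1 A
    have h1 : φ' (φ (cutMap η s A)) = cutMap η s A :=
      congrArg (fun T : Module.End ℂ (BK p) => T _) hinv
    rw [boundaryRep_apply]
    change _ = iotaInv η s (φ' (φ (cutMap η s A)))
    rw [h1]

theorem isQPure (hp : 0 < p) (hω : IsQWeightMap ω)
    (hz : ConditionallyZero ((ψ : BK p →ₗ[ℂ] BK p) + D.rho ∘ₗ Lam p))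
    (hs : StrictlyInfinite ϑ) : IsQPure ω := by
  rintro η₁ η₂ ⟨h₁, hge₁⟩ ⟨h₂, hge₂⟩
  rcases eq_or_ne η₁ 0 with rfl | hne₁
  · exact Or.inr h₂.qGe_zero
  rcases eq_or_ne η₂ 0 with rfl | hne₂
  · exact Or.inl h₁.qGe_zero
  obtain ⟨a, -, ha⟩ := hD.exists_shift hp hω h₁ hge₁ hne₁ hz hs
  obtain ⟨b, -, hb⟩ := hD.exists_shift hp hω h₂ hge₂ hne₂ hz hs
  rcases le_total a b with hab | hab
  · refine Or.inl fun s hs => ?_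
    obtain ⟨R₁, hR₁, e₁, b₁⟩ := ha s hs
    obtain ⟨R₂, -, e₂, b₂⟩ := hb s hs
    exact isCP_boundaryRep_sub h₂ hab hs hR₁ e₁ e₂ b₁ b₂
  · refine Or.inr fun s hs => ?_
    obtain ⟨R₁, hR₁, e₁, b₁⟩ := ha s hs
    obtain ⟨R₂, hR₂, e₂, b₂⟩ := hb s hs
    exact isCP_boundaryRep_sub h₁ hab hs hR₂ e₂ e₁ b₂ b₁

end IsCoefficientPair

end QWeight

end

/-! ### Constructing `q`-subordinates from perturbations of `(ψ, ϑ)`. -/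

noncomputable section

namespace QWeight

open MeasureTheory Filter Topology
open scoped ComplexOrder InnerProductSpace ENNReal

variable {p : ℕ}

namespace IsCoefficientPair

variable {J : Type*} {ω ϑ κ : frakA p →ₗ[ℂ] BK p} {ψ : BK p ≃ₗ[ℂ] BK p} {D : StandardData p J}
  {ζ : Module.End ℂ (BK p)}

/-- Conditions on a pair `(ζ, κ)` under which `ψ + ζ` and `ϑ - κ` are the coefficient map and
the limiting `b`-weight map of a `q`-subordinate. -/
structure IsPerturbation (ψ : BK p ≃ₗ[ℂ] BK p) (ϑ : frakA p →ₗ[ℂ] BK p)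
    (ζ : Module.End ℂ (BK p)) (κ : frakA p →ₗ[ℂ] BK p) : Prop where
  cp : IsCP ζ
  bweight : IsBWeightMap κ
  isCPOn : IsCPOn κ
  isCPOn_sub : IsCPOn (ϑ - κ)
  isCP_sub : ∀ t, 0 < t → IsCP (ζ - lamMap κ t)
  condPos : ∀ t, 0 < t → CondPos (-(coefLam (coefEnd ψ) ϑ t + (ζ - lamMap κ t)))

theorem coefLam_add_sub (φ ζ : Module.End ℂ (BK p)) (ϑ κ : frakA p →ₗ[ℂ] BK p) (t : ℝ) :
    coefLam (φ + ζ) (ϑ - κ) t = coefLam φ ϑ t + (ζ - lamMap κ t) := by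
  have e : lamMap (ϑ - κ) t = lamMap ϑ t - lamMap κ t := rfl
  rw [coefLam, coefLam, e]
  abel

variable (hD : IsCoefficientPair ω ψ ϑ D)
include hD

theorem isCP_iotaInv_mul_symm (hω : IsQWeightMap ω) {t : ℝ} (ht : 0 < t) :
    IsCP (iotaInv ω t * ((ψ.symm : BK p →ₗ[ℂ] BK p) : Module.End ℂ (BK p))) :=
  hω.isCP_iotaInv_mul_limit le_rfl hD.w_tendsto hD.tendsto_iotaAdd ht

theorem iotaInv_mul_symm_mul (hω : IsQWeightMap ω) {t : ℝ} (ht : 0 < t) :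
    iotaInv ω t * ((ψ.symm : BK p →ₗ[ℂ] BK p) : Module.End ℂ (BK p)) *
      coefLam (coefEnd ψ) ϑ t = 1 := by
  rw [← mul_iotaAdd_eq hD.comp_eq, mul_assoc, ← mul_assoc _ (coefEnd ψ), symm_mul_coefEnd, one_mul,
    hω.iotaInv_mul ht]

/-- Put `φ = ψ + ζ` and `η = φ^{-1}(ϑ - κ)`. Then `φ(ι + η|_t Λ)` is `ψ + ϑ|_t Λ` plus the
completely positive map `ζ - κ|_t Λ`. It is conditionally negative, so `CondPos.exists_inverse`
supplies a completely positive inverse. The added map is bounded by `‖ζ(1)‖` uniformly in `t`, so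
the asymptotics `w_t ι` persist and `φ` is the scaled limit. -/
theorem exists_subordinate (hp : 0 < p) (hω : IsQWeightMap ω) (h : IsPerturbation ψ ϑ ζ κ) :
    ∃ η, IsQSubordinate ω η ∧ (coefEnd ψ + ζ) ∘ₗ η = ϑ - κ ∧
      IsScaledLimit (𝓝[>] (0 : ℝ)) D.w η (coefEnd ψ + ζ) := by
  have : Nonempty (Fin p) := ⟨⟨0, hp⟩⟩
  set φ := coefEnd ψ + ζ with hφ
  have hL : ∀ t, coefLam φ (ϑ - κ) t = coefLam (coefEnd ψ) ϑ t + (ζ - lamMap κ t) :=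
    coefLam_add_sub _ _ _ _
  have hLneg : ∀ t, 0 < t → CondPos (-coefLam φ (ϑ - κ) t) := fun t ht => by
    rw [hL]; exact h.condPos t ht
  obtain ⟨φ', hφ'cp, hφ'⟩ : ∃ φ' : Module.End ℂ (BK p), IsCP φ' ∧ φ' * φ = 1 := by
    refine CondPos.exists_inverse (L₀ := coefEnd ψ) ?_ hD.inv_cp symm_mul_coefEnd ?_
    -- Any single cut-off level suffices here: adding the completely positive `(ϑ - κ)|_1 Λ` back
    -- preserves conditional positivity.
    · have e : -φ = -coefLam φ (ϑ - κ) 1 + lamMap (ϑ - κ) 1 := by rw [coefLam]; abel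
      rw [e]
      exact (hLneg 1 one_pos).add
        (((h.isCPOn_sub.isCP_cutMap one_pos).comp isCP_Lam : IsCP (lamMap (ϑ - κ) 1))).condPos
    · have e : φ - coefEnd ψ = ζ := by rw [hφ]; abel
      rw [e]
      exact h.cp
  have hφ'' : φ * φ' = 1 := mul_eq_one_comm.1 hφ'
  set η : frakA p →ₗ[ℂ] BK p := φ' ∘ₗ (ϑ - κ) with hη
  have hφη : φ ∘ₗ η = ϑ - κ := by
    ext1 A
    exact congrArg (fun T : Module.End ℂ (BK p) => T _) hφ''
  have hmul : ∀ t, φ * iotaAdd η t = coefLam φ (ϑ - κ) t := mul_iotaAdd_eq hφη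
  have hR : ∀ t, 0 < t → ∃ R : Module.End ℂ (BK p), IsCP R ∧ R * coefLam φ (ϑ - κ) t = 1 :=
    fun t ht => CondPos.exists_inverse (hLneg t ht) (hD.isCP_iotaInv_mul_symm hω ht)
      (hD.iotaInv_mul_symm_mul hω ht) (by
        have e : coefLam φ (ϑ - κ) t - coefLam (coefEnd ψ) ϑ t = ζ - lamMap κ t := by
          rw [hL]; abel
        rw [e]
        exact h.isCP_sub t ht)
  have hinv : ∀ t, 0 < t → IsUnit (iotaAdd η t) := fun t ht => by
    obtain ⟨R, -, hR⟩ := hR t ht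
    have h1 : R * φ * iotaAdd η t = 1 := by rw [mul_assoc, hmul, hR]
    exact ⟨⟨_, _, mul_eq_one_comm.1 h1, h1⟩, rfl⟩
  have hrep : ∀ t, 0 < t → ∀ R : Module.End ℂ (BK p), R * coefLam φ (ϑ - κ) t = 1 →
      boundaryRep η t = R ∘ₗ cutMap (ϑ - κ) t := fun t ht R hR => by
    have h1 : R * φ * iotaAdd η t = 1 := by rw [mul_assoc, hmul, hR]
    have h2 : iotaInv η t = R * φ :=
      (left_inv_eq_right_inv h1 (Ring.mul_inverse_cancel _ (hinv t ht))).symm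
    rw [← comp_cutMap_eq hφη]
    ext1 A
    rw [boundaryRep_apply, h2]
    rfl
  have hcp : ∀ t, 0 < t → IsCP (boundaryRep η t) := fun t ht => by
    obtain ⟨R, hRcp, hR⟩ := hR t ht
    rw [hrep t ht R hR]
    exact hRcp.comp (h.isCPOn_sub.isCP_cutMap ht)
  have hge : QGe ω η := fun t ht => by
    obtain ⟨R, hRcp, hR⟩ := hR t ht
    set R₀ := iotaInv ω t * ((ψ.symm : BK p →ₗ[ℂ] BK p) : Module.End ℂ (BK p)) with hR₀
    have h1 : R * coefLam φ (ϑ - κ) t * R₀ = R₀ := by rw [hR, one_mul]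
    have h2 : coefLam (coefEnd ψ) ϑ t * R₀ = 1 :=
      mul_eq_one_comm.1 (hD.iotaInv_mul_symm_mul hω ht)
    rw [hL, end_mul_add, end_add_mul, mul_assoc R, h2, mul_one] at h1
    have h3 : boundaryRep ω t = R₀ ∘ₗ cutMap ϑ t := by
      rw [← comp_cutMap_eq hD.comp_eq]
      ext1 A
      have := congrArg (fun T : Module.End ℂ (BK p) => T (cutMap ω t A))
        (symm_mul_coefEnd (ψ := ψ))
      exact congrArg (iotaInv ω t) this.symm
    -- The resolvent identity `R₀ = R + R (ζ - κ|_t Λ) R₀` splits the difference into two visibly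
    -- completely positive terms.
    have e : boundaryRep ω t - boundaryRep η t
        = (R * (ζ - lamMap κ t)) ∘ₗ boundaryRep ω t + R ∘ₗ cutMap κ t := by
      ext1 A
      have h4 := congrArg (fun T : Module.End ℂ (BK p) => T (cutMap ϑ t A)) h1
      have h5 : R (cutMap (ϑ - κ) t A) = R (cutMap ϑ t A) - R (cutMap κ t A) :=
        map_sub R (cutMap ϑ t A) (cutMap κ t A)
      have h6 : R₀ (cutMap ϑ t A) = R (cutMap ϑ t A)
          + (R * (ζ - lamMap κ t)) (R₀ (cutMap ϑ t A)) := h4.symm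
      rw [LinearMap.sub_apply, hrep t ht R hR, LinearMap.add_apply, LinearMap.comp_apply,
        LinearMap.comp_apply, LinearMap.comp_apply, h5, h3, LinearMap.comp_apply]
      nth_rewrite 1 [h6]
      abel
    rw [e]
    exact ((hRcp.mul (h.isCP_sub t ht)).comp (hω.rep_cp t ht)).add
      (hRcp.comp (h.isCPOn.isCP_cutMap ht))
  have hηb : IsBWeightMap η := ((hD.isBWeightMap hω).sub h.bweight).comp_left φ'
  refine ⟨η, ⟨⟨hηb, fun n A hA => hφ'cp n _ (h.isCPOn_sub n A hA), hinv, hcp, fun t ht A => ?_,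
    fun t ht => (hηb.isNormalMap_cutMap ht).comp_left _⟩, hge⟩, hφη, fun A => ?_⟩
  -- Contractivity is inherited from `ω` by domination at the identity.
  · refine ((hcp t ht).norm_le_of_sub (hge t ht) A).trans (mul_le_of_le_one_left (norm_nonneg _) ?_)
    exact (hω.rep_contractive t ht 1).trans ContinuousLinearMap.norm_id_le
  · have hpos : ∀ᶠ t in 𝓝[>] (0 : ℝ), 0 < t := self_mem_nhdsWithin
    have h1 := (hD.isAsymptoticTo.add_bounded (Z := fun t => ζ - lamMap κ t) hD.w_tendsto
      (C := ‖ζ 1‖) (hpos.mono fun t ht A => (h.isCP_sub t ht).norm_le_of_sub (by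
        rw [sub_sub_cancel]
        exact (h.isCPOn.isCP_cutMap ht).comp isCP_Lam) A)).tendsto_inverse
      (R := fun t => iotaInv η t * φ') hD.w_tendsto (hpos.mono fun t ht => by
        rw [← hL, ← hmul, mul_assoc, ← mul_assoc (iotaAdd η t)]
        have h2 : iotaAdd η t * iotaInv η t = 1 := Ring.mul_inverse_cancel _ (hinv t ht)
        rw [h2, one_mul, hφ'']) (φ A)
    refine h1.congr fun t => ?_
    rw [Module.End.mul_apply]
    congr 2
    exact congrArg (fun T : Module.End ℂ (BK p) => T A) hφ'

end IsCoefficientPair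

end QWeight

end

/-! ### Necessity: testing `q`-purity on perturbations. -/

noncomputable section

namespace QWeight

open MeasureTheory Filter Topology
open scoped ComplexOrder InnerProductSpace ENNReal

variable {p : ℕ}

theorem lamMap_sub_lamMap (ω : frakA p →ₗ[ℂ] BK p) {t s : ℝ} (ht : 0 < t) (hts : t ≤ s) :
    lamMap ω t - lamMap ω s = cutMap ω t ∘ₗ lamBelow p s :=
  (cutMap_comp_lamBelow ω ht hts).symm

theorem IsCPOn.isCP_lamMap {ω : frakA p →ₗ[ℂ] BK p} (hω : IsCPOn ω) {t : ℝ} (ht : 0 < t) :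
    IsCP (lamMap ω t) := (hω.isCP_cutMap ht).comp isCP_Lam

theorem isBWeightMap_zero : IsBWeightMap (0 : frakA p →ₗ[ℂ] BK p) := fun _ _ =>
  ⟨0, 0, by simp, by simp, fun _ => by simp⟩

theorem lamMap_zero (t : ℝ) : lamMap (0 : frakA p →ₗ[ℂ] BK p) t = 0 := rfl

namespace IsCoefficientPair

variable {J : Type*} {ω ϑ κ : frakA p →ₗ[ℂ] BK p} {ψ : BK p ≃ₗ[ℂ] BK p} {D : StandardData p J}
  {ζ : Module.End ℂ (BK p)}

variable (hD : IsCoefficientPair ω ψ ϑ D)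
include hD

theorem isCPOn (hω : IsQWeightMap ω) : IsCPOn ϑ := by
  refine (hD.isBWeightMap hω).isCPOn (l := 𝓝[>] (0 : ℝ)) le_rfl ?_
  filter_upwards [self_mem_nhdsWithin] with s hs
  have := (hD.isScaledLimit hω).isCP_comp le_rfl hD.w_tendsto hω hs
  rwa [comp_cutMap_eq hD.comp_eq] at this

theorem condPos_neg_coefLam (hω : IsQWeightMap ω) {s : ℝ} (hs : 0 < s) :
    CondPos (-coefLam (coefEnd ψ) ϑ s) := by
  rw [← mul_iotaAdd_eq hD.comp_eq]
  exact (hD.isScaledLimit hω).condPos le_rfl hD.w_tendsto hω hs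

/-- Perturbations by a completely positive map of the coefficient map alone. -/
theorem isPerturbation_zero (hω : IsQWeightMap ω) (hζ : IsCP ζ)
    (h : ∀ t, 0 < t → CondPos (-(coefLam (coefEnd ψ) ϑ t + ζ))) : IsPerturbation ψ ϑ ζ 0 where
  cp := hζ
  bweight := isBWeightMap_zero
  isCPOn := fun _ _ _ => matrixPos_zero
  isCPOn_sub := by
    have e : ϑ - 0 = ϑ := by abel
    rw [e]
    exact hD.isCPOn hω
  isCP_sub t ht := by
    have e : ζ - lamMap 0 t = ζ := by rw [lamMap_zero]; abel
    rwa [e]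
  condPos t ht := by
    have e : ζ - lamMap 0 t = ζ := by rw [lamMap_zero]; abel
    rw [e]
    exact h t ht

/-- If `ω` is `q`-pure, perturbations are conditionally zero in the coefficient map, and trivial
in the limiting `b`-weight map. -/
theorem condPos_neg_and_eq_zero (hp : 0 < p) (hω : IsQWeightMap ω) (hpure : IsQPure ω)
    (h : IsPerturbation ψ ϑ ζ κ) : CondPos (-ζ) ∧ κ = 0 := by
  have : Nonempty (Fin p) := ⟨⟨0, hp⟩⟩
  -- Being larger than `‖ζ(1)‖`, this `c` prevents `ζ - cι` from being positive at the identity,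
  -- which rules out one of the two comparisons.
  set c : ℝ := ‖ζ 1‖ + 1 with hc
  have hc0 : 0 ≤ c := by positivity
  have h' : IsPerturbation ψ ϑ ((c : ℂ) • 1) 0 := by
    refine hD.isPerturbation_zero hω (isCP_one.smul hc0) fun t ht => ?_
    have e : -(coefLam (coefEnd ψ) ϑ t + (c : ℂ) • 1)
        = -coefLam (coefEnd ψ) ϑ t + -((c : ℂ) • 1) := by abel
    rw [e]
    refine (hD.condPos_neg_coefLam hω ht).add ?_
    rw [smul_one_eq_derivMap]
    exact condPos_neg_derivMap _
  obtain ⟨η, hη, hκη, hlim⟩ := hD.exists_subordinate hp hω h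
  obtain ⟨η', hη', hκη', hlim'⟩ := hD.exists_subordinate hp hω h'
  rcases hpure η' η hη' hη with hge | hge
  · exfalso
    have h1 := hlim'.isCP_sub le_rfl hD.w_tendsto hlim hη'.1 hη.1 hge
    have e : coefEnd ψ + ζ - (coefEnd ψ + (c : ℂ) • 1) = ζ - (c : ℂ) • 1 := by abel
    rw [e] at h1
    obtain ⟨x, hx⟩ := exists_ne (0 : Kp p)
    have h2 := (Complex.le_def.1 (h1.nonneg_of_nonneg (A := 1) inner_self_nonneg_complex x)).1
    have h3 := re_inner_le_opNorm (ζ 1) x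
    have h4 : ⟪x, (ζ - (c : ℂ) • 1) 1 x⟫_ℂ = ⟪x, ζ 1 x⟫_ℂ - ((c * ‖x‖ ^ 2 : ℝ) : ℂ) := by
      have : (ζ - (c : ℂ) • 1) 1 x = ζ 1 x - (c : ℂ) • x := rfl
      rw [this, inner_sub_right, inner_smul_right, inner_self_eq_ofReal]
      push_cast
      rfl
    rw [h4, Complex.sub_re, Complex.ofReal_re, Complex.zero_re] at h2
    have h5 : 0 < ‖x‖ ^ 2 := by positivity
    nlinarith
  -- In the other direction `cι - ζ` is completely positive, with `cι` conditionally zero, and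
  -- `-κ|_s` is completely positive along with `κ|_s`, so `κ|_s = 0`.
  · have h1 := hlim.isCP_sub le_rfl hD.w_tendsto hlim' hη.1 hη'.1 hge
    refine ⟨?_, h.bweight.eq_of_cutMap isBWeightMap_zero fun s hs => ?_⟩
    · have e : -ζ = (coefEnd ψ + (c : ℂ) • 1 - (coefEnd ψ + ζ)) + -((c : ℂ) • 1) := by abel
      rw [e]
      refine h1.condPos.add ?_
      rw [smul_one_eq_derivMap]
      exact condPos_neg_derivMap _
    · have h2 := hlim.isCP_comp_sub le_rfl hD.w_tendsto hlim' hge hs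
      rw [comp_cutMap_eq hκη, comp_cutMap_eq hκη'] at h2
      have e : cutMap (ϑ - κ) s - cutMap (ϑ - 0) s = 0 - cutMap κ s := by
        ext1 A
        change ϑ (cut p s A) - κ (cut p s A) - (ϑ (cut p s A) - 0) = 0 - κ (cut p s A)
        abel
      rw [e] at h2
      ext1 A
      have h3 := (h.isCPOn.isCP_cutMap hs).norm_le_of_sub h2 A
      rw [LinearMap.zero_apply, norm_zero, zero_mul] at h3
      exact norm_le_zero_iff.1 h3

/-- Decompose `-(ψ + ρΛ)` as a completely positive `Ψ` plus a conditionally zero map. Since `(Ψ, 0)`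
is a perturbation, purity makes `Ψ` conditionally negative, which is the missing half. -/
theorem conditionallyZero (hp : 0 < p) (hω : IsQWeightMap ω) (hpure : IsQPure ω) :
    ConditionallyZero ((ψ : BK p →ₗ[ℂ] BK p) + D.rho ∘ₗ Lam p) := by
  have : Nonempty (Fin p) := ⟨⟨0, hp⟩⟩
  obtain ⟨Ψ, X, hΨ, hX⟩ := CondPos.exists_decomp (conditionallyPositive_iff.1 hD.add_condNeg)
  have hX' : coefEnd ψ + D.rho ∘ₗ Lam p = -Ψ - derivMap X := by
    have h1 : -(coefEnd ψ + D.rho ∘ₗ Lam p) = Ψ + derivMap X := hX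
    have h2 : coefEnd ψ + D.rho ∘ₗ Lam p = -(-(coefEnd ψ + D.rho ∘ₗ Lam p)) := by abel
    rw [h2, h1]
    abel
  have hpert : IsPerturbation ψ ϑ Ψ 0 := by
    refine hD.isPerturbation_zero hω hΨ fun t ht => ?_
    -- The correction `ρ|_s Λ - ρΛ` tends to `0`. With it, `Ψ` and `ρ` cancel exactly, leaving
    -- conditionally zero maps plus the completely positive `ϑ|_s (Λ - Λ|_t)`.
    refine CondPos.of_tendsto (l := 𝓝[>] (0 : ℝ)) (φ := fun s =>
      -(coefLam (coefEnd ψ) ϑ t + Ψ) + (D.rhoLam s - D.rho ∘ₗ Lam p)) ?_ fun A => ?_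
    · filter_upwards [eventually_mem_Ioc le_rfl ht] with s hs
      have h1 := lamMap_sub_lamMap ϑ hs.1 hs.2
      have h2 : lamMap ϑ t = (D.w s : ℂ) • 1 + derivMap (D.cross hs.1) + D.rhoLam s
          - cutMap ϑ s ∘ₗ lamBelow p t := by
        rw [← hD.represents.lamMap_eq hs.1, ← h1]; abel
      have h3 : coefEnd ψ = -Ψ - derivMap X - D.rho ∘ₗ Lam p := by rw [← hX']; abel
      have e : -(coefLam (coefEnd ψ) ϑ t + Ψ) + (D.rhoLam s - D.rho ∘ₗ Lam p)
          = derivMap X + cutMap ϑ s ∘ₗ lamBelow p t + -((D.w s : ℂ) • 1)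
            + -derivMap (D.cross hs.1) := by
        rw [coefLam, h2, h3]; abel
      rw [e, smul_one_eq_derivMap]
      exact (((condPos_derivMap X).add
        (((hD.isCPOn hω).isCP_cutMap hs.1).comp (isCP_lamBelow t)).condPos).add
          (condPos_neg_derivMap _)).add (condPos_neg_derivMap _)
    · have h1 := ((D.tendsto_rhoLam A).sub
        (tendsto_const_nhds (x := (D.rho ∘ₗ Lam p) A))).const_add
          ((-(coefLam (coefEnd ψ) ϑ t + Ψ)) A)
      have e : (-(coefLam (coefEnd ψ) ϑ t + Ψ)) A + ((D.rho ∘ₗ Lam p) A - (D.rho ∘ₗ Lam p) A)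
          = (-(coefLam (coefEnd ψ) ϑ t + Ψ)) A := by abel
      rw [e] at h1
      exact h1
  refine ⟨?_, hD.add_condNeg⟩
  have h1 : CondPos (coefEnd ψ + D.rho ∘ₗ Lam p) := by
    have e : -Ψ - derivMap X = -Ψ + -derivMap X := by abel
    rw [hX', e]
    exact (hD.condPos_neg_and_eq_zero hp hω hpure hpert).1.add (condPos_neg_derivMap X)
  exact h1

/-- Boundedness of `κ` provides a limit `ζ` of `κ|_t Λ`, so `κ` can be moved from the limiting
`b`-weight map into the coefficient map: `(ζ, κ)` is a perturbation, and purity gives `κ = 0`. -/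
theorem strictlyInfinite (hp : 0 < p) (hω : IsQWeightMap ω) (hpure : IsQPure ω) :
    StrictlyInfinite ϑ := by
  intro κ hκb hκ hκbd hϑκ
  obtain ⟨C, hC⟩ := hκbd
  set U : Ultrafilter ℝ := Ultrafilter.of (𝓝[>] (0 : ℝ)) with hU
  have hl : (U : Filter ℝ) ≤ 𝓝[>] (0 : ℝ) := Ultrafilter.of_le _
  have hpos : ∀ᶠ t in (U : Filter ℝ), 0 < t := hl self_mem_nhdsWithin
  obtain ⟨ζ, hζ⟩ := exists_end_of_norm_le U (T := lamMap κ) fun A =>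
    ⟨|C| * ‖Lam p A‖, hpos.mono fun t ht => by
      refine (hC _).trans (mul_le_mul (le_abs_self C) ?_ (norm_nonneg _) (abs_nonneg C))
      rw [coe_cut ht]
      exact norm_sandwich_le (norm_cutProj_le t) _⟩
  have hlim : ∀ (s : ℝ) (A : BK p),
      Tendsto (fun t => (lamMap κ t - lamMap κ s) A) (U : Filter ℝ) (𝓝 ((ζ - lamMap κ s) A)) :=
    fun s A => (hζ A).sub tendsto_const_nhds
  refine (hD.condPos_neg_and_eq_zero hp hω hpure (ζ := ζ) (κ := κ)
    ⟨IsCP.of_tendsto (hpos.mono fun t ht => hκ.isCP_lamMap ht) hζ, hκb, hκ, hϑκ,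
      fun s hs => IsCP.of_tendsto ?_ (hlim s), fun s hs => ?_⟩).2
  · filter_upwards [eventually_mem_Ioc hl hs] with t ht
    rw [lamMap_sub_lamMap κ ht.1 ht.2]
    exact (hκ.isCP_cutMap ht.1).comp (isCP_lamBelow s)
  · refine CondPos.of_tendsto (l := (U : Filter ℝ)) (φ := fun t =>
      -(coefLam (coefEnd ψ) ϑ s + (lamMap κ t - lamMap κ s))) ?_ fun A =>
        ((hlim s A).const_add (coefLam (coefEnd ψ) ϑ s A)).neg
    filter_upwards [eventually_mem_Ioc hl hs] with t ht
    have h1 := lamMap_sub_lamMap (ϑ - κ) ht.1 ht.2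
    have h2 : ∀ r, lamMap (ϑ - κ) r = lamMap ϑ r - lamMap κ r := fun r => rfl
    rw [h2, h2] at h1
    -- Passing from level `s` to level `t` trades the `κ` terms for `(ϑ - κ)|_t (Λ - Λ|_s)`, which
    -- is completely positive because `ϑ ≥ κ`.
    have e : -(coefLam (coefEnd ψ) ϑ s + (lamMap κ t - lamMap κ s))
        = -coefLam (coefEnd ψ) ϑ t + cutMap (ϑ - κ) t ∘ₗ lamBelow p s := by
      rw [← h1, coefLam, coefLam]
      abel
    rw [e]
    exact (hD.condPos_neg_coefLam hω ht.1).add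
      ((hϑκ.isCP_cutMap ht.1).comp (isCP_lamBelow s) :
        IsCP (cutMap (ϑ - κ) t ∘ₗ lamBelow p s)).condPos

end IsCoefficientPair

end QWeight

end

theorem theorem4p10 (p : ℕ) (hp : 0 < p) {J : Type*} [Countable J]
    (ω : QWeight.frakA p →ₗ[ℂ] QWeight.BK p) (hω : QWeight.IsQWeightMap ω)
    (h0 : QWeight.IndexZero ω) (hrange : LinearMap.range ω = ⊤)
    (ψ : QWeight.BK p ≃ₗ[ℂ] QWeight.BK p) (ϑ : QWeight.frakA p →ₗ[ℂ] QWeight.BK p)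
    (D : QWeight.StandardData p J) (hD : QWeight.IsCoefficientPair ω ψ ϑ D) :
    QWeight.IsQPure ω ↔
      QWeight.ConditionallyZero
          ((ψ : QWeight.BK p →ₗ[ℂ] QWeight.BK p) + D.rho ∘ₗ QWeight.Lam p) ∧
        QWeight.StrictlyInfinite ϑ :=
  ⟨fun h => ⟨hD.conditionallyZero hp hω h, hD.strictlyInfinite hp hω h⟩,
    fun h => hD.isQPure hp hω h.1 h.2⟩
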